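/- Setting. Let $V$ be a finite set of $n$ variables with finite domains $\Omega_v$, $|\Omega_v|\ge 2$, and let $\Phi=(V,(\Omega_v)_{v\in V},\mathcal C)$ be an atomic CSP with a finite nonempty collection $\mathcal C$ of constraints: each $C\in\mathcal C$ has a variable set $\operatorname{vbl}(C)\subseteq V$ and a forbidden assignment $\boldsymbol C\in\prod_{v\in \operatorname{vbl}(C)}\Omega_v$, and $\sigma\in\prod_v\Omega_v$ violates $C$ if and only if $\sigma(v)=\boldsymbol C(v)$ for all $v\in\operatorname{vbl}(C)$. Let $\Delta=\max_{C\in\mathcal C}|\{C'\in\mathcal C:\operatorname{vbl}(C)\cap\operatorname{vbl}(C')\ne\emptyset\}|$. A projection scheme is a family $\pi=(\pi_v)_{v\in V}$ of surjective maps $\pi_v:\Omega_v\to Q_v$ onto finite sets. Put $\boldsymbol C_\pi(v)=\pi_v(\boldsymbol C(v))$. Let $\mathbb P_\pi$ and $\mu_\pi$ be the images under $\pi$, on $\prod_v Q_v$, of the uniform distribution on $\prod_v\Omega_v$ and of the uniform distribution on the satisfying assignments of $\Phi$, respectively. For $Y\in\prod_vQ_v$ let $Y^{-v}$ be $Y$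 without its coordinate $v$. Set $$b=\max_{C\in\mathcal C}\prod_{u\in\operatorname{vbl}(C)}\frac1{|\pi_u^{-1}(\boldsymbol C_\pi(u))|},\qquad q=\max_{v,Y}d_{\mathrm{TV}}\big(\mathbb P_\pi[\operatorname{value}(v)=\cdot\,],\ \mu_\pi[\operatorname{value}(v)=\cdot\mid Y^{-v}]\big),$$ $$\overline{\operatorname{vbl}}(C)=\{v\in\operatorname{vbl}(C):|Q_v|>1\},\qquad \zeta(C)=\max_{v\in\overline{\operatorname{vbl}}(C)}\Big(1,\min\Big(\frac{(1-3b)^{\Delta}q}{\mathbb P_\pi[\operatorname{value}(v)=\boldsymbol C_\pi(v)]},\,2\Delta\Big)\Big).$$ For $\eta\in(0,1/2)$ and real $\kappa$, call $\pi$ admissible with parameters $\eta,\kappa$ if $\overline{\operatorname{vbl}}(C)\neq\emptyset$ for every $C\in\mathcal C$ and 1. $b\le\eta/(300\Delta)$; 2. $\kappa\ge 4\log(3000\Delta)$ and, for every $C\in\mathcal C$, $$|\overline{\operatorname{vbl}}(C)|^2\,\kappa^2\,\zeta(C)\prod_{v\in\overline{\operatorname{vbl}}(C)}\Big((1-3b)^{-\Delta}\,\mathbb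 P_\pi[\operatorname{value}(v)=\boldsymbol C_\pi(v)]+e^{-\kappa/3}\Big)\le(60000\Delta)^{-2};$$ 3. $\tfrac12\mathbb P_\pi[\operatorname{value}(v)=\boldsymbol C_\pi(v)]\le\mathbb P_\pi[\operatorname{value}(v)=\boldsymbol C'_\pi(v)]\le2\,\mathbb P_\pi[\operatorname{value}(v)=\boldsymbol C_\pi(v)]$ whenever $v\in\operatorname{vbl}(C)\cap\operatorname{vbl}(C')$. The Glauber dynamics for $\mu_\pi$ is the Markov chain $(Y_t)_{t\ge0}$ on $\prod_vQ_v$ which in each step chooses $v\in V$ uniformly at random and replaces $Y(v)$ by a sample from $\mu_\pi[\operatorname{value}(v)=\cdot\mid Y^{-v}]$, keeping the other coordinates. Proposition. There exist absolute constants $c,C_0\ge1$ such that the following holds. Let $\Phi$ be an atomic CSP as above with $n\ge c$ variables, let $\eta\in(0,1/2)$, and let $\pi$ be a projection scheme admissible with parameters $\eta,\kappa$. Then for every initial state $Y_0\in\prod_v Q_v$ and every $\delta\in(0,1/2)$, with $T=\lceil C_0\,\kappa\, n\log(n\Delta/\delta)\rceil$, the total variation distance between the distribution of $Y_T$ and $\mu_\pi$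 is at most $\delta^4$. -/

import Mathlib

universe u₁ u₂ u₃ u₄

/-- A constraint (a truth-valued map on assignments) depends on the variable `v` if two assignments
that differ only in `v` receive different truth values. -/
def DependsOnVar {V : Type u₁} {Ω : V → Type u₂} (C : (∀ v, Ω v) → Prop) (v : V) : Prop :=
  ∃ σ τ : ∀ v, Ω v, (∀ w, w ≠ v → σ w = τ w) ∧ ¬ (C σ ↔ C τ)

/-- A constraint satisfaction problem with variables `V`, domains `Ω v`, and constraints indexed
by `ι`. Every constraint comes with a fixed set `vbl i` containing all variables it depends on. -/
structure CSP (V : Type u₁) (Ω : V → Type u₂) (ι : Type u₃) where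
  /-- `holds i σ` : the assignment `σ` satisfies the constraint `i`. -/
  holds : ι → (∀ v, Ω v) → Prop
  vbl : ι → Finset V
  mem_vbl : ∀ i v, DependsOnVar (holds i) v → v ∈ vbl i

/-- An atomic CSP: each constraint `i` is violated by exactly one assignment to its variables
`vbl i`, recorded as `bad i`. (Only the values of `bad i` on `vbl i` are meaningful, and only these
are used below.) -/
structure AtomicCSP (V : Type u₁) (Ω : V → Type u₂) (ι : Type u₃) extends CSP V Ω ι where
  bad : ι → ∀ v, Ω v
  not_holds_iff : ∀ i σ, ¬ holds i σ ↔ ∀ v ∈ vbl i, σ v = bad i v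

noncomputable section

/-- Total variation distance of two (finitely supported) mass functions on a finite type. -/
def tvDist {α : Type*} [Fintype α] (p q : α → ℝ) : ℝ := (∑ a, |p a - q a|) / 2

namespace AtomicCSP

variable {V : Type u₁} {Ω : V → Type u₂} {ι : Type u₃} {Q : V → Type u₄}

/-- `σ` satisfies all the constraints. -/
def Satisfies (Φ : AtomicCSP V Ω ι) (σ : ∀ v, Ω v) : Prop := ∀ i, Φ.holds i σ

open scoped Classical in
/-- The degree `Δ`: the largest number of constraints (including itself) that share a variable
with a given constraint. -/
def degree [Fintype ι] (Φ : AtomicCSP V Ω ι) : ℕ :=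
  Finset.univ.sup fun i => (Finset.univ.filter fun j => (Φ.vbl i ∩ Φ.vbl j).Nonempty).card

/-- The marginal at `v` of `ℙ_π`, the image under `π` of the uniform distribution on all
assignments: `ℙ_π[value(v) = a] = |π_v⁻¹(a)| / |Ω_v|`. -/
def projMarginal (π : ∀ v, Ω v → Q v) (v : V) (a : Q v) : ℝ :=
  (Nat.card {x : Ω v // π v x = a} : ℝ) / Nat.card (Ω v)

/-- `μ_π`, the image under `π` of the uniform distribution on satisfying assignments. -/
def projMeasure (Φ : AtomicCSP V Ω ι) (π : ∀ v, Ω v → Q v) (Y : ∀ v, Q v) : ℝ :=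
  (Nat.card {σ : ∀ v, Ω v // Φ.Satisfies σ ∧ ∀ v, π v (σ v) = Y v} : ℝ) /
    Nat.card {σ : ∀ v, Ω v // Φ.Satisfies σ}

open scoped Classical in
/-- The conditional marginal `μ_π[value(v) = a | Y^{-v}]`, where `Y^{-v}` is `Y` without its
coordinate `v`. -/
def condMarginal [∀ v, Fintype (Q v)] (Φ : AtomicCSP V Ω ι) (π : ∀ v, Ω v → Q v) (v : V)
    (Y : ∀ v, Q v) (a : Q v) : ℝ :=
  Φ.projMeasure π (Function.update Y v a) / ∑ a', Φ.projMeasure π (Function.update Y v a')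

/-- `b(C) = ∏_{u ∈ vbl(C)} |π_u⁻¹(C_π(u))|⁻¹`, where `C_π(u) = π_u(C(u))`. -/
def bC (Φ : AtomicCSP V Ω ι) (π : ∀ v, Ω v → Q v) (i : ι) : ℝ :=
  ∏ u ∈ Φ.vbl i, (Nat.card {x : Ω u // π u x = π u (Φ.bad i u)} : ℝ)⁻¹

/-- `b = max_C b(C)`. -/
def bMax (Φ : AtomicCSP V Ω ι) (π : ∀ v, Ω v → Q v) : ℝ := ⨆ i, Φ.bC π i

/-- The largest distance, over variables `v` and configurations `Y`, of the conditional marginal of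
`μ_π` at `v` given `Y^{-v}` from the marginal of `ℙ_π` at `v`. -/
def qMax [∀ v, Fintype (Q v)] (Φ : AtomicCSP V Ω ι) (π : ∀ v, Ω v → Q v) : ℝ :=
  ⨆ p : V × (∀ v, Q v), tvDist (projMarginal π p.1) (Φ.condMarginal π p.1 p.2)

open scoped Classical in
/-- The variables `v` of a constraint for which `|Q_v| > 1`. -/
def vblBar (Q : V → Type u₄) (Φ : AtomicCSP V Ω ι) (i : ι) : Finset V :=
  (Φ.vbl i).filter fun v => 1 < Nat.card (Q v)

/-- `ζ(C) = max_{v ∈ vblBar(C)} (1, min((1-3b)^Δ q / ℙ_π[value(v) = C_π(v)], 2Δ))`. -/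
def zeta [Fintype ι] [∀ v, Fintype (Q v)] (Φ : AtomicCSP V Ω ι) (π : ∀ v, Ω v → Q v)
    (i : ι) : ℝ :=
  max 1 (⨆ v : {v // v ∈ Φ.vblBar Q i},
    min ((1 - 3 * Φ.bMax π) ^ Φ.degree * Φ.qMax π / projMarginal π v.1 (π v.1 (Φ.bad i v.1)))
      (2 * (Φ.degree : ℝ)))

/-- Admissibility of a projection scheme `π` with parameters `η` and `κ`. -/
structure IsAdmissible [Fintype ι] [∀ v, Fintype (Q v)] (Φ : AtomicCSP V Ω ι)
    (π : ∀ v, Ω v → Q v) (η κ : ℝ) : Prop where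
  /-- Every symbol of `Q v` has a preimage (from which one can sample). -/
  surjective : ∀ v, Function.Surjective (π v)
  /-- Every constraint contains a variable that is not projected to a single point. -/
  vblBar_nonempty : ∀ i, (Φ.vblBar Q i).Nonempty
  b_le : Φ.bMax π ≤ η / (300 * Φ.degree)
  le_kappa : 4 * Real.log (3000 * Φ.degree) ≤ κ
  prod_le : ∀ i, ((Φ.vblBar Q i).card : ℝ) ^ 2 * κ ^ 2 * Φ.zeta π i *
      ∏ v ∈ Φ.vblBar Q i, (((1 - 3 * Φ.bMax π) ^ Φ.degree)⁻¹ *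
        projMarginal π v (π v (Φ.bad i v)) + Real.exp (-κ / 3)) ≤
    ((60000 * (Φ.degree : ℝ)) ^ 2)⁻¹
  comparable : ∀ i j v, v ∈ Φ.vbl i → v ∈ Φ.vbl j →
    1 / 2 * projMarginal π v (π v (Φ.bad i v)) ≤ projMarginal π v (π v (Φ.bad j v)) ∧
      projMarginal π v (π v (Φ.bad j v)) ≤ 2 * projMarginal π v (π v (Φ.bad i v))

open scoped Classical in
/-- One step of the Glauber dynamics for `μ_π`: the probability of moving from `Y` to `Y'` when a
uniformly random variable `v` is chosen and its value is resampled from `μ_π[value(v) = · | Y^{-v}]`,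
all other values being kept. -/
def glauberStep [Fintype V] [∀ v, Fintype (Q v)] (Φ : AtomicCSP V Ω ι) (π : ∀ v, Ω v → Q v)
    (Y Y' : ∀ v, Q v) : ℝ :=
  ∑ v, (Fintype.card V : ℝ)⁻¹ *
    ∑ a, if Y' = Function.update Y v a then Φ.condMarginal π v Y a else 0

open scoped Classical in
/-- The distribution of the state `Y_t` of the Glauber dynamics for `μ_π` started at `Y₀`. -/
def glauberLaw [Fintype V] [∀ v, Fintype (Q v)] (Φ : AtomicCSP V Ω ι) (π : ∀ v, Ω v → Q v)
    (Y₀ : ∀ v, Q v) : ℕ → (∀ v, Q v) → ℝ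
  | 0, Y => if Y = Y₀ then 1 else 0
  | t + 1, Y => ∑ Z, glauberLaw Φ π Y₀ t Z * Φ.glauberStep π Z Y

end AtomicCSP

end

/-!
The chain started at `Y₀` is compared with a stationary copy by *information percolation*: both
chains resample the same variables, through maximal couplings of the conditional marginals, and they
can differ at time `T` only if a discrepancy has survived all along, which leaves a long trace in
space-time whose probability is summable.

*Propagation.* Two configurations `X`, `Y` have equal conditional marginals at `v` unless the
constraints that are not already satisfied off `v` by both of them connect `v` to a discrepancy
(`exists_cluster_ne`): otherwise satisfying assignments over `X` and `Y` can be exchanged on the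
cluster of `v`. Hence a discrepancy at `u` created by an update leads back to an earlier one, along
constraints violated, up to one variable, by one of the configurations. Only discrepancies at which
one of the two values is a forbidden one can propagate further.

*Nodes.* Time is cut into blocks of `w ≈ κ n` steps, so that a variable misses a whole block with
probability at most `e^{-κ}`. A node is a constraint together with a run of blocks. Following a
relevant discrepancy at time `J₁ w` backwards gives a path of adjacent *occurring* nodes down to the
initial blocks (`exists_reached`); a shortest such path is induced (`exists_induced_path`). Without
relevant discrepancies at time `J₁ w` the chains coalesce as soon as every variable has been updated
(`eq_of_not_relevant`).

*Probabilities.* By the local lemma (`le_card_satBox_union`) an update chooses a forbidden value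
`C_π(u)` with probability at most `(1 - 3b)^{-Δ} ℙ_π[value(u) = C_π(u)]` (`condMarginal_le`), and
the coupling creates a relevant discrepancy with probability at most `2 ζ(C)` times that
(`sum_coupling_relevant_le`). Given the schedule of updates, pairwise non-adjacent nodes constrain
distinct updates, so that the probability of their joint occurrence is at most the product of
weights (`pairE_occurs_le`), and admissibility bounds the weight of a node of `m + 1` blocks by
`(30000 Δ)^{-2(m+1)}` (`nodeWeight_le_pow`). In an induced path the nodes of even index are pairwise
non-adjacent, as are those of odd index; taking the geometric mean of the two bounds, a path has
probability at most the product of the `(30000 Δ)^{-(m+1)}` over all its nodes (`pairE_path_le`).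
Summation over paths (`sum_path_le`) leaves a factor `1 / 100` for each block between the two ends,
and with about `log (n Δ / δ)` blocks in each of the three phases the total is at most `δ ^ 4`.
-/

noncomputable section

open scoped Classical

namespace AtomicCSP

variable {V : Type u₁} {Ω : V → Type u₂} {ι : Type u₃} {Q : V → Type u₄}

/-! ### The local lemma on a box -/

theorem holds_congr (Φ : AtomicCSP V Ω ι) {i : ι} {σ τ : ∀ v, Ω v}
    (h : ∀ v ∈ Φ.vbl i, σ v = τ v) : Φ.holds i σ ↔ Φ.holds i τ := by
  have := Φ.not_holds_iff i σ
  have h2 := Φ.not_holds_iff i τ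
  have : (¬ Φ.holds i σ) ↔ ¬ Φ.holds i τ := by
    rw [this, h2]
    exact forall₂_congr fun v hv => by rw [h v hv]
  tauto

section Box

variable [Fintype V]

/-- The assignments in the box `∏ A v` that satisfy all the constraints in `S`. -/
def satBox (Φ : AtomicCSP V Ω ι) (A : ∀ v, Finset (Ω v)) (S : Finset ι) :
    Finset (∀ v, Ω v) :=
  (Fintype.piFinset A).filter fun σ => ∀ i ∈ S, Φ.holds i σ

theorem mem_satBox {Φ : AtomicCSP V Ω ι} {A : ∀ v, Finset (Ω v)} {S : Finset ι}
    {σ : ∀ v, Ω v} : σ ∈ Φ.satBox A S ↔ (∀ v, σ v ∈ A v) ∧ ∀ i ∈ S, Φ.holds i σ := by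
  simp [satBox]

theorem satBox_anti (Φ : AtomicCSP V Ω ι) (A : ∀ v, Finset (Ω v)) {S S' : Finset ι}
    (h : S ⊆ S') : Φ.satBox A S' ⊆ Φ.satBox A S := fun σ hσ => by
  rw [mem_satBox] at hσ ⊢
  exact ⟨hσ.1, fun i hi => hσ.2 i (h hi)⟩

/-- Violating `i` is independent of the constraints that share no variable with `i`: the values on
`vbl i` of an assignment violating `i` can be replaced by arbitrary ones. -/
theorem card_violated_mul_le (Φ : AtomicCSP V Ω ι) (A : ∀ v, Finset (Ω v)) (S : Finset ι) (i : ι)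
    (hS : ∀ k ∈ S, Disjoint (Φ.vbl i) (Φ.vbl k)) :
    ((Φ.satBox A S).filter fun σ => ¬ Φ.holds i σ).card * ∏ u ∈ Φ.vbl i, (A u).card
      ≤ (Φ.satBox A S).card := by
  have hcard : ∏ u ∈ Φ.vbl i, (A u).card
      = (Fintype.piFinset fun u => if u ∈ Φ.vbl i then A u else {Φ.bad i u}).card := by
    rw [Fintype.card_piFinset, ← Finset.prod_subset (Finset.subset_univ (Φ.vbl i))]
    · exact Finset.prod_congr rfl fun u hu => by simp [hu]
    · intro u _ hu; simp [hu]
  rw [hcard, ← Finset.card_product]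
  refine Finset.card_le_card_of_injOn
    (fun x u => if u ∈ Φ.vbl i then x.2 u else x.1 u) ?_ ?_
  · rintro ⟨σ, τ⟩ h
    simp only [Finset.coe_product, Set.mem_prod, Finset.mem_coe, Finset.mem_filter,
      Fintype.mem_piFinset, mem_satBox] at h ⊢
    obtain ⟨⟨⟨h1, h2⟩, -⟩, h4⟩ := h
    refine ⟨fun v => ?_, fun k hk => ?_⟩
    · by_cases hv : v ∈ Φ.vbl i
      · have := h4 v; simp only [hv, if_true] at this ⊢; exact this
      · simp only [hv, if_false]; exact h1 v
    · refine (Φ.holds_congr fun v hv => ?_).2 (h2 k hk)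
      have : v ∉ Φ.vbl i := fun h => Finset.disjoint_left.1 (hS k hk) h hv
      simp [this]
  · rintro ⟨σ, τ⟩ h ⟨σ', τ'⟩ h' heq
    simp only [Finset.coe_product, Set.mem_prod, Finset.mem_coe, Finset.mem_filter,
      Fintype.mem_piFinset, Φ.not_holds_iff] at h h'
    have e : ∀ u, (if u ∈ Φ.vbl i then τ u else σ u) = if u ∈ Φ.vbl i then τ' u else σ' u :=
      fun u => congrFun heq u
    refine Prod.ext (funext fun u => ?_) (funext fun u => ?_)
    · by_cases hu : u ∈ Φ.vbl i
      · exact (h.1.2 u hu).trans (h'.1.2 u hu).symm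
      · simpa [hu] using e u
    · by_cases hu : u ∈ Φ.vbl i
      · simpa [hu] using e u
      · have h1 := h.2 u
        have h2 := h'.2 u
        simp only [hu, if_false, Finset.mem_singleton] at h1 h2
        simp only [h1, h2]

theorem card_satBox_insert (Φ : AtomicCSP V Ω ι) (A : ∀ v, Finset (Ω v)) (S : Finset ι) (i : ι) :
    ((Φ.satBox A (insert i S)).card : ℝ) =
      (Φ.satBox A S).card - ((Φ.satBox A S).filter fun σ => ¬ Φ.holds i σ).card := by
  have : Φ.satBox A (insert i S) = (Φ.satBox A S).filter fun σ => Φ.holds i σ := by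
    ext σ
    simp only [mem_satBox, Finset.mem_filter, Finset.mem_insert, forall_eq_or_imp]
    tauto
  rw [this, ← Finset.card_filter_add_card_filter_not (s := Φ.satBox A S) (fun σ => Φ.holds i σ)]
  push_cast; ring

/-- If the local lemma estimate holds for all sets of fewer than `N` constraints, then adding
constraints to `S` one at a time costs a factor `1 - 3b` each. -/
theorem satBox_union_of_violated_le (Φ : AtomicCSP V Ω ι) (A : ∀ v, Finset (Ω v)) {b : ℝ}
    (hb3 : 3 * b ≤ 1) {N : ℕ}
    (H : ∀ S : Finset ι, S.card < N → ∀ i ∉ S,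
      (((Φ.satBox A S).filter fun σ => ¬ Φ.holds i σ).card : ℝ) ≤ 3 * b * (Φ.satBox A S).card)
    (S R : Finset ι) (hd : Disjoint S R) (hN : S.card + R.card ≤ N) :
    (1 - 3 * b) ^ R.card * (Φ.satBox A S).card ≤ ((Φ.satBox A (S ∪ R)).card : ℝ) := by
  induction R using Finset.induction_on with
  | empty => simp
  | insert i R hi ih =>
    rw [Finset.disjoint_insert_right] at hd
    rw [Finset.card_insert_of_notMem hi] at hN ⊢
    have h1 := ih hd.2 (by omega)
    have hiS : i ∉ S ∪ R := by simp [hi, hd.1]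
    have h2 := H (S ∪ R) (by rw [Finset.card_union_of_disjoint hd.2]; omega) i hiS
    rw [Finset.union_insert, card_satBox_insert, pow_succ]
    nlinarith

variable [Fintype ι]

/-- The Lovász local lemma on a box, for atomic constraints of probability at most `b`. -/
theorem card_violated_le (Φ : AtomicCSP V Ω ι) (A : ∀ v, Finset (Ω v)) {b : ℝ} (hb : 0 ≤ b)
    (hbD : 3 * b * Φ.degree ≤ 1 / 2)
    (hA : ∀ i, (∀ u ∈ Φ.vbl i, Φ.bad i u ∈ A u) → 1 ≤ b * ∏ u ∈ Φ.vbl i, ((A u).card : ℝ))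
    (hne : ∀ i, (Φ.vbl i).Nonempty)
    (S : Finset ι) (i : ι) (hi : i ∉ S) :
    (((Φ.satBox A S).filter fun σ => ¬ Φ.holds i σ).card : ℝ) ≤ 3 * b * (Φ.satBox A S).card := by
  induction hn : S.card using Nat.strong_induction_on generalizing S i with
  | _ n ih =>
  subst hn
  -- The constraints of `S₂` are independent of `i`, and dropping the at most `Δ - 1` constraints
  -- of `S₁` costs at most a factor `2`.
  set S₁ := S.filter fun k => (Φ.vbl i ∩ Φ.vbl k).Nonempty with hS₁
  set S₂ := S.filter fun k => ¬ (Φ.vbl i ∩ Φ.vbl k).Nonempty with hS₂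
  have hdeg : S₁.card + 1 ≤ Φ.degree := by
    refine le_trans ?_ (Finset.le_sup (f := fun i => (Finset.univ.filter
      fun j => (Φ.vbl i ∩ Φ.vbl j).Nonempty).card) (Finset.mem_univ i))
    rw [← Finset.card_insert_of_notMem (s := S₁) (a := i) (by simp [hS₁, hi])]
    refine Finset.card_le_card fun k hk => ?_
    rcases Finset.mem_insert.1 hk with rfl | hk
    · simpa using hne k
    · simpa using (Finset.mem_filter.1 hk).2
  have hD : (1 : ℝ) ≤ Φ.degree := by exact_mod_cast (by omega : 1 ≤ Φ.degree)
  have hb3 : 3 * b ≤ 1 := by nlinarith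
  have hunion : S₂ ∪ S₁ = S := by
    rw [Finset.union_comm]; exact Finset.filter_union_filter_not_eq _ S
  have hdisj : Disjoint S₂ S₁ := (Finset.disjoint_filter_filter_not S S _).symm
  have h1 := Φ.satBox_union_of_violated_le A hb3 (N := S.card)
    (fun S' hS' i hi => ih S'.card hS' S' i hi rfl) S₂ S₁ hdisj
    (by rw [← Finset.card_union_of_disjoint hdisj, hunion])
  rw [hunion] at h1
  have h2 : (1 / 2 : ℝ) ≤ (1 - 3 * b) ^ S₁.card := by
    have := one_add_mul_le_pow (a := -(3 * b)) (by linarith) S₁.card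
    have h3 : (S₁.card : ℝ) ≤ Φ.degree := by exact_mod_cast (by omega : S₁.card ≤ Φ.degree)
    have h4 : (1 + -(3 * b)) = 1 - 3 * b := by ring
    rw [h4] at this
    nlinarith
  have h3 : (((Φ.satBox A S₂).filter fun σ => ¬ Φ.holds i σ).card : ℝ)
      ≤ b * (Φ.satBox A S₂).card := by
    by_cases hbad : ∀ u ∈ Φ.vbl i, Φ.bad i u ∈ A u
    · have h4 := Φ.card_violated_mul_le A S₂ i (fun k hk => by
        have := (Finset.mem_filter.1 hk).2
        rwa [Finset.not_nonempty_iff_eq_empty, ← Finset.disjoint_iff_inter_eq_empty] at this)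
      have h5 : (((Φ.satBox A S₂).filter fun σ => ¬ Φ.holds i σ).card : ℝ)
          * ∏ u ∈ Φ.vbl i, ((A u).card : ℝ) ≤ (Φ.satBox A S₂).card := by exact_mod_cast h4
      have h6 := hA i hbad
      have h7 : (0 : ℝ) ≤ (((Φ.satBox A S₂).filter fun σ => ¬ Φ.holds i σ).card : ℝ) := by
        positivity
      nlinarith
    · have : ((Φ.satBox A S₂).filter fun σ => ¬ Φ.holds i σ) = ∅ := by
        refine Finset.filter_eq_empty_iff.2 fun σ hσ hv => hbad fun u hu => ?_
        rw [← (Φ.not_holds_iff i σ).1 hv u hu]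
        exact (mem_satBox.1 hσ).1 u
      rw [this]; simp; positivity
  have h4 : (((Φ.satBox A S).filter fun σ => ¬ Φ.holds i σ).card : ℝ)
      ≤ ((Φ.satBox A S₂).filter fun σ => ¬ Φ.holds i σ).card := by
    exact_mod_cast Finset.card_le_card (Finset.filter_subset_filter _
      (Φ.satBox_anti A (Finset.filter_subset _ _)))
  have h5 : (0 : ℝ) ≤ (Φ.satBox A S₂).card := by positivity
  nlinarith

/-- The local lemma: imposing one more constraint retains a proportion of at least `1 - 3b` of the
assignments. -/
theorem le_card_satBox_union (Φ : AtomicCSP V Ω ι) (A : ∀ v, Finset (Ω v)) {b : ℝ} (hb : 0 ≤ b)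
    (hb3 : 3 * b ≤ 1) (hbD : 3 * b * Φ.degree ≤ 1 / 2)
    (hA : ∀ i, (∀ u ∈ Φ.vbl i, Φ.bad i u ∈ A u) → 1 ≤ b * ∏ u ∈ Φ.vbl i, ((A u).card : ℝ))
    (hne : ∀ i, (Φ.vbl i).Nonempty) (S R : Finset ι) (hd : Disjoint S R) :
    (1 - 3 * b) ^ R.card * (Φ.satBox A S).card ≤ ((Φ.satBox A (S ∪ R)).card : ℝ) :=
  Φ.satBox_union_of_violated_le A hb3 (N := S.card + R.card)
    (fun S' _ i hi => Φ.card_violated_le A hb hbD hA hne S' i hi) S R hd le_rfl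

/-- Conditioned on satisfying all constraints, the value of `v` lies in `F` with probability at most
`(1 - 3b)^{-Δ}` times the unconditioned one. -/
theorem card_satBox_filter_mul_le (Φ : AtomicCSP V Ω ι) (A : ∀ v, Finset (Ω v)) {b : ℝ}
    (hb : 0 ≤ b) (hb3 : 3 * b ≤ 1) (hbD : 3 * b * Φ.degree ≤ 1 / 2)
    (hA : ∀ i, (∀ u ∈ Φ.vbl i, Φ.bad i u ∈ A u) → 1 ≤ b * ∏ u ∈ Φ.vbl i, ((A u).card : ℝ))
    (hne : ∀ i, (Φ.vbl i).Nonempty) (v : V) (F : Finset (Ω v)) :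
    (1 - 3 * b) ^ Φ.degree *
      ((((Φ.satBox A Finset.univ).filter fun σ => σ v ∈ F).card : ℝ) * (A v).card) ≤
      F.card * (Φ.satBox A Finset.univ).card := by
  set S := Finset.univ.filter fun i => v ∉ Φ.vbl i
  set R := Finset.univ.filter fun i => v ∈ Φ.vbl i with hR
  have hSR : S ∪ R = Finset.univ := by
    rw [Finset.union_comm]; exact Finset.filter_union_filter_not_eq _ _
  have h1 := Φ.le_card_satBox_union A hb hb3 hbD hA hne S R
    (Finset.disjoint_filter_filter_not _ _ _).symm
  rw [hSR] at h1
  have hRD : R.card ≤ Φ.degree := by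
    rcases R.eq_empty_or_nonempty with h | ⟨i, hi⟩
    · simp [h]
    · refine le_trans (Finset.card_le_card fun k hk => ?_)
        (Finset.le_sup (f := fun i => (Finset.univ.filter
          fun j => (Φ.vbl i ∩ Φ.vbl j).Nonempty).card) (Finset.mem_univ i))
      simp only [hR, Finset.mem_filter, Finset.mem_univ, true_and] at hk hi ⊢
      exact ⟨v, Finset.mem_inter.2 ⟨hi, hk⟩⟩
  have h2 : ((Φ.satBox A S).filter fun σ => σ v ∈ F).card * (A v).card
      ≤ F.card * (Φ.satBox A S).card := by
    rw [← Finset.card_product, ← Finset.card_product]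
    refine Finset.card_le_card_of_injOn (fun x => (x.1 v, Function.update x.1 v x.2)) ?_ ?_
    · rintro ⟨σ, x⟩ h
      simp only [Finset.coe_product, Set.mem_prod, Finset.mem_coe, Finset.mem_filter,
        mem_satBox] at h ⊢
      obtain ⟨⟨⟨h1, h2⟩, h3⟩, h4⟩ := h
      refine ⟨h3, fun u => ?_, fun k hk => ?_⟩
      · by_cases hu : u = v
        · subst hu; simpa using h4
        · simpa [hu] using h1 u
      · refine (Φ.holds_congr fun u hu => ?_).2 (h2 k hk)
        have : u ≠ v := by
          rintro rfl; exact (Finset.mem_filter.1 hk).2 hu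
        simp [this]
    · rintro ⟨σ, x⟩ - ⟨σ', x'⟩ - heq
      simp only [Prod.mk.injEq] at heq
      have e := fun u => congrFun heq.2 u
      refine Prod.ext (funext fun u => ?_) ?_
      · by_cases hu : u = v
        · subst hu; exact heq.1
        · simpa [hu] using e u
      · simpa using e v
  have h3 : (((Φ.satBox A Finset.univ).filter fun σ => σ v ∈ F).card : ℝ)
      ≤ ((Φ.satBox A S).filter fun σ => σ v ∈ F).card := by
    exact_mod_cast Finset.card_le_card (Finset.filter_subset_filter _
      (Φ.satBox_anti A (Finset.subset_univ _)))
  have h2' : ((((Φ.satBox A S).filter fun σ => σ v ∈ F).card : ℝ) * (A v).card)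
      ≤ F.card * (Φ.satBox A S).card := by exact_mod_cast h2
  have h4 : (1 - 3 * b) ^ Φ.degree ≤ (1 - 3 * b) ^ R.card :=
    pow_le_pow_of_le_one (by linarith) (by linarith) hRD
  have h0 : 0 ≤ (1 - 3 * b) ^ Φ.degree := pow_nonneg (by linarith) _
  calc _ ≤ (1 - 3 * b) ^ Φ.degree * (F.card * (Φ.satBox A S).card) := by
        refine mul_le_mul_of_nonneg_left (le_trans ?_ h2') h0
        gcongr
    _ = F.card * ((1 - 3 * b) ^ Φ.degree * (Φ.satBox A S).card) := by ring
    _ ≤ F.card * ((1 - 3 * b) ^ R.card * (Φ.satBox A S).card) := by gcongr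
    _ ≤ _ := by gcongr

end Box

/-! ### Marginals of the projected measure -/

section Marginals

variable [Fintype V] [∀ v, Fintype (Ω v)] [Fintype ι] [∀ v, Fintype (Q v)]

/-- The number of satisfying assignments projecting to `Y`. -/
def liftCount (Φ : AtomicCSP V Ω ι) (π : ∀ v, Ω v → Q v) (Y : ∀ v, Q v) : ℕ :=
  Nat.card {σ : ∀ v, Ω v // Φ.Satisfies σ ∧ ∀ v, π v (σ v) = Y v}

/-- The box of assignments that project to `Y` off the variable `v`. -/
def offBox (π : ∀ v, Ω v → Q v) (v : V) (Y : ∀ v, Q v) (u : V) : Finset (Ω u) :=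
  Finset.univ.filter fun x => u ≠ v → π u x = Y u

omit [∀ v, Fintype (Q v)] in
theorem liftCount_update (Φ : AtomicCSP V Ω ι) (π : ∀ v, Ω v → Q v) (v : V) (Y : ∀ v, Q v)
    (a : Q v) : Φ.liftCount π (Function.update Y v a) =
      ((Φ.satBox (offBox π v Y) Finset.univ).filter fun σ => π v (σ v) = a).card := by
  rw [liftCount, Nat.card_eq_fintype_card, Fintype.card_subtype]
  congr 1
  ext σ
  rw [Finset.mem_filter, Finset.mem_filter, mem_satBox]
  simp only [offBox, Satisfies, Finset.mem_filter, Finset.mem_univ, true_and, forall_true_left]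
  constructor
  · rintro ⟨h1, h2⟩
    refine ⟨⟨fun u hu => by simpa [hu] using h2 u, h1⟩, by simpa using h2 v⟩
  · rintro ⟨⟨h1, h2⟩, h3⟩
    refine ⟨h2, fun u => ?_⟩
    by_cases hu : u = v
    · subst hu; simpa using h3
    · simpa [hu] using h1 u hu

theorem sum_liftCount_update (Φ : AtomicCSP V Ω ι) (π : ∀ v, Ω v → Q v) (v : V) (Y : ∀ v, Q v) :
    ∑ a, Φ.liftCount π (Function.update Y v a) =
      (Φ.satBox (offBox π v Y) Finset.univ).card := by
  simp_rw [liftCount_update]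
  exact (Finset.card_eq_sum_card_fiberwise (fun _ _ => Finset.mem_coe.2 (Finset.mem_univ _))).symm

omit [Fintype ι] in
theorem sum_liftCount (Φ : AtomicCSP V Ω ι) (π : ∀ v, Ω v → Q v) :
    ∑ Y, Φ.liftCount π Y = Nat.card {σ : ∀ v, Ω v // Φ.Satisfies σ} := by
  rw [Nat.card_eq_fintype_card, Fintype.card_subtype, Finset.card_eq_sum_card_fiberwise
    (f := fun σ v => π v (σ v)) (t := Finset.univ)
    (fun _ _ => Finset.mem_coe.2 (Finset.mem_univ _))]
  refine Finset.sum_congr rfl fun Y _ => ?_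
  rw [liftCount, Nat.card_eq_fintype_card, Fintype.card_subtype, Finset.filter_filter]
  congr 1
  ext σ
  simp [funext_iff]

variable {Φ : AtomicCSP V Ω ι} {π : ∀ v, Ω v → Q v} {η κ : ℝ}

omit [Fintype V] [∀ v, Fintype (Ω v)] in
theorem IsAdmissible.vbl_nonempty (h : Φ.IsAdmissible π η κ) (i : ι) : (Φ.vbl i).Nonempty :=
  (h.vblBar_nonempty i).mono (Finset.filter_subset _ _)

omit [Fintype V] [∀ v, Fintype (Ω v)] in
theorem card_inter_le_degree (Φ : AtomicCSP V Ω ι) (i : ι) :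
    (Finset.univ.filter fun j => (Φ.vbl i ∩ Φ.vbl j).Nonempty).card ≤ Φ.degree :=
  Finset.le_sup (f := fun i => (Finset.univ.filter
          fun j => (Φ.vbl i ∩ Φ.vbl j).Nonempty).card) (Finset.mem_univ i)

omit [Fintype V] [∀ v, Fintype (Ω v)] in
theorem card_mem_vbl_le_degree (Φ : AtomicCSP V Ω ι) (v : V) :
    (Finset.univ.filter fun j => v ∈ Φ.vbl j).card ≤ Φ.degree := by
  rcases (Finset.univ.filter fun j => v ∈ Φ.vbl j).eq_empty_or_nonempty with h | ⟨i, hi⟩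
  · simp [h]
  · refine le_trans (Finset.card_le_card fun k hk => ?_) (Φ.card_inter_le_degree i)
    simp only [Finset.mem_filter, Finset.mem_univ, true_and] at hk hi ⊢
    exact ⟨v, Finset.mem_inter.2 ⟨hi, hk⟩⟩

omit [Fintype V] [∀ v, Fintype (Ω v)] in
theorem IsAdmissible.one_le_degree [Nonempty ι] (h : Φ.IsAdmissible π η κ) :
    (1 : ℝ) ≤ Φ.degree := by
  obtain ⟨i⟩ := ‹Nonempty ι›
  have := Φ.card_inter_le_degree i
  have h2 : 0 < (Finset.univ.filter fun j => (Φ.vbl i ∩ Φ.vbl j).Nonempty).card :=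
    Finset.card_pos.2 ⟨i, by simpa using h.vbl_nonempty i⟩
  exact_mod_cast (by omega : 1 ≤ Φ.degree)

omit [Fintype V] in
theorem IsAdmissible.card_fiber_pos (h : Φ.IsAdmissible π η κ) (v : V) (a : Q v) :
    0 < Nat.card {x : Ω v // π v x = a} := by
  obtain ⟨x, hx⟩ := h.surjective v a
  have : Nonempty {x : Ω v // π v x = a} := ⟨⟨x, hx⟩⟩
  exact Nat.card_pos

omit [Fintype V] [∀ v, Fintype (Ω v)] [Fintype ι] [∀ v, Fintype (Q v)] in
theorem bMax_nonneg : 0 ≤ Φ.bMax π :=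
  Real.iSup_nonneg fun i => Finset.prod_nonneg fun u _ => by positivity

omit [Fintype V] [∀ v, Fintype (Ω v)] [∀ v, Fintype (Q v)] in
theorem bC_le_bMax (i : ι) : Φ.bC π i ≤ Φ.bMax π :=
  le_ciSup (f := fun i => Φ.bC π i) (Set.finite_range _).bddAbove i

omit [Fintype V] [∀ v, Fintype (Ω v)] in
theorem IsAdmissible.three_mul_bMax_mul_degree_le [Nonempty ι] (h : Φ.IsAdmissible π η κ)
    (hη : η < 1 / 2) : 3 * Φ.bMax π * Φ.degree ≤ 1 / 200 := by
  have h1 := h.b_le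
  have h2 := h.one_le_degree
  rw [le_div_iff₀ (by linarith)] at h1
  nlinarith

omit [Fintype V] [∀ v, Fintype (Ω v)] in
theorem IsAdmissible.three_mul_bMax_le [Nonempty ι] (h : Φ.IsAdmissible π η κ)
    (hη : η < 1 / 2) : 3 * Φ.bMax π ≤ 1 / 200 := by
  have h1 := h.three_mul_bMax_mul_degree_le hη
  have h2 := h.one_le_degree
  have h3 := bMax_nonneg (Φ := Φ) (π := π)
  nlinarith

omit [Fintype V] [∀ v, Fintype (Ω v)] in
theorem IsAdmissible.rho_pos [Nonempty ι] (h : Φ.IsAdmissible π η κ)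
    (hη : η < 1 / 2) : 0 < (1 - 3 * Φ.bMax π) ^ Φ.degree :=
  pow_pos (by linarith [h.three_mul_bMax_le hη]) _

omit [Fintype V] in
theorem IsAdmissible.projMarginal_pos [∀ v, Nonempty (Ω v)] (h : Φ.IsAdmissible π η κ) (v : V)
    (a : Q v) : 0 < projMarginal π v a := by
  have h1 := h.card_fiber_pos v a
  have h2 : 0 < Nat.card (Ω v) := Nat.card_pos
  unfold projMarginal
  positivity

omit [Fintype V] in
/-- Each constraint that is not already satisfied off `v` has probability at most `b` on the box of
assignments projecting to `Y` off `v`. -/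
theorem IsAdmissible.one_le_bMax_mul_prod (h : Φ.IsAdmissible π η κ) (v : V) (Y : ∀ v, Q v) (i : ι)
    (hi : ∀ u ∈ Φ.vbl i, Φ.bad i u ∈ offBox π v Y u) :
    1 ≤ Φ.bMax π * ∏ u ∈ Φ.vbl i, ((offBox π v Y u).card : ℝ) := by
  have h1 := bC_le_bMax (Φ := Φ) (π := π) i
  have hpos : ∀ u, (0 : ℝ) < Nat.card {x : Ω u // π u x = π u (Φ.bad i u)} := fun u => by
    exact_mod_cast h.card_fiber_pos u _
  have h2 : ∀ u ∈ Φ.vbl i, (Nat.card {x : Ω u // π u x = π u (Φ.bad i u)} : ℝ)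
      ≤ (offBox π v Y u).card := fun u hu => by
    rw [Nat.card_eq_fintype_card, Fintype.card_subtype]
    refine mod_cast Finset.card_le_card fun x hx => ?_
    have := hi u hu
    simp only [offBox, Finset.mem_filter, Finset.mem_univ, true_and] at this hx ⊢
    intro huv
    rw [hx, this huv]
  calc (1 : ℝ) = Φ.bC π i * ∏ u ∈ Φ.vbl i,
        (Nat.card {x : Ω u // π u x = π u (Φ.bad i u)} : ℝ) := by
        rw [bC, ← Finset.prod_mul_distrib]
        exact (Finset.prod_eq_one fun u _ => inv_mul_cancel₀ (hpos u).ne').symm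
    _ ≤ _ := by
        refine mul_le_mul h1 (Finset.prod_le_prod (fun u _ => (hpos u).le) h2)
          (Finset.prod_nonneg fun u _ => (hpos u).le) bMax_nonneg

theorem IsAdmissible.sum_liftCount_update_pos [Nonempty ι] (h : Φ.IsAdmissible π η κ)
    (hη : η < 1 / 2) (v : V) (Y : ∀ v, Q v) :
    0 < ∑ a, Φ.liftCount π (Function.update Y v a) := by
  rw [sum_liftCount_update]
  have hb := h.three_mul_bMax_mul_degree_le hη
  have hb' := h.three_mul_bMax_le hη
  have h1 := Φ.le_card_satBox_union (offBox π v Y) bMax_nonneg (by linarith) (by linarith)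
    (h.one_le_bMax_mul_prod v Y) h.vbl_nonempty ∅ Finset.univ (by simp)
  rw [Finset.empty_union] at h1
  have h2 : 0 < (Φ.satBox (offBox π v Y) ∅).card := by
    rw [Finset.card_pos]
    have : ∀ u, ∃ x, x ∈ offBox π v Y u := fun u => by
      obtain ⟨x, hx⟩ := h.surjective u (Y u)
      exact ⟨x, by simp [offBox, hx]⟩
    choose σ hσ using this
    exact ⟨σ, mem_satBox.2 ⟨hσ, by simp⟩⟩
  have h3 : (0 : ℝ) < (1 - 3 * Φ.bMax π) ^ (Finset.univ : Finset ι).card :=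
    pow_pos (by linarith) _
  have h4 : (0 : ℝ) < (Φ.satBox (offBox π v Y) ∅).card := by exact_mod_cast h2
  have h5 : (0 : ℝ) < (Φ.satBox (offBox π v Y) Finset.univ).card :=
    lt_of_lt_of_le (mul_pos h3 h4) h1
  exact_mod_cast h5

omit [Fintype ι] in
theorem projMeasure_eq (Y : ∀ v, Q v) : Φ.projMeasure π Y =
    (Φ.liftCount π Y : ℝ) / (∑ Y, Φ.liftCount π Y : ℕ) := by
  rw [sum_liftCount]; rfl

theorem IsAdmissible.sum_liftCount_pos [Nonempty ι] (h : Φ.IsAdmissible π η κ)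
    (hη : η < 1 / 2) (hΩ : ∀ v, Nonempty (Ω v)) : 0 < ∑ Y, Φ.liftCount π Y := by
  obtain ⟨i⟩ := ‹Nonempty ι›
  obtain ⟨v, hv⟩ := h.vblBar_nonempty i
  have : Nonempty ι := ⟨i⟩
  have Y : ∀ v, Q v := fun v => π v (Classical.arbitrary _)
  have h1 := h.sum_liftCount_update_pos hη v Y
  rw [Finset.sum_pos_iff] at h1
  obtain ⟨a, -, ha⟩ := h1
  exact Finset.sum_pos_iff.2 ⟨_, Finset.mem_univ _, ha⟩

theorem IsAdmissible.condMarginal_eq [Nonempty ι] (h : Φ.IsAdmissible π η κ)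
    (hη : η < 1 / 2) (hΩ : ∀ v, Nonempty (Ω v)) (v : V) (Y : ∀ v, Q v) (a : Q v) :
    Φ.condMarginal π v Y a = (Φ.liftCount π (Function.update Y v a) : ℝ) /
      ∑ a', (Φ.liftCount π (Function.update Y v a') : ℝ) := by
  have h1 : ((∑ Y, Φ.liftCount π Y : ℕ) : ℝ) ≠ 0 := by
    exact_mod_cast (h.sum_liftCount_pos hη hΩ).ne'
  unfold condMarginal
  simp_rw [projMeasure_eq]
  rw [← Finset.sum_div, div_div_div_cancel_right₀ h1]

omit [Fintype V] [∀ v, Fintype (Ω v)] [Fintype ι] in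
theorem condMarginal_nonneg (v : V) (Y : ∀ v, Q v) (a : Q v) : 0 ≤ Φ.condMarginal π v Y a := by
  unfold condMarginal projMeasure
  positivity

theorem IsAdmissible.sum_condMarginal [Nonempty ι] (h : Φ.IsAdmissible π η κ)
    (hη : η < 1 / 2) (hΩ : ∀ v, Nonempty (Ω v)) (v : V) (Y : ∀ v, Q v) :
    ∑ a, Φ.condMarginal π v Y a = 1 := by
  simp_rw [h.condMarginal_eq hη hΩ]
  rw [← Finset.sum_div]
  refine div_self ?_
  exact_mod_cast (h.sum_liftCount_update_pos hη v Y).ne'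

/-- The local lemma bound on the conditional marginals. -/
theorem IsAdmissible.condMarginal_le [Nonempty ι] (h : Φ.IsAdmissible π η κ)
    (hη : η < 1 / 2) (hΩ : ∀ v, Nonempty (Ω v)) (v : V) (Y : ∀ v, Q v) (a : Q v) :
    Φ.condMarginal π v Y a ≤ ((1 - 3 * Φ.bMax π) ^ Φ.degree)⁻¹ * projMarginal π v a := by
  have hb := h.three_mul_bMax_mul_degree_le hη
  have hb' := h.three_mul_bMax_le hη
  have h1 := Φ.card_satBox_filter_mul_le (offBox π v Y) bMax_nonneg (by linarith) (by linarith)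
    (h.one_le_bMax_mul_prod v Y) h.vbl_nonempty v (Finset.univ.filter fun x => π v x = a)
  have h2 : (offBox π v Y v).card = Nat.card (Ω v) := by simp [offBox]
  have h3 : (Finset.univ.filter fun x => π v x = a).card = Nat.card {x : Ω v // π v x = a} := by
    rw [Nat.card_eq_fintype_card, Fintype.card_subtype]
  simp only [Finset.mem_filter, Finset.mem_univ, true_and] at h1
  rw [← liftCount_update, h2, h3, ← sum_liftCount_update] at h1
  have h4 : (0 : ℝ) < (∑ a, Φ.liftCount π (Function.update Y v a) : ℕ) := by
    exact_mod_cast h.sum_liftCount_update_pos hη v Y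
  have h5 : (0 : ℝ) < Nat.card (Ω v) := by
    exact_mod_cast (Nat.card_pos : 0 < Nat.card (Ω v))
  rw [h.condMarginal_eq hη hΩ, ← Nat.cast_sum, projMarginal, inv_mul_eq_div,
    div_div, div_le_div_iff₀ h4 (mul_pos h5 (h.rho_pos hη))]
  linarith

omit [∀ v, Fintype (Ω v)] [Fintype ι] in
/-- Two conditional marginals are within `2 q` of each other. -/
theorem tvDist_condMarginal_le (v : V) (X Y : ∀ v, Q v) :
    tvDist (Φ.condMarginal π v X) (Φ.condMarginal π v Y) ≤ 2 * Φ.qMax π := by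
  have hq : ∀ Z, tvDist (projMarginal π v) (Φ.condMarginal π v Z) ≤ Φ.qMax π := fun Z =>
    le_ciSup (f := fun p : V × (∀ v, Q v) =>
      tvDist (projMarginal π p.1) (Φ.condMarginal π p.1 p.2)) (Set.finite_range _).bddAbove (v, Z)
  have h1 := hq X
  have h2 := hq Y
  unfold tvDist at *
  have : ∑ a, |Φ.condMarginal π v X a - Φ.condMarginal π v Y a| ≤
      ∑ a, |projMarginal π v a - Φ.condMarginal π v X a| +
      ∑ a, |projMarginal π v a - Φ.condMarginal π v Y a| := by
    rw [← Finset.sum_add_distrib]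
    refine Finset.sum_le_sum fun a _ => ?_
    rw [abs_sub_comm (projMarginal π v a) (Φ.condMarginal π v X a)]
    exact abs_sub_le _ _ _
  linarith

omit [Fintype V] [∀ v, Fintype (Ω v)] [Fintype ι] [∀ v, Fintype (Q v)] in
theorem projMeasure_nonneg (Y : ∀ v, Q v) : 0 ≤ Φ.projMeasure π Y := by
  unfold projMeasure; positivity

theorem IsAdmissible.sum_projMeasure [Nonempty ι] (h : Φ.IsAdmissible π η κ)
    (hη : η < 1 / 2) (hΩ : ∀ v, Nonempty (Ω v)) : ∑ Y, Φ.projMeasure π Y = 1 := by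
  simp_rw [projMeasure_eq]
  rw [← Finset.sum_div, ← Nat.cast_sum]
  refine div_self ?_
  exact_mod_cast (h.sum_liftCount_pos hη hΩ).ne'

omit [∀ v, Fintype (Ω v)] [Fintype ι] in
/-- `μ_π` is stationary for resampling the variable `v`. -/
theorem sum_projMeasure_mul_condMarginal (v : V) (f : (∀ v, Q v) → ℝ) :
    ∑ Y, Φ.projMeasure π Y * ∑ a, Φ.condMarginal π v Y a * f (Function.update Y v a) =
      ∑ Y, Φ.projMeasure π Y * f Y := by
  -- Both sides are grouped according to the configuration off `v`.
  let e := Equiv.piSplitAt v Q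
  have key : ∀ g : (∀ v, Q v) → ℝ, ∑ Y, g Y =
      ∑ Z : ∀ j : {j // j ≠ v}, Q j, ∑ a, g (e.symm (a, Z)) := fun g => by
    rw [← e.symm.sum_comp g, Fintype.sum_prod_type_right]
  have hup : ∀ a b Z, Function.update (e.symm (a, Z)) v b = e.symm (b, Z) := fun a b Z => by
    ext u
    by_cases hu : u = v
    · subst hu; simp [e]
    · simp [e, hu]
  rw [key, key (fun Y => Φ.projMeasure π Y * f Y)]
  refine Finset.sum_congr rfl fun Z _ => ?_
  simp only [condMarginal, hup]
  set s := ∑ a, Φ.projMeasure π (e.symm (a, Z))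
  rw [← Finset.sum_mul]
  rw [Finset.mul_sum]
  refine Finset.sum_congr rfl fun a _ => ?_
  by_cases hs : s = 0
  · have := (Finset.sum_eq_zero_iff_of_nonneg
      (fun a _ => projMeasure_nonneg (Φ := Φ) (π := π) (e.symm (a, Z)))).1 hs a (Finset.mem_univ a)
    simp [this]
  · change s * (_ / s * _) = _
    field_simp

end Marginals

/-! ### Propagation of discrepancies in one step -/

/-- The configuration `X` agrees with the forbidden assignment of `i` at all variables of `i` other
than `v`: the constraint `i` is not already satisfied by `X` off `v`. -/
def ViolatedOff (Φ : AtomicCSP V Ω ι) (π : ∀ v, Ω v → Q v) (v : V) (X : ∀ v, Q v) (i : ι) : Prop :=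
  ∀ u ∈ Φ.vbl i, u ≠ v → X u = π u (Φ.bad i u)

/-- The cluster of `v`: the constraints connected to `v` through constraints that are not already
satisfied by both `X` and `Y` off `v`. -/
inductive Cluster (Φ : AtomicCSP V Ω ι) (π : ∀ v, Ω v → Q v) (v : V) (X Y : ∀ v, Q v) : ι → Prop
  | base (i : ι) : v ∈ Φ.vbl i → (Φ.ViolatedOff π v X i ∨ Φ.ViolatedOff π v Y i) →
      Cluster Φ π v X Y i
  | step (i k : ι) : Cluster Φ π v X Y i → (Φ.vbl i ∩ Φ.vbl k).Nonempty →
      (Φ.ViolatedOff π v X k ∨ Φ.ViolatedOff π v Y k) → Cluster Φ π v X Y k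

theorem Cluster.violatedOff {Φ : AtomicCSP V Ω ι} {π : ∀ v, Ω v → Q v} {v : V} {X Y : ∀ v, Q v}
    {i : ι} (h : Φ.Cluster π v X Y i) : Φ.ViolatedOff π v X i ∨ Φ.ViolatedOff π v Y i := by
  cases h <;> assumption

/-- Satisfying assignments over `X` and `Y` can be glued along a set `U` of variables on which `X`
and `Y` agree off `v`, if every constraint not already satisfied that meets `U` lies inside `U`. -/
theorem glue_satisfies {Φ : AtomicCSP V Ω ι} {π : ∀ v, Ω v → Q v} {v : V} {X Y : ∀ v, Q v}
    {U : Set V} (hv : v ∈ U) (hU : ∀ u ∈ U, u ≠ v → X u = Y u)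
    (hcl : ∀ i, Φ.ViolatedOff π v Y i → (∃ u ∈ Φ.vbl i, u ∈ U) → ∀ u ∈ Φ.vbl i, u ∈ U)
    {σ τ : ∀ v, Ω v} {a a' : Q v}
    (hσ : Φ.Satisfies σ ∧ ∀ u, π u (σ u) = Function.update X v a u)
    (hτ : Φ.Satisfies τ ∧ ∀ u, π u (τ u) = Function.update Y v a' u) :
    Φ.Satisfies (fun u => if u ∈ U then σ u else τ u) ∧
      ∀ u, π u (if u ∈ U then σ u else τ u) = Function.update Y v a u := by
  have hproj : ∀ u, π u (if u ∈ U then σ u else τ u) = Function.update Y v a u := fun u => by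
    by_cases hu : u ∈ U
    · rw [if_pos hu, hσ.2]
      by_cases huv : u = v
      · subst huv; simp
      · simp [huv, hU u hu huv]
    · have huv : u ≠ v := fun h => hu (h ▸ hv)
      rw [if_neg hu, hτ.2]
      simp [huv]
  refine ⟨fun i => ?_, hproj⟩
  by_cases h1 : ∀ u ∈ Φ.vbl i, u ∈ U
  · exact (Φ.holds_congr fun u hu => by simp [h1 u hu]).2 (hσ.1 i)
  by_cases h2 : ∃ u ∈ Φ.vbl i, u ∈ U
  · by_contra h3
    rw [Φ.not_holds_iff] at h3
    refine h1 (hcl i (fun u hu huv => ?_) h2)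
    have h4 := hproj u
    rw [h3 u hu] at h4
    simpa [huv] using h4.symm
  · push Not at h2
    exact (Φ.holds_congr fun u hu => by simp [h2 u hu]).2 (hτ.1 i)

section Propagation

variable [Fintype V] [∀ v, Fintype (Ω v)] [Fintype ι] [∀ v, Fintype (Q v)]
variable {Φ : AtomicCSP V Ω ι} {π : ∀ v, Ω v → Q v} {η κ : ℝ}

omit [Fintype ι] [∀ v, Fintype (Q v)] in
/-- Exchanging satisfying assignments on `U` is an injection between pairs of assignments. -/
theorem liftCount_mul_le {v : V} {X Y : ∀ v, Q v}
    {U : Set V} (hv : v ∈ U) (hU : ∀ u ∈ U, u ≠ v → X u = Y u)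
    (hX : ∀ i, Φ.ViolatedOff π v X i → (∃ u ∈ Φ.vbl i, u ∈ U) → ∀ u ∈ Φ.vbl i, u ∈ U)
    (hY : ∀ i, Φ.ViolatedOff π v Y i → (∃ u ∈ Φ.vbl i, u ∈ U) → ∀ u ∈ Φ.vbl i, u ∈ U)
    (a a' : Q v) :
    Φ.liftCount π (Function.update X v a) * Φ.liftCount π (Function.update Y v a') ≤
      Φ.liftCount π (Function.update Y v a) * Φ.liftCount π (Function.update X v a') := by
  unfold liftCount
  rw [← Nat.card_prod, ← Nat.card_prod]
  refine Nat.card_le_card_of_injective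
    (fun p => (⟨_, glue_satisfies hv hU hY p.1.2 p.2.2⟩,
      ⟨_, glue_satisfies hv (fun u hu huv => (hU u hu huv).symm) hX p.2.2 p.1.2⟩)) ?_
  rintro ⟨⟨σ, hσ⟩, ⟨τ, hτ⟩⟩ ⟨⟨σ', hσ'⟩, ⟨τ', hτ'⟩⟩ h
  simp only [Prod.mk.injEq, Subtype.mk.injEq] at h ⊢
  obtain ⟨h1, h2⟩ := h
  have e1 := fun u => congrFun h1 u
  have e2 := fun u => congrFun h2 u
  constructor <;> funext u <;> specialize e1 u <;> specialize e2 u <;>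
    by_cases hu : u ∈ U <;> simp only [hu, if_true, if_false] at e1 e2 <;> assumption

/-- If the conditional marginals at `v` given `X` and given `Y` differ, then some constraint of the
cluster of `v` contains a variable other than `v` at which `X` and `Y` differ. -/
theorem IsAdmissible.exists_cluster_ne [Nonempty ι] (h : Φ.IsAdmissible π η κ)
    (hη : η < 1 / 2) (hΩ : ∀ v, Nonempty (Ω v)) {v : V} {X Y : ∀ v, Q v}
    (hne : Φ.condMarginal π v X ≠ Φ.condMarginal π v Y) :
    ∃ i, Φ.Cluster π v X Y i ∧ ∃ u ∈ Φ.vbl i, u ≠ v ∧ X u ≠ Y u := by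
  by_contra hcon
  push Not at hcon
  let U : Set V := {u | u = v ∨ ∃ i, Φ.Cluster π v X Y i ∧ u ∈ Φ.vbl i}
  have hv : v ∈ U := Or.inl rfl
  have hU : ∀ u ∈ U, u ≠ v → X u = Y u := by
    rintro u (rfl | ⟨i, hi, hu⟩) huv
    · exact absurd rfl huv
    · exact hcon i hi u hu huv
  have hcl : ∀ i, (Φ.ViolatedOff π v X i ∨ Φ.ViolatedOff π v Y i) →
      (∃ u ∈ Φ.vbl i, u ∈ U) → ∀ u ∈ Φ.vbl i, u ∈ U := by
    rintro i hi ⟨u, hu, rfl | ⟨k, hk, huk⟩⟩ w hw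
    · exact Or.inr ⟨i, .base i hu hi, hw⟩
    · exact Or.inr ⟨i, .step k i hk ⟨u, Finset.mem_inter.2 ⟨huk, hu⟩⟩ hi, hw⟩
  have key : ∀ a a', Φ.liftCount π (Function.update X v a) * Φ.liftCount π (Function.update Y v a')
      = Φ.liftCount π (Function.update Y v a) * Φ.liftCount π (Function.update X v a') :=
    fun a a' => le_antisymm
      (liftCount_mul_le hv hU (fun i hi => hcl i (Or.inl hi)) (fun i hi => hcl i (Or.inr hi)) a a')
      (liftCount_mul_le hv (fun u hu huv => (hU u hu huv).symm) (fun i hi => hcl i (Or.inr hi))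
        (fun i hi => hcl i (Or.inl hi)) a a')
  refine hne (funext fun a => ?_)
  rw [h.condMarginal_eq hη hΩ, h.condMarginal_eq hη hΩ]
  have hX : ((∑ a', Φ.liftCount π (Function.update X v a') : ℕ) : ℝ) ≠ 0 := by
    exact_mod_cast (h.sum_liftCount_update_pos hη v X).ne'
  have hY : ((∑ a', Φ.liftCount π (Function.update Y v a') : ℕ) : ℝ) ≠ 0 := by
    exact_mod_cast (h.sum_liftCount_update_pos hη v Y).ne'
  rw [← Nat.cast_sum, ← Nat.cast_sum, div_eq_div_iff hX hY]
  have := Finset.sum_congr rfl fun a' (_ : a' ∈ Finset.univ) => key a a'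
  rw [← Finset.mul_sum, ← Finset.mul_sum] at this
  exact_mod_cast this

end Propagation

end AtomicCSP

/-! ### Maximal couplings -/

section Coupling

variable {α : Type*} [Fintype α]

/-- The maximal coupling of two probability mass functions: the common part is put on the diagonal
and the remaining parts are coupled independently. -/
def maxCoupling (p q : α → ℝ) (a b : α) : ℝ :=
  (if a = b then min (p a) (q a) else 0) +
    (p a - min (p a) (q a)) * (q b - min (p b) (q b)) / (1 - ∑ c, min (p c) (q c))

variable {p q : α → ℝ}

theorem one_sub_sum_min_eq_tvDist (hp : ∑ a, p a = 1) (hq : ∑ a, q a = 1) :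
    1 - ∑ c, min (p c) (q c) = tvDist p q := by
  have : ∀ a, |p a - q a| = p a + q a - 2 * min (p a) (q a) := fun a => by
    rcases le_total (p a) (q a) with h | h
    · rw [abs_of_nonpos (by linarith), min_eq_left h]; ring
    · rw [abs_of_nonneg (by linarith), min_eq_right h]; ring
  unfold tvDist
  simp_rw [this]
  rw [Finset.sum_sub_distrib, Finset.sum_add_distrib, ← Finset.mul_sum, hp, hq]
  ring

theorem tvDist_nonneg (p q : α → ℝ) : 0 ≤ tvDist p q := by
  unfold tvDist; positivity

theorem maxCoupling_nonneg (hp0 : ∀ a, 0 ≤ p a) (hq0 : ∀ a, 0 ≤ q a) (hp : ∑ a, p a = 1)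
    (hq : ∑ a, q a = 1) (a b : α) : 0 ≤ maxCoupling p q a b := by
  unfold maxCoupling
  rw [one_sub_sum_min_eq_tvDist hp hq]
  have h1 := min_le_left (p a) (q a)
  have h2 := min_le_right (p b) (q b)
  have h3 := le_min (hp0 a) (hq0 a)
  refine add_nonneg (by split_ifs <;> simp_all) (div_nonneg (mul_nonneg (by linarith)
    (by linarith)) (tvDist_nonneg p q))

theorem sum_maxCoupling_right (hp : ∑ a, p a = 1) (hq : ∑ a, q a = 1) (a : α) :
    ∑ b, maxCoupling p q a b = p a := by
  unfold maxCoupling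
  rw [Finset.sum_add_distrib, ← Finset.sum_div, ← Finset.mul_sum, Finset.sum_sub_distrib, hq]
  simp only [Finset.sum_ite_eq, Finset.mem_univ, if_true]
  by_cases hd : 1 - ∑ c, min (p c) (q c) = 0
  · have h1 : ∑ c, (p c - min (p c) (q c)) = 0 := by rw [Finset.sum_sub_distrib, hp, hd]
    have h2 := (Finset.sum_eq_zero_iff_of_nonneg
      (fun c _ => sub_nonneg.2 (min_le_left (p c) (q c)))).1 h1 a (Finset.mem_univ a)
    rw [hd, div_zero]; linarith
  · rw [mul_div_assoc, div_self hd]; ring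

theorem maxCoupling_comm (p q : α → ℝ) (a b : α) : maxCoupling p q a b = maxCoupling q p b a := by
  unfold maxCoupling
  simp_rw [min_comm (q _) (p _), eq_comm (a := b)]
  congr 1
  · by_cases h : a = b
    · subst h; rfl
    · simp [h]
  · ring

theorem sum_maxCoupling_left (hp : ∑ a, p a = 1) (hq : ∑ a, q a = 1) (b : α) :
    ∑ a, maxCoupling p q a b = q b := by
  simp_rw [maxCoupling_comm p q _ b]
  exact sum_maxCoupling_right hq hp b

theorem sum_maxCoupling_ne (hp : ∑ a, p a = 1) (hq : ∑ a, q a = 1) :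
    ∑ a, ∑ b, (if a ≠ b then maxCoupling p q a b else 0) ≤ tvDist p q := by
  have h0 := tvDist_nonneg p q
  rw [← one_sub_sum_min_eq_tvDist hp hq] at h0 ⊢
  set d := 1 - ∑ c, min (p c) (q c)
  calc _ ≤ ∑ a, ∑ b, (p a - min (p a) (q a)) * (q b - min (p b) (q b)) / d := by
        refine Finset.sum_le_sum fun a _ => Finset.sum_le_sum fun b _ => ?_
        have h1 := min_le_left (p a) (q a)
        have h2 := min_le_right (p b) (q b)
        have h3 : 0 ≤ (p a - min (p a) (q a)) * (q b - min (p b) (q b)) / d :=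
          div_nonneg (mul_nonneg (by linarith) (by linarith)) h0
        by_cases hab : a = b
        · simpa [hab] using hab ▸ h3
        · simp [hab, maxCoupling, d]
    _ = d * d / d := by
        simp_rw [← Finset.sum_div, ← Finset.mul_sum, ← Finset.sum_mul, Finset.sum_sub_distrib]
        rw [hp, hq]
    _ ≤ d := (mul_self_div_self d).le

theorem eq_of_maxCoupling_self_ne_zero {a b : α} (h : maxCoupling p p a b ≠ 0) : a = b := by
  by_contra hab
  simp [maxCoupling, hab] at h

end Coupling

/-! ### Iterated expectations -/

section IterE

variable {Z : Type*} [Fintype Z]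

/-- The expectation of `f` over the states at times `s + 1, …, s + k` of a Markov chain with
transition weights `W`, the states up to time `s` being those of `ω`. A trajectory is a function
`ℕ → Z`, whose values after time `s + k` are those of `ω` and play no role. -/
def iterE (W : ℕ → Z → Z → ℝ) : ℕ → ℕ → ((ℕ → Z) → ℝ) → (ℕ → Z) → ℝ
  | 0, _, f, ω => f ω
  | k + 1, s, f, ω => ∑ z, W s (ω s) z * iterE W k (s + 1) f (Function.update ω (s + 1) z)

variable {W : ℕ → Z → Z → ℝ}

/-- Only trajectories of positive weight need to be compared. -/
theorem iterE_le_iterE (hW : ∀ s z z', 0 ≤ W s z z') {f g : (ℕ → Z) → ℝ} (k s : ℕ) (ω : ℕ → Z)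
    (h : ∀ ω', (∀ r ≤ s, ω' r = ω r) →
      (∀ r, s ≤ r → r < s + k → W r (ω' r) (ω' (r + 1)) ≠ 0) → f ω' ≤ g ω') :
    iterE W k s f ω ≤ iterE W k s g ω := by
  induction k generalizing s ω with
  | zero => exact h ω (fun _ _ => rfl) (fun r h1 h2 => by omega)
  | succ k ih =>
    refine Finset.sum_le_sum fun z _ => ?_
    by_cases hz : W s (ω s) z = 0
    · simp [hz]
    refine mul_le_mul_of_nonneg_left (ih (s + 1) _ fun ω' h1 h2 => h ω' (fun r hr => ?_)
      fun r h3 h4 => ?_) (hW _ _ _)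
    · rw [h1 r (by omega), Function.update_of_ne (by omega)]
    · rcases h3.eq_or_lt with rfl | h3
      · rw [h1 s (by omega), h1 (s + 1) le_rfl, Function.update_self,
          Function.update_of_ne (by omega)]
        exact hz
      · exact h2 r (by omega) (by omega)

theorem iterE_congr {f g : (ℕ → Z) → ℝ} (k s : ℕ) (ω : ℕ → Z)
    (h : ∀ ω', (∀ r ≤ s, ω' r = ω r) → f ω' = g ω') :
    iterE W k s f ω = iterE W k s g ω := by
  induction k generalizing s ω with
  | zero => exact h ω (fun _ _ => rfl)
  | succ k ih =>
    refine Finset.sum_congr rfl fun z _ => ?_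
    rw [ih (s + 1) _ fun ω' h1 => h ω' fun r hr => ?_]
    rw [h1 r (by omega), Function.update_of_ne (by omega)]

theorem iterE_sum {β : Type*} (B : Finset β) (f : β → (ℕ → Z) → ℝ) (k s : ℕ) (ω : ℕ → Z) :
    iterE W k s (fun ω => ∑ b ∈ B, f b ω) ω = ∑ b ∈ B, iterE W k s (f b) ω := by
  induction k generalizing s ω with
  | zero => rfl
  | succ k ih =>
    simp only [iterE, ih, Finset.mul_sum]
    exact Finset.sum_comm

theorem iterE_const_mul (c : ℝ) (f : (ℕ → Z) → ℝ) (k s : ℕ) (ω : ℕ → Z) :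
    iterE W k s (fun ω => c * f ω) ω = c * iterE W k s f ω := by
  induction k generalizing s ω with
  | zero => rfl
  | succ k ih =>
    simp only [iterE, ih, Finset.mul_sum]
    exact Finset.sum_congr rfl fun z _ => by ring

theorem iterE_sub (f g : (ℕ → Z) → ℝ) (k s : ℕ) (ω : ℕ → Z) :
    iterE W k s (fun ω => f ω - g ω) ω = iterE W k s f ω - iterE W k s g ω := by
  induction k generalizing s ω with
  | zero => rfl
  | succ k ih => simp only [iterE, ih, mul_sub, Finset.sum_sub_distrib]

theorem iterE_add (f g : (ℕ → Z) → ℝ) (k s : ℕ) (ω : ℕ → Z) :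
    iterE W k s (fun ω => f ω + g ω) ω = iterE W k s f ω + iterE W k s g ω := by
  induction k generalizing s ω with
  | zero => rfl
  | succ k ih => simp only [iterE, ih, mul_add, Finset.sum_add_distrib]

theorem abs_iterE_le (hW : ∀ s z z', 0 ≤ W s z z') (f : (ℕ → Z) → ℝ) (k s : ℕ) (ω : ℕ → Z) :
    |iterE W k s f ω| ≤ iterE W k s (fun ω => |f ω|) ω := by
  rw [abs_le']
  constructor
  · exact iterE_le_iterE hW k s ω fun ω' _ _ => le_abs_self _
  · rw [neg_eq_neg_one_mul, ← iterE_const_mul]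
    exact iterE_le_iterE hW k s ω fun ω' _ _ => by rw [← neg_eq_neg_one_mul]; exact neg_le_abs _

/-- A product of functionals of single transitions is bounded by the product of uniform bounds on
their one-step expectations. -/
theorem iterE_prod_le (hW : ∀ s z z', 0 ≤ W s z z') {g : ℕ → Z → Z → ℝ}
    (hg : ∀ s z z', 0 ≤ g s z z') {a : ℕ → ℝ} (ha : ∀ s, 0 ≤ a s)
    (h : ∀ s z, ∑ z', W s z z' * g s z z' ≤ a s) (k s : ℕ) (ω : ℕ → Z) :
    iterE W k s (fun ω => ∏ r ∈ Finset.range (s + k), g r (ω r) (ω (r + 1))) ω ≤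
      (∏ r ∈ Finset.range s, g r (ω r) (ω (r + 1))) * ∏ r ∈ Finset.Ico s (s + k), a r := by
  induction k generalizing s ω with
  | zero => simp [iterE]
  | succ k ih =>
    have hP : 0 ≤ ∏ r ∈ Finset.range s, g r (ω r) (ω (r + 1)) :=
      Finset.prod_nonneg fun _ _ => hg _ _ _
    have hA : 0 ≤ ∏ r ∈ Finset.Ico (s + 1) (s + 1 + k), a r := Finset.prod_nonneg fun _ _ => ha _
    calc _ ≤ ∑ z, W s (ω s) z * (((∏ r ∈ Finset.range s, g r (ω r) (ω (r + 1))) * g s (ω s) z) *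
          ∏ r ∈ Finset.Ico (s + 1) (s + 1 + k), a r) := by
          simp only [iterE]
          refine Finset.sum_le_sum fun z _ => mul_le_mul_of_nonneg_left ?_ (hW _ _ _)
          have := ih (s + 1) (Function.update ω (s + 1) z)
          rw [show s + 1 + k = s + (k + 1) by ring] at this ⊢
          refine this.trans (le_of_eq ?_)
          rw [Finset.prod_range_succ, Function.update_self, Function.update_of_ne (by omega)]
          congr 2
          refine Finset.prod_congr rfl fun r hr => ?_
          have := Finset.mem_range.1 hr
          rw [Function.update_of_ne (by omega), Function.update_of_ne (by omega)]
      _ = (∏ r ∈ Finset.range s, g r (ω r) (ω (r + 1))) *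
          (∏ r ∈ Finset.Ico (s + 1) (s + 1 + k), a r) * ∑ z, W s (ω s) z * g s (ω s) z := by
          rw [Finset.mul_sum]; exact Finset.sum_congr rfl fun z _ => by ring
      _ ≤ (∏ r ∈ Finset.range s, g r (ω r) (ω (r + 1))) *
          (∏ r ∈ Finset.Ico (s + 1) (s + 1 + k), a r) * a s :=
          mul_le_mul_of_nonneg_left (h s (ω s)) (mul_nonneg hP hA)
      _ = _ := by
          rw [Finset.prod_eq_prod_Ico_succ_bot (by omega : s < s + (k + 1)),
            show s + 1 + k = s + (k + 1) by ring]
          ring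

theorem iterE_const (h : ∀ s z, ∑ z', W s z z' = 1) (c : ℝ) (k s : ℕ) (ω : ℕ → Z) :
    iterE W k s (fun _ => c) ω = c := by
  induction k generalizing s ω with
  | zero => rfl
  | succ k ih => simp only [iterE, ih, ← Finset.sum_mul, h, one_mul]

end IterE

namespace AtomicCSP

variable {V : Type u₁} {Ω : V → Type u₂} {ι : Type u₃} {Q : V → Type u₄}

/-! ### The coupled Glauber dynamics -/

section Glauber

variable [Fintype V] [∀ v, Fintype (Ω v)] [Fintype ι] [∀ v, Fintype (Q v)]
variable {Φ : AtomicCSP V Ω ι} {π : ∀ v, Ω v → Q v} {η κ : ℝ}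

/-- The transition weights of the pair of chains when both resample the variable `v`, through the
maximal coupling of their conditional marginals. -/
def pairKernel (Φ : AtomicCSP V Ω ι) (π : ∀ v, Ω v → Q v) (v : V)
    (z z' : (∀ v, Q v) × (∀ v, Q v)) : ℝ :=
  ∑ a, ∑ b, if z' = (Function.update z.1 v a, Function.update z.2 v b) then
    maxCoupling (Φ.condMarginal π v z.1) (Φ.condMarginal π v z.2) a b else 0

/-- The weights of the uniformly random update schedule. -/
def scheduleKernel (V : Type*) [Fintype V] (_ : ℕ) (_ _ : V) : ℝ := (Fintype.card V : ℝ)⁻¹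

/-- The expectation of a functional of the update schedule `r` and of the trajectory `ω` of the
coupled pair during `T` steps. The variable updated in step `s`, that is, between the states `ω s`
and `ω (s + 1)`, is `r (s + 1)`. -/
def pairE (Φ : AtomicCSP V Ω ι) (π : ∀ v, Ω v → Q v) (T : ℕ) (r₀ : V)
    (z₀ : (∀ v, Q v) × (∀ v, Q v))
    (F : (ℕ → V) → (ℕ → (∀ v, Q v) × (∀ v, Q v)) → ℝ) : ℝ :=
  iterE (scheduleKernel V) T 0
    (fun r => iterE (fun s => Φ.pairKernel π (r (s + 1))) T 0 (F r) fun _ => z₀) fun _ => r₀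

/-- The one-step averaging operator of the Glauber dynamics. -/
def glauberOp (Φ : AtomicCSP V Ω ι) (π : ∀ v, Ω v → Q v) (f : (∀ v, Q v) → ℝ) (X : ∀ v, Q v) : ℝ :=
  ∑ v, (Fintype.card V : ℝ)⁻¹ * ∑ a, Φ.condMarginal π v X a * f (Function.update X v a)

omit [∀ v, Fintype (Ω v)] [Fintype ι] in
theorem sum_glauberStep_mul (f : (∀ v, Q v) → ℝ) (X : ∀ v, Q v) :
    ∑ Y, Φ.glauberStep π X Y * f Y = Φ.glauberOp π f X := by
  unfold glauberStep glauberOp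
  simp_rw [Finset.sum_mul]
  rw [Finset.sum_comm]
  refine Finset.sum_congr rfl fun v _ => ?_
  simp_rw [mul_assoc, ← Finset.mul_sum, Finset.sum_mul]
  rw [Finset.sum_comm]
  congr 1
  refine Finset.sum_congr rfl fun a _ => ?_
  simp [ite_mul]

omit [∀ v, Fintype (Ω v)] [Fintype ι] in
theorem sum_glauberLaw_mul (t : ℕ) (f : (∀ v, Q v) → ℝ) (X : ∀ v, Q v) :
    ∑ Y, Φ.glauberLaw π X t Y * f Y = (Φ.glauberOp π)^[t] f X := by
  induction t generalizing f with
  | zero => simp [glauberLaw]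
  | succ t ih =>
    rw [Function.iterate_succ_apply, ← ih]
    simp only [glauberLaw, Finset.sum_mul]
    rw [Finset.sum_comm]
    refine Finset.sum_congr rfl fun Z _ => ?_
    rw [← sum_glauberStep_mul, Finset.mul_sum]
    exact Finset.sum_congr rfl fun Y _ => by ring

omit [∀ v, Fintype (Ω v)] [Fintype ι] in
theorem sum_projMeasure_mul_glauberOp [Nonempty V] (f : (∀ v, Q v) → ℝ) :
    ∑ Y, Φ.projMeasure π Y * Φ.glauberOp π f Y = ∑ Y, Φ.projMeasure π Y * f Y := by
  unfold glauberOp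
  simp_rw [Finset.mul_sum]
  rw [Finset.sum_comm]
  have : ∀ v, ∑ Y, ∑ a, Φ.projMeasure π Y * ((Fintype.card V : ℝ)⁻¹ *
      (Φ.condMarginal π v Y a * f (Function.update Y v a))) =
      (Fintype.card V : ℝ)⁻¹ * ∑ Y, Φ.projMeasure π Y * f Y := fun v => by
    rw [← sum_projMeasure_mul_condMarginal v f, Finset.mul_sum]
    refine Finset.sum_congr rfl fun Y _ => ?_
    rw [Finset.mul_sum, Finset.mul_sum]
    exact Finset.sum_congr rfl fun a _ => by ring
  have h : ∀ v, ∑ Y, ∑ a, Φ.projMeasure π Y * ((Fintype.card V : ℝ)⁻¹ *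
      (Φ.condMarginal π v Y a * f (Function.update Y v a))) =
      ∑ Y, Φ.projMeasure π Y * ∑ a, (Fintype.card V : ℝ)⁻¹ *
      (Φ.condMarginal π v Y a * f (Function.update Y v a)) := fun v =>
    Finset.sum_congr rfl fun Y _ => (Finset.mul_sum _ _ _).symm
  simp_rw [this, Finset.sum_const, Finset.card_univ, nsmul_eq_mul]
  rw [← mul_assoc, mul_inv_cancel₀ (by exact_mod_cast Fintype.card_ne_zero), one_mul]

omit [∀ v, Fintype (Ω v)] [Fintype ι] in
theorem sum_projMeasure_mul_glauberOp_iterate [Nonempty V] (t : ℕ) (f : (∀ v, Q v) → ℝ) :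
    ∑ Y, Φ.projMeasure π Y * (Φ.glauberOp π)^[t] f Y = ∑ Y, Φ.projMeasure π Y * f Y := by
  induction t generalizing f with
  | zero => rfl
  | succ t ih => rw [Function.iterate_succ_apply, ih, sum_projMeasure_mul_glauberOp]

omit [∀ v, Fintype (Ω v)] [Fintype ι] in
theorem sum_pairKernel_mul (v : V) (z : (∀ v, Q v) × (∀ v, Q v))
    (g : (∀ v, Q v) × (∀ v, Q v) → ℝ) :
    ∑ z', Φ.pairKernel π v z z' * g z' = ∑ a, ∑ b,
      maxCoupling (Φ.condMarginal π v z.1) (Φ.condMarginal π v z.2) a b *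
        g (Function.update z.1 v a, Function.update z.2 v b) := by
  unfold pairKernel
  simp_rw [Finset.sum_mul]
  rw [Finset.sum_comm]
  refine Finset.sum_congr rfl fun a _ => ?_
  rw [Finset.sum_comm]
  refine Finset.sum_congr rfl fun b _ => ?_
  simp only [ite_mul, zero_mul, Finset.sum_ite_eq', Finset.mem_univ, if_true]

omit [∀ v, Fintype (Ω v)] [Fintype ι] in
theorem exists_of_pairKernel_ne_zero {v : V} {z z' : (∀ v, Q v) × (∀ v, Q v)}
    (h : Φ.pairKernel π v z z' ≠ 0) : ∃ a b,
      z' = (Function.update z.1 v a, Function.update z.2 v b) ∧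
      (Φ.condMarginal π v z.1 = Φ.condMarginal π v z.2 → a = b) := by
  obtain ⟨a, -, ha⟩ := Finset.exists_ne_zero_of_sum_ne_zero h
  obtain ⟨b, -, hb⟩ := Finset.exists_ne_zero_of_sum_ne_zero ha
  split_ifs at hb with hz
  · refine ⟨a, b, hz, fun heq => ?_⟩
    rw [heq] at hb
    exact eq_of_maxCoupling_self_ne_zero hb
  · exact absurd rfl hb

section Facts

variable [Nonempty ι] (h : Φ.IsAdmissible π η κ) (hη : η < 1 / 2) (hΩ : ∀ v, Nonempty (Ω v))
include h hη hΩ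

theorem IsAdmissible.pairKernel_nonneg (v : V) (z z' : (∀ v, Q v) × (∀ v, Q v)) :
    0 ≤ Φ.pairKernel π v z z' := by
  refine Finset.sum_nonneg fun a _ => Finset.sum_nonneg fun b _ => ?_
  split_ifs
  · exact maxCoupling_nonneg (condMarginal_nonneg v _) (condMarginal_nonneg v _)
      (h.sum_condMarginal hη hΩ v _) (h.sum_condMarginal hη hΩ v _) a b
  · exact le_rfl

theorem IsAdmissible.sum_pairKernel_mul_fst (v : V) (z : (∀ v, Q v) × (∀ v, Q v))
    (g : (∀ v, Q v) → ℝ) : ∑ z', Φ.pairKernel π v z z' * g z'.1 =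
      ∑ a, Φ.condMarginal π v z.1 a * g (Function.update z.1 v a) := by
  rw [sum_pairKernel_mul v z (fun z' => g z'.1)]
  refine Finset.sum_congr rfl fun a _ => ?_
  dsimp only
  rw [← Finset.sum_mul, sum_maxCoupling_right (h.sum_condMarginal hη hΩ v _)
    (h.sum_condMarginal hη hΩ v _)]

theorem IsAdmissible.sum_pairKernel_mul_snd (v : V) (z : (∀ v, Q v) × (∀ v, Q v))
    (g : (∀ v, Q v) → ℝ) : ∑ z', Φ.pairKernel π v z z' * g z'.2 =
      ∑ a, Φ.condMarginal π v z.2 a * g (Function.update z.2 v a) := by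
  rw [sum_pairKernel_mul v z (fun z' => g z'.2), Finset.sum_comm]
  refine Finset.sum_congr rfl fun a _ => ?_
  dsimp only
  rw [← Finset.sum_mul, sum_maxCoupling_left (h.sum_condMarginal hη hΩ v _)
    (h.sum_condMarginal hη hΩ v _)]

theorem IsAdmissible.sum_pairKernel (v : V) (z : (∀ v, Q v) × (∀ v, Q v)) :
    ∑ z', Φ.pairKernel π v z z' = 1 := by
  have := h.sum_pairKernel_mul_fst hη hΩ v z (fun _ => 1)
  simpa [h.sum_condMarginal hη hΩ] using this

end Facts

theorem scheduleKernel_nonneg (s : ℕ) (v v' : V) : 0 ≤ scheduleKernel V s v v' := by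
  unfold scheduleKernel; positivity

theorem sum_scheduleKernel [Nonempty V] (s : ℕ) (v : V) : ∑ v', scheduleKernel V s v v' = 1 := by
  simp [scheduleKernel]

omit [∀ v, Fintype (Ω v)] [Fintype ι] in
/-- Each of the two coordinates of the coupled pair, selected by `p`, is a Glauber dynamics. -/
theorem iterE_schedule_pair {p : (∀ v, Q v) × (∀ v, Q v) → ∀ v, Q v}
    (hp : ∀ v z (g : (∀ v, Q v) → ℝ), ∑ z', Φ.pairKernel π v z z' * g (p z') =
      ∑ a, Φ.condMarginal π v (p z) a * g (Function.update (p z) v a))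
    (f : (∀ v, Q v) → ℝ) (k s : ℕ) (r₀ : ℕ → V) (ω : ℕ → (∀ v, Q v) × (∀ v, Q v)) :
    iterE (scheduleKernel V) k s (fun r => iterE (fun s => Φ.pairKernel π (r (s + 1))) k s
      (fun ω => f (p (ω (s + k)))) ω) r₀ = (Φ.glauberOp π)^[k] f (p (ω s)) := by
  induction k generalizing s r₀ ω with
  | zero => rfl
  | succ k ih =>
    rw [Function.iterate_succ_apply', glauberOp]
    conv_lhs => rw [iterE]
    refine Finset.sum_congr rfl fun v _ => ?_
    rw [scheduleKernel, ← hp]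
    congr 1
    rw [iterE_congr (g := fun r => ∑ z, Φ.pairKernel π v (ω s) z *
      iterE (fun s => Φ.pairKernel π (r (s + 1))) k (s + 1)
        (fun ω => f (p (ω (s + 1 + k)))) (Function.update ω (s + 1) z))]
    · rw [iterE_sum]
      refine Finset.sum_congr rfl fun z _ => ?_
      rw [iterE_const_mul, ih, Function.update_self]
    · intro r hr
      simp only [iterE]
      rw [hr (s + 1) le_rfl, Function.update_self]
      simp only [show s + (k + 1) = s + 1 + k by ring]

/-- The coupling inequality: the distance of the law of `Y_T` from `μ_π` is at most the largest
probability, over initial states of the pair, that the coupled chains differ at time `T`. -/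
theorem IsAdmissible.tvDist_glauberLaw_le [Nonempty V] [Nonempty ι] (h : Φ.IsAdmissible π η κ)
    (hη : η < 1 / 2) (hΩ : ∀ v, Nonempty (Ω v)) (T : ℕ) (X : ∀ v, Q v) (r₀ : V) {ε : ℝ}
    (hε : ∀ Z, Φ.pairE π T r₀ (X, Z) (fun _ ω => if (ω T).1 ≠ (ω T).2 then 1 else 0) ≤ ε) :
    tvDist (Φ.glauberLaw π X T) (Φ.projMeasure π) ≤ ε := by
  let δ : (∀ v, Q v) → (∀ v, Q v) → ℝ := fun a y => if y = a then 1 else 0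
  have h1 : ∀ a, Φ.glauberLaw π X T a = (Φ.glauberOp π)^[T] (δ a) X := fun a => by
    rw [← sum_glauberLaw_mul]; simp [δ]
  have h2 : ∀ a, Φ.projMeasure π a = ∑ Z, Φ.projMeasure π Z * (Φ.glauberOp π)^[T] (δ a) Z :=
    fun a => by rw [sum_projMeasure_mul_glauberOp_iterate]; simp [δ]
  have hK0 : ∀ r : ℕ → V, ∀ s z z', 0 ≤ (fun s => Φ.pairKernel π (r (s + 1))) s z z' :=
    fun r s z z' => h.pairKernel_nonneg hη hΩ _ z z'
  have h3 : ∀ a Z, |(Φ.glauberOp π)^[T] (δ a) X - (Φ.glauberOp π)^[T] (δ a) Z| ≤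
      Φ.pairE π T r₀ (X, Z) (fun _ ω => |δ a (ω T).1 - δ a (ω T).2|) := fun a Z => by
    have e1 := iterE_schedule_pair (p := Prod.fst) (h.sum_pairKernel_mul_fst hη hΩ) (δ a) T 0
      (fun _ => r₀) (fun _ => (X, Z))
    have e2 := iterE_schedule_pair (p := Prod.snd) (h.sum_pairKernel_mul_snd hη hΩ) (δ a) T 0
      (fun _ => r₀) (fun _ => (X, Z))
    simp only [zero_add] at e1 e2
    rw [← e1, ← e2, ← iterE_sub]
    refine (abs_iterE_le scheduleKernel_nonneg _ _ _ _).trans ?_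
    refine iterE_le_iterE scheduleKernel_nonneg _ _ _ fun r _ _ => ?_
    rw [← iterE_sub]
    exact abs_iterE_le (hK0 r) _ _ _ _
  have h4 : ∀ Z, ∑ a, |(Φ.glauberOp π)^[T] (δ a) X - (Φ.glauberOp π)^[T] (δ a) Z| ≤ 2 * ε :=
    fun Z => by
    refine (Finset.sum_le_sum fun a _ => h3 a Z).trans ?_
    unfold pairE
    rw [← iterE_sum]
    refine le_trans ?_ (mul_le_mul_of_nonneg_left (hε Z) zero_le_two)
    unfold pairE
    rw [← iterE_const_mul]
    refine iterE_le_iterE scheduleKernel_nonneg _ _ _ fun r _ _ => ?_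
    rw [← iterE_sum, ← iterE_const_mul]
    refine iterE_le_iterE (hK0 r) _ _ _ fun ω _ _ => ?_
    by_cases hne : (ω T).1 = (ω T).2
    · simp [hne]
    · simp only [ne_eq, hne, not_false_eq_true, if_true]
      calc ∑ a, |δ a (ω T).1 - δ a (ω T).2| ≤ ∑ a, (δ a (ω T).1 + δ a (ω T).2) := by
            refine Finset.sum_le_sum fun a _ => ?_
            simp only [δ]; split_ifs <;> norm_num
        _ = 2 * 1 := by simp [δ, Finset.sum_add_distrib]; norm_num
  have h5 : ∀ a, |Φ.glauberLaw π X T a - Φ.projMeasure π a| ≤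
      ∑ Z, Φ.projMeasure π Z * |(Φ.glauberOp π)^[T] (δ a) X - (Φ.glauberOp π)^[T] (δ a) Z| :=
    fun a => by
    have : Φ.glauberLaw π X T a - Φ.projMeasure π a = ∑ Z, Φ.projMeasure π Z *
        ((Φ.glauberOp π)^[T] (δ a) X - (Φ.glauberOp π)^[T] (δ a) Z) := by
      simp_rw [mul_sub, Finset.sum_sub_distrib]
      rw [← h2, ← Finset.sum_mul, h.sum_projMeasure hη hΩ, one_mul, h1]
    rw [this]
    refine (Finset.abs_sum_le_sum_abs _ _).trans (Finset.sum_le_sum fun Z _ => ?_)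
    rw [abs_mul, abs_of_nonneg (projMeasure_nonneg Z)]
  unfold tvDist
  have h6 : ∑ a, |Φ.glauberLaw π X T a - Φ.projMeasure π a| ≤ 2 * ε := by
    refine (Finset.sum_le_sum fun a _ => h5 a).trans ?_
    rw [Finset.sum_comm]
    calc _ ≤ ∑ Z, Φ.projMeasure π Z * (2 * ε) := by
          refine Finset.sum_le_sum fun Z _ => ?_
          rw [← Finset.mul_sum]
          exact mul_le_mul_of_nonneg_left (h4 Z) (projMeasure_nonneg Z)
      _ = 2 * ε := by rw [← Finset.sum_mul, h.sum_projMeasure hη hΩ, one_mul]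
  linarith

end Glauber

end AtomicCSP

/-! ### Shortest paths -/

/-- A path of minimal length is injective and induced. -/
theorem exists_induced_path {α : Type*} {R : α → α → Prop} {P A B : α → Prop}
    (h : ∃ (k : ℕ) (x : ℕ → α), A (x 0) ∧ B (x k) ∧ (∀ i ≤ k, P (x i)) ∧
      ∀ i < k, R (x i) (x (i + 1))) :
    ∃ (k : ℕ) (x : ℕ → α), A (x 0) ∧ B (x k) ∧ (∀ i ≤ k, P (x i)) ∧
      (∀ i < k, R (x i) (x (i + 1))) ∧ (∀ i j, i + 1 < j → j ≤ k → ¬ R (x i) (x j)) ∧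
      ∀ i j, i < j → j ≤ k → x i ≠ x j := by
  let k := Nat.find h
  obtain ⟨x, hA, hB, hP, hx⟩ := Nat.find_spec h
  -- Removing the `d` vertices after `x i` would give a shorter path.
  have splice : ∀ i d, 1 ≤ d → i + d ≤ k → (i + d = k → x i = x k) →
      (i + d < k → R (x i) (x (i + d + 1))) → False := by
    intro i d hd hk h1 h2
    refine Nat.find_min h (show k - d < Nat.find h from Nat.sub_lt (by omega) hd)
      ⟨fun n => if n ≤ i then x n else x (n + d), by simpa using hA, ?_, fun n hn => ?_,
        fun n hn => ?_⟩
    · dsimp only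
      split_ifs with hi
      · rw [show k - d = i by omega, h1 (by omega)]; exact hB
      · rw [show k - d + d = k by omega]; exact hB
    · dsimp only; split_ifs
      · exact hP n (by omega)
      · exact hP _ (by omega)
    · dsimp only
      rcases lt_trichotomy n i with hni | rfl | hni
      · rw [if_pos (by omega), if_pos (by omega)]; exact hx n (by omega)
      · rw [if_pos le_rfl, if_neg (by omega), show n + 1 + d = n + d + 1 by ring]
        exact h2 (by omega)
      · rw [if_neg (by omega), if_neg (by omega), show n + 1 + d = n + d + 1 by ring]
        exact hx _ (by omega)
  have hfar : ∀ i j, i + 1 < j → j ≤ k → ¬ R (x i) (x j) := fun i j hij hj hRij =>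
    splice i (j - i - 1) (by omega) (by omega) (fun h => by omega)
      (fun _ => by rwa [show i + (j - i - 1) + 1 = j by omega])
  refine ⟨k, x, hA, hB, hP, hx, hfar, fun i j hij hj heq => ?_⟩
  rcases hj.eq_or_lt with rfl | hjk
  · exact splice i (k - i) (by omega) (by omega) (fun _ => heq) (fun h => by omega)
  · refine splice i (j - i) (by omega) (by omega) (fun h => by omega) fun _ => ?_
    rw [heq, show i + (j - i) = j by omega]
    exact hx j hjk

namespace AtomicCSP

variable {V : Type u₁} {Ω : V → Type u₂} {ι : Type u₃} {Q : V → Type u₄}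

/-! ### Percolation of discrepancies through space and time -/

/-- A node of the percolation: a constraint `C`, the block of time `[j w, (j + 1) w)` numbered `j`,
and the number `m` of blocks following it that the node also covers. -/
abbrev Node (ι : Type*) := ι × ℕ × ℕ

/-- One of the two coupled configurations. -/
def side : Bool → (∀ v, Q v) × (∀ v, Q v) → ∀ v, Q v
  | true, z => z.1
  | false, z => z.2

/-- The two configurations differ at `u`, and one of them takes the forbidden value of some
constraint there. Only such discrepancies can propagate. -/
def RelevantAt (Φ : AtomicCSP V Ω ι) (π : ∀ v, Ω v → Q v) (u : V)
    (a b : Q u) : Prop :=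
  a ≠ b ∧ ∃ k, u ∈ Φ.vbl k ∧ (a = π u (Φ.bad k u) ∨ b = π u (Φ.bad k u))

/-- What a node with constraint `i` requires of the update of its distinguished variable `u` to the
values `a` and `b`. -/
def SpecialEvent (Φ : AtomicCSP V Ω ι) (π : ∀ v, Ω v → Q v) (i : ι) (u : V) (a b : Q u) : Prop :=
  Φ.RelevantAt π u a b ∨ a = π u (Φ.bad i u) ∨ b = π u (Φ.bad i u)

/-- The ways in which a node can occur: `some (s, u)` if its constraint is violated by one of the
configurations before step `s`, up to the variable `u` which is updated in that step, and `none` if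
it is violated at the beginning of its block. The Boolean tells by which configuration. -/
abbrev Pattern (V : Type*) := Option (ℕ × V) × Bool

/-- The node `z` occurs with the given pattern along the schedule `r` and the trajectory `ω`, for
blocks of length `w`. -/
def Matches (Φ : AtomicCSP V Ω ι) (π : ∀ v, Ω v → Q v) (w : ℕ) (r : ℕ → V)
    (ω : ℕ → (∀ v, Q v) × (∀ v, Q v)) (z : Node ι) : Pattern V → Prop
  | (some (s, u), χ) => s / w = z.2.1 ∧ u ∈ Φ.vblBar Q z.1 ∧ r (s + 1) = u ∧
      (∀ u' ∈ Φ.vblBar Q z.1, u' ≠ u → side χ (ω s) u' = π u' (Φ.bad z.1 u')) ∧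
      Φ.SpecialEvent π z.1 u ((ω (s + 1)).1 u) ((ω (s + 1)).2 u) ∧
      ∀ t, (z.2.1 + 1) * w ≤ t → t < (z.2.1 + z.2.2 + 1) * w → r (t + 1) ≠ u
  | (none, χ) => z.2.2 = 0 ∧
      ∀ u' ∈ Φ.vblBar Q z.1, side χ (ω (z.2.1 * w)) u' = π u' (Φ.bad z.1 u')

/-- The node `z` occurs: its constraint is violated, up to one variable updated in an unfavourable
way, by one of the two configurations during its block. -/
def Occurs (Φ : AtomicCSP V Ω ι) (π : ∀ v, Ω v → Q v) (w : ℕ) (r : ℕ → V)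
    (ω : ℕ → (∀ v, Q v) × (∀ v, Q v)) (z : Node ι) : Prop :=
  ∃ p, Φ.Matches π w r ω z p

/-- Two nodes are adjacent if their constraints share a variable and their time ranges meet. The
time range of `(C, j, m)` consists of the blocks `j - 1, …, j + m`: the values held during block `j`
are determined by updates in the blocks `j - 1` and `j`, except for variables not updated for a
whole block. -/
def Adj (Φ : AtomicCSP V Ω ι) (z z' : Node ι) : Prop :=
  (Φ.vbl z.1 ∩ Φ.vbl z'.1).Nonempty ∧ z.2.1 ≤ z'.2.1 + z'.2.2 + 1 ∧ z'.2.1 ≤ z.2.1 + z.2.2 + 1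

/-- The trajectory `ω` follows the schedule `r` for `T` steps, and a step with equal conditional
marginals chooses equal values. -/
def Follows [∀ v, Fintype (Q v)] (Φ : AtomicCSP V Ω ι) (π : ∀ v, Ω v → Q v) (T : ℕ) (r : ℕ → V)
    (ω : ℕ → (∀ v, Q v) × (∀ v, Q v)) : Prop :=
  ∀ s < T, ∃ a b, ω (s + 1) = (Function.update (ω s).1 (r (s + 1)) a,
      Function.update (ω s).2 (r (s + 1)) b) ∧
    (Φ.condMarginal π (r (s + 1)) (ω s).1 = Φ.condMarginal π (r (s + 1)) (ω s).2 → a = b)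

/-- A path of `k + 1` occurring nodes `x 0, …, x k` that starts at time `J₁ w`. -/
def IsPath (Φ : AtomicCSP V Ω ι) (π : ∀ v, Ω v → Q v) (w J₁ : ℕ) (r : ℕ → V)
    (ω : ℕ → (∀ v, Q v) × (∀ v, Q v)) (k : ℕ) (x : ℕ → Node ι) : Prop :=
  (x 0).2.1 + (x 0).2.2 + 1 = J₁ ∧
    (∀ i ≤ k, Φ.Occurs π w r ω (x i) ∧ 1 ≤ (x i).2.1 ∧ (x i).2.1 + (x i).2.2 + 1 ≤ J₁) ∧
    ∀ i < k, Φ.Adj (x i) (x (i + 1))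

/-- The node `z` is the end of a path of occurring nodes that starts at time `J₁ w`. -/
def Reached (Φ : AtomicCSP V Ω ι) (π : ∀ v, Ω v → Q v) (w J₁ : ℕ) (r : ℕ → V)
    (ω : ℕ → (∀ v, Q v) × (∀ v, Q v)) (z : Node ι) : Prop :=
  ∃ k x, Φ.IsPath π w J₁ r ω k x ∧ x k = z

section Percolation

variable {Φ : AtomicCSP V Ω ι} {π : ∀ v, Ω v → Q v} {η κ : ℝ} {w J₀ J₁ T : ℕ} {r : ℕ → V}
  {ω : ℕ → (∀ v, Q v) × (∀ v, Q v)}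

theorem Reached.top {z : Node ι} (hz : z.2.1 + z.2.2 + 1 = J₁) (h1 : 1 ≤ z.2.1)
    (ho : Φ.Occurs π w r ω z) : Φ.Reached π w J₁ r ω z :=
  ⟨0, fun _ => z, ⟨hz, fun _ _ => ⟨ho, h1, hz.le⟩, fun i hi => by omega⟩, rfl⟩

theorem Reached.step {z z' : Node ι} (h : Φ.Reached π w J₁ r ω z) (hadj : Φ.Adj z z')
    (hz : z'.2.1 + z'.2.2 + 1 ≤ J₁) (h1 : 1 ≤ z'.2.1) (ho : Φ.Occurs π w r ω z') :
    Φ.Reached π w J₁ r ω z' := by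
  obtain ⟨k, x, ⟨htop, hx, hR⟩, rfl⟩ := h
  refine ⟨k + 1, fun i => if i ≤ k then x i else z', ⟨by simpa using htop, fun i hi => ?_,
    fun i hi => ?_⟩, by simp⟩
  · dsimp only
    split_ifs with hik
    · exact hx i hik
    · exact ⟨ho, h1, hz⟩
  · dsimp only
    rcases (Nat.lt_succ_iff.1 hi).eq_or_lt with rfl | hik
    · rw [if_pos le_rfl, if_neg (by omega)]; exact hadj
    · rw [if_pos hik.le, if_pos (by omega)]; exact hR i hik

variable [∀ v, Fintype (Q v)]

theorem Follows.apply_of_ne (hf : Φ.Follows π T r ω) {s : ℕ} (hs : s < T) {u : V}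
    (hu : r (s + 1) ≠ u) (χ : Bool) : side χ (ω (s + 1)) u = side χ (ω s) u := by
  obtain ⟨a, b, h, -⟩ := hf s hs
  rw [h]
  cases χ <;> simp [side, Function.update_of_ne hu.symm]

theorem Follows.apply_eq (hf : Φ.Follows π T r ω) {s t : ℕ} (hst : s ≤ t) (ht : t ≤ T) {u : V}
    (hu : ∀ t', s ≤ t' → t' < t → r (t' + 1) ≠ u) (χ : Bool) :
    side χ (ω t) u = side χ (ω s) u := by
  induction t, hst using Nat.le_induction with
  | base => rfl
  | succ t hst ih =>
    rw [hf.apply_of_ne (by omega) (hu t hst (by omega)), ih (by omega) fun t' h1 h2 =>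
      hu t' h1 (by omega)]

/-- A constraint violated at some time occurs in the block of that time: it was violated at the
beginning of the block or has become violated by an update of one of its variables. -/
theorem Follows.occurs_of_violated (hf : Φ.Follows π T r ω) (hw : 0 < w) {s : ℕ} (hs : s ≤ T)
    {i : ι} {χ : Bool} (h : ∀ u ∈ Φ.vblBar Q i, side χ (ω s) u = π u (Φ.bad i u)) :
    Φ.Occurs π w r ω (i, s / w, 0) := by
  induction s with
  | zero => exact ⟨(none, χ), rfl, by simpa using h⟩
  | succ s ih =>
    by_cases hblk : (s + 1) / w * w = s + 1
    · exact ⟨(none, χ), rfl, by simpa [hblk] using h⟩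
    have hdiv : (s + 1) / w = s / w := by
      refine le_antisymm ?_ (Nat.div_le_div_right (by omega))
      rw [Nat.le_div_iff_mul_le hw]
      have := Nat.div_mul_le_self (s + 1) w
      omega
    rw [hdiv]
    by_cases hv : ∀ u ∈ Φ.vblBar Q i, side χ (ω s) u = π u (Φ.bad i u)
    · exact ih (by omega) hv
    push Not at hv
    obtain ⟨u, hu, hne⟩ := hv
    have hru : r (s + 1) = u := by
      by_contra hru
      exact hne ((hf.apply_of_ne (by omega) hru χ).symm.trans (h u hu))
    refine ⟨(some (s, u), χ), rfl, hu, hru, fun u' hu' huu' => ?_, Or.inr ?_, fun t h1 h2 => ?_⟩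
    · rw [← hf.apply_of_ne (by omega) (by rw [hru]; exact huu'.symm) χ]; exact h u' hu'
    · have := h u hu
      cases χ
      · exact Or.inr this
      · exact Or.inl this
    · simp only [add_zero] at h1 h2; omega

theorem mem_vblBar_of_ne {i : ι} {u : V} (hu : u ∈ Φ.vbl i) {a b : Q u} (hab : a ≠ b) :
    u ∈ Φ.vblBar Q i := by
  refine Finset.mem_filter.2 ⟨hu, ?_⟩
  rw [Nat.card_eq_fintype_card]
  exact Fintype.one_lt_card_iff.2 ⟨a, b, hab⟩

omit [∀ v, Fintype (Q v)] in
theorem ViolatedOff.eq_of_mem {v u : V} {X : ∀ v, Q v} {i : ι} (h : Φ.ViolatedOff π v X i)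
    (hu : u ∈ Φ.vblBar Q i) (huv : u ≠ v) : X u = π u (Φ.bad i u) :=
  h u (Finset.mem_filter.1 hu).1 huv

omit [∀ v, Fintype (Q v)] in
theorem exists_side_of_violatedOff {v : V} {z : (∀ v, Q v) × (∀ v, Q v)} {i : ι}
    (h : Φ.ViolatedOff π v z.1 i ∨ Φ.ViolatedOff π v z.2 i) :
    ∃ χ, ∀ u ∈ Φ.vblBar Q i, u ≠ v → side χ z u = π u (Φ.bad i u) := by
  rcases h with h | h
  · exact ⟨true, fun u hu huv => h.eq_of_mem hu huv⟩
  · exact ⟨false, fun u hu huv => h.eq_of_mem hu huv⟩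

variable [Fintype V] [∀ v, Fintype (Ω v)] [Fintype ι]

/-- A relevant discrepancy at time `t` is traced back to the last update of its variable; that
update was made with differing conditional marginals, so that the cluster of the variable leads to
an earlier relevant discrepancy. All constraints met on the way occur. -/
theorem IsAdmissible.exists_reached [Nonempty ι] (h : Φ.IsAdmissible π η κ)
    (hη : η < 1 / 2) (hΩ : ∀ v, Nonempty (Ω v)) (hf : Φ.Follows π T r ω) (hw : 0 < w)
    (hJ : J₀ ≤ J₁) (hT : J₁ * w ≤ T)
    (hupd : ∀ u, ∃ s, w ≤ s ∧ s < J₀ * w ∧ r (s + 1) = u) (t : ℕ) (ht : t ≤ J₁ * w) (u : V)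
    (hu : Φ.RelevantAt π u ((ω t).1 u) ((ω t).2 u))
    (hz : t = J₁ * w ∨ ∃ z, Φ.Reached π w J₁ r ω z ∧ z.2.1 = t / w ∧ u ∈ Φ.vbl z.1) :
    ∃ z, Φ.Reached π w J₁ r ω z ∧ z.2.1 < J₀ := by
  induction t using Nat.strong_induction_on generalizing u with
  | _ t ih =>
  by_cases htJ : t < J₀ * w
  · rcases hz with rfl | ⟨z, hz, hzt, -⟩
    · exact absurd htJ (not_lt.2 (Nat.mul_le_mul_right w hJ))
    · exact ⟨z, hz, by rw [hzt]; exact (Nat.div_lt_iff_lt_mul hw).2 htJ⟩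
  push Not at htJ
  -- The last update of `u` before `t`.
  obtain ⟨s, hsw, hst, hsu, hlast⟩ : ∃ s, w ≤ s ∧ s < t ∧ r (s + 1) = u ∧
      ∀ t', s + 1 ≤ t' → t' < t → r (t' + 1) ≠ u := by
    obtain ⟨s₀, h1, h2, h3⟩ := hupd u
    let S := (Finset.range t).filter fun s => r (s + 1) = u
    have hS : s₀ ∈ S := Finset.mem_filter.2 ⟨Finset.mem_range.2 (by omega), h3⟩
    have hm := S.max'_mem ⟨s₀, hS⟩
    obtain ⟨h4, h5⟩ := Finset.mem_filter.1 hm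
    refine ⟨_, h1.trans (S.le_max' s₀ hS), Finset.mem_range.1 h4, h5, fun t' h6 h7 h8 => ?_⟩
    have := S.le_max' t' (Finset.mem_filter.2 ⟨Finset.mem_range.2 h7, h8⟩)
    omega
  have hX : (ω t).1 u = (ω (s + 1)).1 u := hf.apply_eq (by omega) (by omega) hlast true
  have hY : (ω t).2 u = (ω (s + 1)).2 u := hf.apply_eq (by omega) (by omega) hlast false
  rw [hX, hY] at hu
  have hblk : s / w + 1 ≤ J₁ := (Nat.div_lt_iff_lt_mul hw).2 (by omega)
  have hblk1 : 1 ≤ s / w := (Nat.le_div_iff_mul_le hw).2 (by omega)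
  have hne : Φ.condMarginal π u (ω s).1 ≠ Φ.condMarginal π u (ω s).2 := by
    obtain ⟨a, b, h1, h2⟩ := hf s (by omega)
    intro heq
    have hab := h2 (by rw [hsu]; exact heq)
    refine hu.1 ?_
    rw [h1]
    subst hsu
    simpa using hab
  -- A constraint at `u` occurs in the block of `s` and covers the blocks up to that of `t`, during
  -- which `u` is not updated.
  have hbase : ∀ i, u ∈ Φ.vbl i →
      (Φ.ViolatedOff π u (ω s).1 i ∨ Φ.ViolatedOff π u (ω s).2 i) →
      ∃ m, Φ.Reached π w J₁ r ω (i, s / w, m) := by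
    intro i hui hvi
    obtain ⟨χ, hχ⟩ := exists_side_of_violatedOff hvi
    have hocc : ∀ m, (∀ t', (s / w + 1) * w ≤ t' → t' < (s / w + m + 1) * w → t' < t) →
        Φ.Occurs π w r ω (i, s / w, m) := fun m hm =>
      ⟨(some (s, u), χ), rfl, mem_vblBar_of_ne hui hu.1, hsu, hχ, Or.inl hu, fun t' h1 h2 =>
        hlast t' ((Nat.lt_mul_of_div_lt (Nat.lt_succ_self _) hw).trans_le h1) (hm t' h1 h2)⟩
    rcases hz with rfl | ⟨z, hz, hzt, huz⟩
    · refine ⟨J₁ - 1 - s / w, .top (by dsimp only; omega) hblk1 (hocc _ fun t' _ h2 => ?_)⟩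
      rwa [show s / w + (J₁ - 1 - s / w) + 1 = J₁ by omega] at h2
    · have hst' : s / w ≤ z.2.1 := hzt ▸ Nat.div_le_div_right hst.le
      have hzJ : z.2.1 ≤ J₁ := hzt ▸ Nat.div_le_of_le_mul (by rw [mul_comm]; exact ht)
      refine ⟨z.2.1 - 1 - s / w, hz.step ⟨⟨u, Finset.mem_inter.2 ⟨huz, hui⟩⟩, ?_, ?_⟩ ?_ hblk1
        (hocc _ fun t' h1 h2 => ?_)⟩
      · dsimp only; omega
      · dsimp only; omega
      · dsimp only; omega
      · rcases hst'.eq_or_lt with heq | hlt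
        · rw [← heq, show s / w + (s / w - 1 - s / w) + 1 = s / w + 1 by omega] at h2
          omega
        · rw [show s / w + (z.2.1 - 1 - s / w) + 1 = z.2.1 by omega, hzt] at h2
          exact h2.trans_le (Nat.div_mul_le_self t w)
  have hcl : ∀ i, Φ.Cluster π u (ω s).1 (ω s).2 i →
      ∃ m, Φ.Reached π w J₁ r ω (i, s / w, m) := by
    intro i hi
    induction hi with
    | base i hui hvi => exact hbase i hui hvi
    | step i k _ hik hvk ihi =>
      by_cases huk : u ∈ Φ.vbl k
      · exact hbase k huk hvk
      obtain ⟨m, hm⟩ := ihi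
      obtain ⟨χ, hχ⟩ := exists_side_of_violatedOff hvk
      refine ⟨0, hm.step ⟨hik, by dsimp only; omega, by dsimp only; omega⟩ hblk hblk1
        (hf.occurs_of_violated hw (by omega) (χ := χ) fun u' hu' => hχ u' hu' ?_)⟩
      rintro rfl
      exact huk (Finset.mem_filter.1 hu').1
  obtain ⟨i, hi, u', hu'i, hu'u, hu'⟩ := h.exists_cluster_ne hη hΩ hne
  obtain ⟨m, hm⟩ := hcl i hi
  exact ih s hst (by omega) u' ⟨hu', i, hu'i, hi.violatedOff.imp (fun h => h u' hu'i hu'u)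
    (fun h => h u' hu'i hu'u)⟩ (Or.inr ⟨_, hm, rfl, hu'i⟩)

/-- Without relevant discrepancies at time `t₀`, the chains coalesce once all variables have been
updated. -/
theorem IsAdmissible.eq_of_not_relevant [Nonempty ι] (h : Φ.IsAdmissible π η κ)
    (hη : η < 1 / 2) (hΩ : ∀ v, Nonempty (Ω v)) (hf : Φ.Follows π T r ω) {t₀ : ℕ} (ht₀ : t₀ ≤ T)
    (hupd : ∀ u, ∃ s, t₀ ≤ s ∧ s < T ∧ r (s + 1) = u)
    (hrel : ∀ u, ¬ Φ.RelevantAt π u ((ω t₀).1 u) ((ω t₀).2 u)) : (ω T).1 = (ω T).2 := by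
  have key : ∀ t, t₀ ≤ t → t ≤ T → (∀ u, ¬ Φ.RelevantAt π u ((ω t).1 u) ((ω t).2 u)) ∧
      ∀ u, (ω t).1 u ≠ (ω t).2 u → ∀ s, t₀ ≤ s → s < t → r (s + 1) ≠ u := by
    intro t ht
    induction t, ht using Nat.le_induction with
    | base => exact fun _ => ⟨hrel, fun u _ s h1 h2 => by omega⟩
    | succ t ht ih =>
      intro htT
      obtain ⟨ih1, ih2⟩ := ih (by omega)
      obtain ⟨a, b, h1, h2⟩ := hf t (by omega)
      have hab : a = b := h2 (by
        by_contra hne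
        obtain ⟨i, hi, u', hu'i, hu'u, hu'⟩ := h.exists_cluster_ne hη hΩ hne
        exact ih1 u' ⟨hu', i, hu'i, hi.violatedOff.imp (fun h => h u' hu'i hu'u)
          (fun h => h u' hu'i hu'u)⟩)
      have hv : (ω (t + 1)).1 (r (t + 1)) = (ω (t + 1)).2 (r (t + 1)) := by rw [h1]; simpa using hab
      refine ⟨fun u hu => ?_, fun u hu s h3 h4 => ?_⟩
      · by_cases hru : r (t + 1) = u
        · subst hru; exact hu.1 hv
        · have e1 := hf.apply_of_ne (by omega) hru true
          have e2 := hf.apply_of_ne (by omega) hru false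
          simp only [side] at e1 e2
          rw [e1, e2] at hu
          exact ih1 u hu
      · rintro rfl
        by_cases hru : r (t + 1) = r (s + 1)
        · rw [← hru] at hu; exact hu hv
        · have e1 := hf.apply_of_ne (by omega) hru true
          have e2 := hf.apply_of_ne (by omega) hru false
          simp only [side] at e1 e2
          rw [e1, e2] at hu
          have hst : s ≠ t := by rintro rfl; exact hru rfl
          exact ih2 _ hu s h3 (by omega) rfl
  funext u
  by_contra hu
  obtain ⟨s, h1, h2, h3⟩ := hupd u
  exact (key T ht₀ le_rfl).2 u hu s h1 h2 h3

omit [Fintype V] [∀ v, Fintype (Ω v)] [Fintype ι] in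
/-- The time ranges of a path from block `J₁` to a block below `J₀` cover the difference. -/
theorem le_add_sum_of_adj {k : ℕ} {x : ℕ → Node ι} (htop : (x 0).2.1 + (x 0).2.2 + 1 = J₁)
    (hbot : (x k).2.1 < J₀) (hadj : ∀ i < k, Φ.Adj (x i) (x (i + 1))) :
    J₁ ≤ J₀ + ∑ i ∈ Finset.range (k + 1), ((x i).2.2 + 1) := by
  have : ∀ i ≤ k, J₁ ≤ (x i).2.1 + ∑ l ∈ Finset.range (i + 1), ((x l).2.2 + 1) := by
    intro i
    induction i with
    | zero => intro _; simp; omega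
    | succ i ih =>
      intro hi
      have h1 := ih (by omega)
      have h2 := (hadj i (by omega)).2.1
      rw [Finset.sum_range_succ]
      omega
  have := this k le_rfl
  omega

end Percolation

end AtomicCSP

/-! ### Products of events at distinct times -/

section IterE

variable {Z : Type*} [Fintype Z] {W : ℕ → Z → Z → ℝ}

theorem prod_ite_one_zero {β : Type*} (D : Finset β) (P : β → Prop) [DecidablePred P]
    [Decidable (∀ b ∈ D, P b)] :
    ∏ b ∈ D, (if P b then (1 : ℝ) else 0) = if ∀ b ∈ D, P b then 1 else 0 := by
  split_ifs with h
  · exact Finset.prod_eq_one fun b hb => by simp [h b hb]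
  · push Not at h
    obtain ⟨b, hb, hP⟩ := h
    exact Finset.prod_eq_zero hb (by simp [hP])

/-- Events about single steps, at distinct times: the probability that all of them happen is at most
the product of uniform bounds on their conditional probabilities. -/
theorem iterE_events_le (hW : ∀ s z z', 0 ≤ W s z z') (hW1 : ∀ s z, ∑ z', W s z z' = 1)
    {β : Type*} (D : Finset β) (τ : β → ℕ) (T : ℕ) (hT : ∀ b ∈ D, τ b < T)
    (hinj : ∀ b ∈ D, ∀ b' ∈ D, τ b = τ b' → b = b') (e : β → Z → Prop) (α : β → ℝ)
    (h : ∀ b ∈ D, ∀ z, ∑ z', W (τ b) z z' * (if e b z' then 1 else 0) ≤ α b) (ω : ℕ → Z) :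
    iterE W T 0 (fun ω => if ∀ b ∈ D, e b (ω (τ b + 1)) then 1 else 0) ω ≤ ∏ b ∈ D, α b := by
  rcases isEmpty_or_nonempty Z with hZ | ⟨⟨z₀⟩⟩
  · exact (hZ.false (ω 0)).elim
  have hα : ∀ b ∈ D, 0 ≤ α b := fun b hb => le_trans
    (Finset.sum_nonneg fun z' _ => mul_nonneg (hW _ _ _) (by split_ifs <;> norm_num)) (h b hb z₀)
  have key := iterE_prod_le hW (g := fun s _ z' => ∏ b ∈ D with τ b = s, if e b z' then 1 else 0)
    (fun s z z' => Finset.prod_nonneg fun b _ => by split_ifs <;> norm_num)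
    (a := fun s => ∏ b ∈ D with τ b = s, α b)
    (fun s => Finset.prod_nonneg fun b hb => hα b (Finset.mem_filter.1 hb).1) ?_ T 0 ω
  · rw [Finset.range_zero, Finset.prod_empty, one_mul, zero_add, ← Finset.range_eq_Ico,
      Finset.prod_fiberwise_of_maps_to fun b hb => Finset.mem_range.2 (hT b hb)] at key
    refine le_trans (le_of_eq ?_) key
    congr 1
    funext ω
    rw [← prod_ite_one_zero, ← Finset.prod_fiberwise_of_maps_to (g := τ) (t := Finset.range T)
      fun b hb => Finset.mem_range.2 (hT b hb)]
    refine Finset.prod_congr rfl fun s _ => Finset.prod_congr rfl fun b hb => ?_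
    rw [(Finset.mem_filter.1 hb).2]
  · intro s z
    rcases (D.filter fun b => τ b = s).eq_empty_or_nonempty with hb | ⟨b, hb⟩
    · rw [hb]; simp [hW1]
    obtain ⟨hbD, hbs⟩ := Finset.mem_filter.1 hb
    have : (D.filter fun b => τ b = s) = {b} := by
      refine Finset.eq_singleton_iff_unique_mem.2 ⟨hb, fun b' hb' => ?_⟩
      obtain ⟨h1, h2⟩ := Finset.mem_filter.1 hb'
      exact hinj b' h1 b hbD (h2.trans hbs.symm)
    rw [this]
    simp only [Finset.prod_singleton]
    rw [← hbs]
    exact h b hbD z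

end IterE

/-! ### Events of the update schedule -/

theorem one_sixth_le_one_sub_inv_pow {n : ℕ} (hn : 2 ≤ n) : (1 / 6 : ℝ) ≤ (1 - (n : ℝ)⁻¹) ^ n := by
  obtain ⟨m, rfl⟩ : ∃ m, n = m + 1 := ⟨n - 1, by omega⟩
  have hm : (1 : ℝ) ≤ m := by exact_mod_cast (by omega : 1 ≤ m)
  have h1 : (1 - ((m + 1 : ℕ) : ℝ)⁻¹) = (1 + (m : ℝ)⁻¹)⁻¹ := by
    push_cast; field_simp; ring
  have h2 : (1 + (m : ℝ)⁻¹) ^ m ≤ Real.exp 1 := by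
    calc (1 + (m : ℝ)⁻¹) ^ m ≤ (Real.exp (m : ℝ)⁻¹) ^ m := by
          refine pow_le_pow_left₀ (by positivity) ?_ m
          rw [add_comm]; exact Real.add_one_le_exp _
      _ = Real.exp 1 := by rw [← Real.exp_nat_mul, mul_inv_cancel₀ (by positivity)]
  have h3 : 1 + (m : ℝ)⁻¹ ≤ 2 := by
    have := inv_le_one_of_one_le₀ hm
    linarith
  have h4 := Real.exp_one_lt_three
  rw [h1, inv_pow, one_div, inv_le_inv₀ (by norm_num) (by positivity), pow_succ]
  calc _ ≤ Real.exp 1 * 2 := by gcongr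
    _ ≤ 6 := by linarith

namespace AtomicCSP

/-- Prescribing the variables updated at given times, and excluding updates of given variables
during disjoint periods. The factor `6` compensates for the fact that a prescribed update also
avoids the excluded variables. -/
theorem iterE_schedule_le {V : Type*} [Fintype V] (hn : 2 ≤ Fintype.card V)
    {β : Type*} (P E : Finset β) (u : β → V) (s : β → ℕ) (I : β → Finset ℕ) (T : ℕ)
    (hs : ∀ b ∈ P, s b < T) (hI : ∀ b ∈ E, ∀ t ∈ I b, t < T)
    (hP : ∀ b ∈ P, ∀ b' ∈ P, s b = s b' → u b = u b' → b = b')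
    (hE : ∀ b ∈ E, ∀ b' ∈ E, u b = u b' → ∀ t ∈ I b, t ∈ I b' → b = b') (r₀ : ℕ → V) :
    iterE (scheduleKernel V) T 0 (fun r => if (∀ b ∈ P, r (s b + 1) = u b) ∧
        (∀ b ∈ E, ∀ t ∈ I b, r (t + 1) ≠ u b) then 1 else 0) r₀ ≤
      (∏ _b ∈ P, (6 * (Fintype.card V : ℝ)⁻¹)) *
        ∏ b ∈ E, (1 - (Fintype.card V : ℝ)⁻¹) ^ (I b).card := by
  set n := Fintype.card V with hn'
  have hn2 : (2 : ℝ) ≤ n := by exact_mod_cast hn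
  have hninv : (n : ℝ)⁻¹ ≤ 1 / 2 := by
    rw [one_div]; exact inv_anti₀ (by norm_num) hn2
  have hninv0 : 0 < (n : ℝ)⁻¹ := by positivity
  have hc0 : 0 ≤ 1 - (n : ℝ)⁻¹ := by linarith
  by_cases hPinj : ∀ b ∈ P, ∀ b' ∈ P, s b = s b' → b = b'
  swap
  · push Not at hPinj
    obtain ⟨b, hb, b', hb', hss, hne⟩ := hPinj
    calc _ ≤ iterE (scheduleKernel V) T 0 (fun _ => 0 * 0) r₀ := by
          refine iterE_le_iterE scheduleKernel_nonneg _ _ _ fun r _ _ => ?_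
          rw [if_neg]
          · simp
          · rintro ⟨h1, -⟩
            exact hne (hP b hb b' hb' hss ((h1 b hb).symm.trans (hss ▸ h1 b' hb')))
      _ = 0 := by rw [iterE_const_mul, zero_mul]
      _ ≤ _ := by positivity
  have key := iterE_prod_le (W := scheduleKernel V) scheduleKernel_nonneg
    (g := fun t _ v => (∏ b ∈ P with s b = t, if v = u b then 1 else 0) *
      ∏ b ∈ E with t ∈ I b, if v ≠ u b then 1 else 0)
    (fun t z z' => mul_nonneg (Finset.prod_nonneg fun b _ => by split_ifs <;> norm_num)
      (Finset.prod_nonneg fun b _ => by split_ifs <;> norm_num))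
    (a := fun t => (∏ b ∈ P with s b = t, (6 * (n : ℝ)⁻¹)) *
      ∏ b ∈ E with t ∈ I b, (1 - (n : ℝ)⁻¹))
    (fun t => by positivity) ?_ T 0 r₀
  · rw [Finset.range_zero, Finset.prod_empty, one_mul, zero_add, ← Finset.range_eq_Ico,
      Finset.prod_mul_distrib, Finset.prod_fiberwise_of_maps_to
        fun b hb => Finset.mem_range.2 (hs b hb)] at key
    have hcomm : ∀ f : β → ℕ → ℝ, ∏ t ∈ Finset.range T, ∏ b ∈ E with t ∈ I b, f b t =
        ∏ b ∈ E, ∏ t ∈ I b, f b t := fun f => by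
      refine Finset.prod_comm' fun t b => ?_
      simp only [Finset.mem_range, Finset.mem_filter]
      exact ⟨fun h => ⟨h.2.2, h.2.1⟩, fun h => ⟨hI b h.2 t h.1, h.2, h.1⟩⟩
    rw [hcomm] at key
    simp only [Finset.prod_const] at key ⊢
    refine le_trans (le_of_eq ?_) key
    congr 1
    funext r
    have hfib : ∏ t ∈ Finset.range T, ∏ b ∈ P with s b = t, (if r (t + 1) = u b then (1 : ℝ) else 0)
        = ∏ b ∈ P, if r (s b + 1) = u b then (1 : ℝ) else 0 := by
      rw [← Finset.prod_fiberwise_of_maps_to (g := s) (t := Finset.range T)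
        fun b hb => Finset.mem_range.2 (hs b hb)]
      refine Finset.prod_congr rfl fun s _ => Finset.prod_congr rfl fun b hb => ?_
      rw [(Finset.mem_filter.1 hb).2]
    rw [Finset.prod_mul_distrib, hcomm (fun b t => if r (t + 1) ≠ u b then 1 else 0), hfib]
    simp_rw [prod_ite_one_zero]
    by_cases h1 : ∀ b ∈ P, r (s b + 1) = u b
    · rw [if_pos h1, one_mul]
      exact if_congr (and_iff_right h1) rfl rfl
    · simp only [h1, false_and, if_false, zero_mul]
  · intro t v
    simp only [scheduleKernel, ← hn', ← Finset.mul_sum, Finset.prod_const]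
    set m := (E.filter fun b => t ∈ I b).card with hm
    set A := (E.filter fun b => t ∈ I b).image u with hA
    have hAcard : A.card = m := Finset.card_image_of_injOn fun b hb b' hb' h => by
      obtain ⟨h1, h2⟩ := Finset.mem_filter.1 (Finset.mem_coe.1 hb)
      obtain ⟨h3, h4⟩ := Finset.mem_filter.1 (Finset.mem_coe.1 hb')
      exact hE b h1 b' h3 h t h2 h4
    have hmn : m ≤ n := hAcard ▸ Finset.card_le_univ A
    rcases (P.filter fun b => s b = t).eq_empty_or_nonempty with hPt | ⟨b, hb⟩
    · rw [hPt]
      simp only [Finset.prod_empty, one_mul, Finset.card_empty, pow_zero]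
      have h1 : ∀ v', (∏ b ∈ E with t ∈ I b, if v' ≠ u b then (1 : ℝ) else 0) =
          if v' ∈ Aᶜ then 1 else 0 := fun v' => by
        rw [prod_ite_one_zero]
        congr 1
        simp only [hA, Finset.mem_compl, Finset.mem_image, eq_iff_iff, not_exists, not_and]
        exact ⟨fun h b hb h2 => h b hb h2.symm, fun h b hb h2 => h b hb h2.symm⟩
      simp_rw [h1]
      rw [Finset.sum_ite_mem, Finset.univ_inter, Finset.sum_const, nsmul_eq_mul, mul_one,
        Finset.card_compl, hAcard, Nat.cast_sub hmn]
      have h2 := one_add_mul_le_pow (a := -(n : ℝ)⁻¹) (by linarith) m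
      have h3 : (n : ℝ)⁻¹ * n = 1 := inv_mul_cancel₀ (by positivity)
      rw [← sub_eq_add_neg] at h2
      nlinarith
    · obtain ⟨hbP, hbt⟩ := Finset.mem_filter.1 hb
      have hPt : (P.filter fun b => s b = t) = {b} := by
        refine Finset.eq_singleton_iff_unique_mem.2 ⟨hb, fun b' hb' => ?_⟩
        obtain ⟨h1, h2⟩ := Finset.mem_filter.1 hb'
        exact hPinj b' h1 b hbP (h2.trans hbt.symm)
      rw [hPt]
      simp only [Finset.prod_singleton, Finset.card_singleton, pow_one]
      have h1 : ∑ v', (if v' = u b then (1 : ℝ) else 0) *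
          (∏ b ∈ E with t ∈ I b, if v' ≠ u b then (1 : ℝ) else 0) ≤ 1 := by
        calc _ ≤ ∑ v', (if v' = u b then (1 : ℝ) else 0) := by
              refine Finset.sum_le_sum fun v' _ => ?_
              rw [prod_ite_one_zero]
              split_ifs <;> norm_num
          _ = 1 := by simp
      have h2 : (1 / 6 : ℝ) ≤ (1 - (n : ℝ)⁻¹) ^ m := (one_sixth_le_one_sub_inv_pow hn).trans
        (pow_le_pow_of_le_one hc0 (by linarith) hmn)
      nlinarith

variable {V : Type u₁} {Ω : V → Type u₂} {ι : Type u₃} {Q : V → Type u₄}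

/-! ### Probabilities of single updates -/

theorem ite_or_le {S A B C : Prop} (h : S ↔ A ∨ B ∨ C) : (if S then (1 : ℝ) else 0) ≤
    (if A then 1 else 0) + (if B then 1 else 0) + (if C then 1 else 0) := by
  by_cases hA : A <;> by_cases hB : B <;> by_cases hC : C <;> simp [h, hA, hB, hC]

section OneStep

variable [Fintype V] [∀ v, Fintype (Ω v)] [Fintype ι] [∀ v, Fintype (Q v)]

/-- The local lemma bound `(1 - 3b)^{-Δ} ℙ_π[value(u) = C_π(u)]` on the probability that an update
of `u` chooses the forbidden value of the constraint `i`. -/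
def forbidBound (Φ : AtomicCSP V Ω ι) (π : ∀ v, Ω v → Q v) (i : ι) (u : V) : ℝ :=
  ((1 - 3 * Φ.bMax π) ^ Φ.degree)⁻¹ * projMarginal π u (π u (Φ.bad i u))

variable {Φ : AtomicCSP V Ω ι} {π : ∀ v, Ω v → Q v} {η κ : ℝ}

omit [Fintype V] [∀ v, Fintype (Ω v)] in
theorem one_le_zeta (i : ι) : 1 ≤ Φ.zeta π i := le_max_left _ _

omit [∀ v, Fintype (Ω v)] in
theorem min_le_zeta {i : ι} {u : V} (hu : u ∈ Φ.vblBar Q i) :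
    min ((1 - 3 * Φ.bMax π) ^ Φ.degree * Φ.qMax π / projMarginal π u (π u (Φ.bad i u)))
      (2 * (Φ.degree : ℝ)) ≤ Φ.zeta π i :=
  le_trans (le_ciSup (f := fun v : {v // v ∈ Φ.vblBar Q i} =>
    min ((1 - 3 * Φ.bMax π) ^ Φ.degree * Φ.qMax π / projMarginal π v.1 (π v.1 (Φ.bad i v.1)))
      (2 * (Φ.degree : ℝ))) (Set.finite_range _).bddAbove ⟨u, hu⟩) (le_max_right _ _)

variable [Nonempty ι] (h : Φ.IsAdmissible π η κ) (hη : η < 1 / 2) (hΩ : ∀ v, Nonempty (Ω v))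
include h hη hΩ

omit [Fintype V] in
theorem IsAdmissible.forbidBound_pos (i : ι) (u : V) : 0 < Φ.forbidBound π i u :=
  mul_pos (inv_pos.2 (h.rho_pos hη)) (h.projMarginal_pos u _)

theorem IsAdmissible.sum_coupling_eq_le (u : V) (X Y : ∀ v, Q v) (i : ι) :
    ∑ a, ∑ b, maxCoupling (Φ.condMarginal π u X) (Φ.condMarginal π u Y) a b *
      (if a = π u (Φ.bad i u) then 1 else 0) ≤ Φ.forbidBound π i u := by
  simp_rw [← Finset.sum_mul, sum_maxCoupling_right (h.sum_condMarginal hη hΩ u X)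
    (h.sum_condMarginal hη hΩ u Y)]
  simpa [forbidBound] using h.condMarginal_le hη hΩ u X _

theorem IsAdmissible.sum_coupling_eq_le' (u : V) (X Y : ∀ v, Q v) (i : ι) :
    ∑ a, ∑ b, maxCoupling (Φ.condMarginal π u X) (Φ.condMarginal π u Y) a b *
      (if b = π u (Φ.bad i u) then 1 else 0) ≤ Φ.forbidBound π i u := by
  rw [Finset.sum_comm]
  simp_rw [← Finset.sum_mul, sum_maxCoupling_left (h.sum_condMarginal hη hΩ u X)
    (h.sum_condMarginal hη hΩ u Y)]
  simpa [forbidBound] using h.condMarginal_le hη hΩ u Y _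

/-- An update creates a relevant discrepancy with probability at most `2 ζ(C)` times the bound for
the forbidden value of `C`: either because it creates a discrepancy at all, or because it hits one
of the at most `Δ` comparable forbidden values at its variable. -/
theorem IsAdmissible.sum_coupling_relevant_le (u : V) (X Y : ∀ v, Q v) (i : ι)
    (hu : u ∈ Φ.vblBar Q i) :
    ∑ a, ∑ b, maxCoupling (Φ.condMarginal π u X) (Φ.condMarginal π u Y) a b *
      (if Φ.RelevantAt π u a b then 1 else 0) ≤ 2 * Φ.zeta π i * Φ.forbidBound π i u := by
  have hw0 : ∀ a b, 0 ≤ maxCoupling (Φ.condMarginal π u X) (Φ.condMarginal π u Y) a b :=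
    maxCoupling_nonneg (condMarginal_nonneg u _) (condMarginal_nonneg u _)
      (h.sum_condMarginal hη hΩ u _) (h.sum_condMarginal hη hΩ u _)
  have hp := h.projMarginal_pos u (π u (Φ.bad i u))
  have hρ := h.rho_pos hη
  have hf := h.forbidBound_pos hη hΩ i u
  have hui := (Finset.mem_filter.1 hu).1
  rcases min_le_iff.1 (min_le_zeta (π := π) hu) with hq | hD
  · have h1 : ∑ a, ∑ b, maxCoupling (Φ.condMarginal π u X) (Φ.condMarginal π u Y) a b *
      (if Φ.RelevantAt π u a b then 1 else 0) ≤ 2 * Φ.qMax π := by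
      refine le_trans (Finset.sum_le_sum fun a _ => Finset.sum_le_sum fun b _ => ?_)
        ((sum_maxCoupling_ne (h.sum_condMarginal hη hΩ u X) (h.sum_condMarginal hη hΩ u Y)).trans
          (tvDist_condMarginal_le u X Y))
      by_cases hr : Φ.RelevantAt π u a b
      · simp [hr, hr.1]
      · simp only [hr, if_false, mul_zero]
        split_ifs
        · exact hw0 a b
        · exact le_rfl
    rw [div_le_iff₀ hp] at hq
    have h2 : Φ.qMax π ≤ Φ.zeta π i * Φ.forbidBound π i u := by
      have : Φ.zeta π i * Φ.forbidBound π i u = ((1 - 3 * Φ.bMax π) ^ Φ.degree)⁻¹ *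
          (Φ.zeta π i * projMarginal π u (π u (Φ.bad i u))) := by
        unfold forbidBound; ring
      rw [this, le_inv_mul_iff₀ hρ]
      exact hq
    linarith
  · have hcomp : ∀ k, u ∈ Φ.vbl k → Φ.forbidBound π k u ≤ 2 * Φ.forbidBound π i u := by
      intro k hk
      have := (h.comparable i k u hui hk).2
      unfold forbidBound
      calc _ ≤ ((1 - 3 * Φ.bMax π) ^ Φ.degree)⁻¹ *
            (2 * projMarginal π u (π u (Φ.bad i u))) :=
            mul_le_mul_of_nonneg_left this (inv_pos.2 hρ).le
        _ = _ := by ring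
    have h1 : ∑ a, ∑ b, maxCoupling (Φ.condMarginal π u X) (Φ.condMarginal π u Y) a b *
        (if Φ.RelevantAt π u a b then 1 else 0) ≤
        ∑ k with u ∈ Φ.vbl k, ∑ a, ∑ b,
          (maxCoupling (Φ.condMarginal π u X) (Φ.condMarginal π u Y) a b *
            (if a = π u (Φ.bad k u) then 1 else 0) +
          maxCoupling (Φ.condMarginal π u X) (Φ.condMarginal π u Y) a b *
            (if b = π u (Φ.bad k u) then 1 else 0)) := by
      refine le_trans ?_ Finset.sum_comm.le
      refine Finset.sum_le_sum fun a _ => ?_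
      refine le_trans ?_ Finset.sum_comm.le
      refine Finset.sum_le_sum fun b _ => ?_
      have hnn : ∀ k, 0 ≤ maxCoupling (Φ.condMarginal π u X) (Φ.condMarginal π u Y) a b *
            (if a = π u (Φ.bad k u) then 1 else 0) +
          maxCoupling (Φ.condMarginal π u X) (Φ.condMarginal π u Y) a b *
            (if b = π u (Φ.bad k u) then 1 else 0) := fun k => by
        have := hw0 a b
        split_ifs <;> simp [this]
      by_cases hr : Φ.RelevantAt π u a b
      · obtain ⟨-, k, hk, hab⟩ := id hr
        refine le_trans ?_ (Finset.single_le_sum (f := fun k =>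
          maxCoupling (Φ.condMarginal π u X) (Φ.condMarginal π u Y) a b *
            (if a = π u (Φ.bad k u) then 1 else 0) +
          maxCoupling (Φ.condMarginal π u X) (Φ.condMarginal π u Y) a b *
            (if b = π u (Φ.bad k u) then 1 else 0)) (fun k _ => hnn k)
          (Finset.mem_filter.2 ⟨Finset.mem_univ k, hk⟩))
        have := hw0 a b
        rcases hab with hab | hab <;> rw [if_pos hr, if_pos hab] <;> split_ifs <;> linarith
      · rw [if_neg hr, mul_zero]
        exact Finset.sum_nonneg fun k _ => hnn k
    have h2 : ∑ k with u ∈ Φ.vbl k, ∑ a, ∑ b,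
          (maxCoupling (Φ.condMarginal π u X) (Φ.condMarginal π u Y) a b *
            (if a = π u (Φ.bad k u) then 1 else 0) +
          maxCoupling (Φ.condMarginal π u X) (Φ.condMarginal π u Y) a b *
            (if b = π u (Φ.bad k u) then 1 else 0)) ≤
        ∑ k with u ∈ Φ.vbl k, 4 * Φ.forbidBound π i u := by
      refine Finset.sum_le_sum fun k hk => ?_
      simp_rw [Finset.sum_add_distrib]
      have e1 := h.sum_coupling_eq_le hη hΩ u X Y k
      have e2 := h.sum_coupling_eq_le' hη hΩ u X Y k
      have e3 := hcomp k (Finset.mem_filter.1 hk).2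
      linarith
    rw [Finset.sum_const, nsmul_eq_mul] at h2
    have h3 : ((Finset.univ.filter fun k => u ∈ Φ.vbl k).card : ℝ) ≤ Φ.degree := by
      exact_mod_cast Φ.card_mem_vbl_le_degree u
    nlinarith

/-- The probability of the special event at the distinguished variable of a node. -/
theorem IsAdmissible.sum_pairKernel_special_le (u : V) (z : (∀ v, Q v) × (∀ v, Q v)) (i : ι)
    (hu : u ∈ Φ.vblBar Q i) :
    ∑ z', Φ.pairKernel π u z z' * (if Φ.SpecialEvent π i u (z'.1 u) (z'.2 u) then 1 else 0) ≤
      4 * Φ.zeta π i * Φ.forbidBound π i u := by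
  rw [sum_pairKernel_mul u z (fun z' => if Φ.SpecialEvent π i u (z'.1 u) (z'.2 u) then 1 else 0)]
  simp only [Function.update_self]
  have hw0 : ∀ a b, 0 ≤ maxCoupling (Φ.condMarginal π u z.1) (Φ.condMarginal π u z.2) a b :=
    maxCoupling_nonneg (condMarginal_nonneg u _) (condMarginal_nonneg u _)
      (h.sum_condMarginal hη hΩ u _) (h.sum_condMarginal hη hΩ u _)
  have e1 := h.sum_coupling_eq_le hη hΩ u z.1 z.2 i
  have e2 := h.sum_coupling_eq_le' hη hΩ u z.1 z.2 i
  have e3 := h.sum_coupling_relevant_le hη hΩ u z.1 z.2 i hu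
  have hf := h.forbidBound_pos hη hΩ i u
  have hz := one_le_zeta (Φ := Φ) (π := π) i
  have h1 : ∑ a, ∑ b, maxCoupling (Φ.condMarginal π u z.1) (Φ.condMarginal π u z.2) a b *
      (if Φ.SpecialEvent π i u a b then 1 else 0) ≤
      ∑ a, ∑ b, (maxCoupling (Φ.condMarginal π u z.1) (Φ.condMarginal π u z.2) a b *
        (if Φ.RelevantAt π u a b then 1 else 0) +
        maxCoupling (Φ.condMarginal π u z.1) (Φ.condMarginal π u z.2) a b *
        (if a = π u (Φ.bad i u) then 1 else 0) +
        maxCoupling (Φ.condMarginal π u z.1) (Φ.condMarginal π u z.2) a b *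
        (if b = π u (Φ.bad i u) then 1 else 0)) := by
    refine Finset.sum_le_sum fun a _ => Finset.sum_le_sum fun b _ => ?_
    have hw := hw0 a b
    rw [← mul_add, ← mul_add]
    refine mul_le_mul_of_nonneg_left ?_ hw
    exact ite_or_le Iff.rfl
  simp_rw [Finset.sum_add_distrib] at h1
  nlinarith

theorem IsAdmissible.sum_pairKernel_side_le (u : V) (z : (∀ v, Q v) × (∀ v, Q v)) (i : ι)
    (χ : Bool) :
    ∑ z', Φ.pairKernel π u z z' * (if side χ z' u = π u (Φ.bad i u) then 1 else 0) ≤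
      Φ.forbidBound π i u := by
  cases χ
  · refine (le_of_eq ?_).trans (h.sum_coupling_eq_le' hη hΩ u z.1 z.2 i)
    rw [sum_pairKernel_mul u z (fun z' => if side false z' u = π u (Φ.bad i u) then 1 else 0)]
    simp only [side, Function.update_self]
  · refine (le_of_eq ?_).trans (h.sum_coupling_eq_le hη hΩ u z.1 z.2 i)
    rw [sum_pairKernel_mul u z (fun z' => if side true z' u = π u (Φ.bad i u) then 1 else 0)]
    simp only [side, Function.update_self]

end OneStep

/-! ### Joint occurrence of non-adjacent nodes -/

/-- `u` is the variable whose update is recorded in the pattern. -/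
def Distinguished (o : Option (ℕ × V)) (u : V) : Prop := ∃ s, o = some (s, u)

/-- The time before which the constraint of `z` is violated according to the pattern. -/
def startTime (w : ℕ) (z : Node ι) : Option (ℕ × V) → ℕ
  | some (s, _) => s
  | none => z.2.1 * w

/-- The pattern can be a pattern of `z`. -/
def IsPattern (Q : V → Type u₄) (Φ : AtomicCSP V Ω ι) (w : ℕ) (z : Node ι) :
    Option (ℕ × V) → Prop
  | some (s, u) => s / w = z.2.1 ∧ u ∈ Φ.vblBar Q z.1
  | none => z.2.2 = 0

/-- The period of time whose updates of `u` matter for a pattern of `z`: for the distinguished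
variable, the blocks after that of `z`, during which it must not be updated; for any other variable,
the `w` steps before the violation, during which its last update, if any, must choose the forbidden
value. -/
def period (w : ℕ) (z : Node ι) (o : Option (ℕ × V)) (u : V) : Finset ℕ :=
  if Distinguished o u then Finset.Ico ((z.2.1 + 1) * w) ((z.2.1 + z.2.2 + 1) * w)
  else Finset.Ico (startTime w z o - w) (startTime w z o)

/-- The time `t` belongs to the time range of the node `z`. -/
def InRange (w : ℕ) (z : Node ι) (t : ℕ) : Prop :=
  z.2.1 ≤ t / w + 1 ∧ t / w ≤ z.2.1 + z.2.2

/-- The last time in `I` at which the schedule updates `u`. -/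
def lastIn (r : ℕ → V) (I : Finset ℕ) (u : V) : ℕ := (I.filter fun t => r (t + 1) = u).sup id

/-- The time of the update of `u` that a pattern of `z` constrains. -/
def decisiveTime (w : ℕ) (r : ℕ → V) (z : Node ι) (o : Option (ℕ × V)) (u : V) : ℕ :=
  if Distinguished o u then startTime w z o else lastIn r (period w z o u) u

/-- The requirement on the states after the decisive update of `u`. -/
def DecisiveEvent (Φ : AtomicCSP V Ω ι) (π : ∀ v, Ω v → Q v) (z : Node ι) (p : Pattern V) (u : V)
    (y : (∀ v, Q v) × (∀ v, Q v)) : Prop :=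
  if Distinguished p.1 u then Φ.SpecialEvent π z.1 u (y.1 u) (y.2 u)
  else side p.2 y u = π u (Φ.bad z.1 u)

section Geometry

variable {Φ : AtomicCSP V Ω ι} {w : ℕ} {z z' : Node ι} {o : Option (ℕ × V)} {u : V}

theorem startTime_div (hw : 0 < w) (ho : IsPattern Q Φ w z o) : startTime w z o / w = z.2.1 := by
  rcases o with _ | ⟨s, v⟩
  · exact Nat.mul_div_cancel _ hw
  · exact ho.1

theorem inRange_startTime (hw : 0 < w) (ho : IsPattern Q Φ w z o) :
    InRange w z (startTime w z o) := by
  unfold InRange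
  rw [startTime_div hw ho]
  omega

theorem mul_le_startTime (hw : 0 < w) (ho : IsPattern Q Φ w z o) :
    z.2.1 * w ≤ startTime w z o := by
  rw [← startTime_div hw ho]; exact Nat.div_mul_le_self _ _

theorem startTime_lt (hw : 0 < w) (ho : IsPattern Q Φ w z o) :
    startTime w z o < (z.2.1 + 1) * w := by
  rw [← startTime_div hw ho]
  exact Nat.lt_mul_of_div_lt (Nat.lt_succ_self _) hw

theorem inRange_of_mem_period (hw : 0 < w) (ho : IsPattern Q Φ w z o) {t : ℕ}
    (ht : t ∈ period w z o u) : InRange w z t := by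
  unfold period at ht
  split_ifs at ht with hd
  · obtain ⟨h1, h2⟩ := Finset.mem_Ico.1 ht
    have h3 : z.2.1 + 1 ≤ t / w := (Nat.le_div_iff_mul_le hw).2 h1
    have h4 : t / w < z.2.1 + z.2.2 + 1 := (Nat.div_lt_iff_lt_mul hw).2 h2
    exact ⟨by omega, by omega⟩
  · obtain ⟨h1, h2⟩ := Finset.mem_Ico.1 ht
    have h3 := startTime_div hw ho
    have h4 : t / w ≤ startTime w z o / w := Nat.div_le_div_right h2.le
    have h5 : startTime w z o / w ≤ (t + w) / w := Nat.div_le_div_right (by omega)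
    rw [Nat.add_div_right _ hw] at h5
    exact ⟨by omega, by omega⟩

theorem card_period (hw : 0 < w) (ho : IsPattern Q Φ w z o) (hz : 1 ≤ z.2.1) :
    (period w z o u).card = if Distinguished o u then z.2.2 * w else w := by
  unfold period
  split_ifs with hd
  · rw [Nat.card_Ico, ← Nat.sub_mul]
    congr 1
    omega
  · rw [Nat.card_Ico]
    have := mul_le_startTime hw ho
    have : 1 * w ≤ z.2.1 * w := Nat.mul_le_mul_right w hz
    omega

theorem lt_of_inRange (hw : 0 < w) {t T : ℕ} (ht : InRange w z t)
    (hT : (z.2.1 + z.2.2 + 1) * w ≤ T) : t < T :=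
  ((Nat.div_lt_iff_lt_mul hw).1 (Nat.lt_succ_of_le ht.2)).trans_le hT

/-- The space-time regions of non-adjacent nodes are disjoint. -/
theorem adj_of_inRange {t : ℕ} (h1 : InRange w z t) (h2 : InRange w z' t) (hu : u ∈ Φ.vbl z.1)
    (hu' : u ∈ Φ.vbl z'.1) : Φ.Adj z z' :=
  ⟨⟨u, Finset.mem_inter.2 ⟨hu, hu'⟩⟩, by have := h1.1; have := h2.2; omega,
    by have := h1.2; have := h2.1; omega⟩

theorem lastIn_mem {r : ℕ → V} {I : Finset ℕ} (h : ∃ t ∈ I, r (t + 1) = u) :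
    lastIn r I u ∈ I ∧ r (lastIn r I u + 1) = u := by
  obtain ⟨t, ht, hr⟩ := h
  obtain ⟨t', ht', he⟩ := Finset.exists_mem_eq_sup (I.filter fun t => r (t + 1) = u)
    ⟨t, Finset.mem_filter.2 ⟨ht, hr⟩⟩ id
  rw [lastIn, he]
  exact Finset.mem_filter.1 ht'

theorem ne_of_lastIn_lt {r : ℕ → V} {I : Finset ℕ} {t : ℕ} (ht : t ∈ I) (h : lastIn r I u < t) :
    r (t + 1) ≠ u := fun hr =>
  absurd (Finset.le_sup (f := id) (Finset.mem_filter.2 ⟨ht, hr⟩ :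
    t ∈ I.filter fun t => r (t + 1) = u)) (not_le.2 h)

variable {r : ℕ → V}

/-- The decisive update takes place inside the time range of the node; this is what makes the
updates constrained by non-adjacent nodes distinct. -/
theorem decisiveTime_spec (hw : 0 < w) (ho : IsPattern Q Φ w z o)
    (hr : Distinguished o u → r (startTime w z o + 1) = u)
    (hu : Distinguished o u ∨ ∃ t ∈ period w z o u, r (t + 1) = u) :
    r (decisiveTime w r z o u + 1) = u ∧ InRange w z (decisiveTime w r z o u) := by
  unfold decisiveTime
  split_ifs with hd
  · exact ⟨hr hd, inRange_startTime hw ho⟩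
  · obtain ⟨h1, h2⟩ := lastIn_mem (hu.resolve_left hd)
    exact ⟨h2, inRange_of_mem_period hw ho h1⟩

theorem Matches.isPattern {π : ∀ v, Ω v → Q v} {ω : ℕ → (∀ v, Q v) × (∀ v, Q v)} {p : Pattern V}
    (h : Φ.Matches π w r ω z p) : IsPattern Q Φ w z p.1 := by
  obtain ⟨_ | ⟨s, v⟩, χ⟩ := p
  · exact h.1
  · exact ⟨h.1, h.2.1⟩

theorem Matches.schedule {π : ∀ v, Ω v → Q v} {ω : ℕ → (∀ v, Q v) × (∀ v, Q v)} {p : Pattern V}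
    (h : Φ.Matches π w r ω z p) (hd : Distinguished p.1 u) :
    r (startTime w z p.1 + 1) = u ∧ ∀ t ∈ period w z p.1 u, r (t + 1) ≠ u := by
  obtain ⟨o, χ⟩ := p
  obtain ⟨s, rfl⟩ := id hd
  obtain ⟨-, -, h1, -, -, h2⟩ := h
  refine ⟨h1, fun t ht => ?_⟩
  rw [period, if_pos hd, Finset.mem_Ico] at ht
  exact h2 t ht.1 ht.2

/-- The value violating the constraint at its start time is the one chosen by the last update. -/
theorem Matches.decisiveEvent [∀ v, Fintype (Q v)] {π : ∀ v, Ω v → Q v}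
    {ω : ℕ → (∀ v, Q v) × (∀ v, Q v)} {p : Pattern V} {T : ℕ}
    (h : Φ.Matches π w r ω z p) (hf : Φ.Follows π T r ω) (hT : startTime w z p.1 ≤ T)
    (hu : u ∈ Φ.vblBar Q z.1)
    (hupd : Distinguished p.1 u ∨ ∃ t ∈ period w z p.1 u, r (t + 1) = u) :
    Φ.DecisiveEvent π z p u (ω (decisiveTime w r z p.1 u + 1)) := by
  unfold DecisiveEvent decisiveTime
  obtain ⟨o, χ⟩ := p
  by_cases hd : Distinguished o u
  · simp only [hd, if_true]
    obtain ⟨s, rfl⟩ := hd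
    exact h.2.2.2.2.1
  · simp only [hd, if_false]
    have hviol : side χ (ω (startTime w z o)) u = π u (Φ.bad z.1 u) := by
      rcases o with _ | ⟨s, v⟩
      · exact h.2 u hu
      · exact h.2.2.2.1 u hu fun huv => hd ⟨s, by rw [huv]⟩
    obtain ⟨h1, h2⟩ := lastIn_mem (hupd.resolve_left hd)
    dsimp only at h1 h2
    rw [← hviol]
    have hper : ∀ t, t ∈ period w z o u ↔ startTime w z o - w ≤ t ∧ t < startTime w z o :=
      fun t => by rw [period, if_neg hd, Finset.mem_Ico]
    have h3 := (hper _).1 h1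
    change startTime w z o ≤ T at hT
    exact (hf.apply_eq (by omega) hT (fun t' h4 h5 => ne_of_lastIn_lt (I := period w z o u)
      ((hper t').2 ⟨by omega, h5⟩) (by omega)) χ).symm

end Geometry

section Joint

variable [Fintype V] [∀ v, Fintype (Ω v)] [Fintype ι] [∀ v, Fintype (Q v)]

/-- The bound for the probability of a pattern of `z`. The distinguished variable contributes the
probability of its being chosen, that of its special event, and that of its not being updated during
the following blocks. -/
def patternWeight (Φ : AtomicCSP V Ω ι) (π : ∀ v, Ω v → Q v) (w : ℕ) (z : Node ι)
    (o : Option (ℕ × V)) : ℝ :=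
  ∏ u ∈ Φ.vblBar Q z.1, if Distinguished o u then
    6 * (Fintype.card V : ℝ)⁻¹ * ((1 - (Fintype.card V : ℝ)⁻¹) ^ w) ^ z.2.2 *
      (4 * Φ.zeta π z.1 * Φ.forbidBound π z.1 u)
    else Φ.forbidBound π z.1 u + (1 - (Fintype.card V : ℝ)⁻¹) ^ w

variable {Φ : AtomicCSP V Ω ι} {π : ∀ v, Ω v → Q v} {η κ : ℝ} {w T : ℕ}

omit [∀ v, Fintype (Ω v)] [Fintype ι] in
theorem follows_of_pairKernel_ne_zero {r : ℕ → V} {ω : ℕ → (∀ v, Q v) × (∀ v, Q v)}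
    (h : ∀ s, 0 ≤ s → s < 0 + T → Φ.pairKernel π (r (s + 1)) (ω s) (ω (s + 1)) ≠ 0) :
    Φ.Follows π T r ω := fun s hs => by
  obtain ⟨a, b, h1, h2⟩ := exists_of_pairKernel_ne_zero (h s (by omega) (by omega))
  exact ⟨a, b, h1, h2⟩

variable [Nonempty ι] (h : Φ.IsAdmissible π η κ) (hη : η < 1 / 2) (hΩ : ∀ v, Nonempty (Ω v))
include h hη hΩ

/-- For a given schedule, pairwise non-adjacent nodes constrain distinct updates. -/
theorem IsAdmissible.iterE_matches_le (hw : 0 < w) {J : Type*} [Fintype J] (x : J → Node ι)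
    (p : J → Pattern V) (hx1 : ∀ j, (x j).2.1 * w + w ≤ T)
    (hxT : ∀ j, ((x j).2.1 + (x j).2.2 + 1) * w ≤ T)
    (hadj : ∀ j j', j ≠ j' → ¬ Φ.Adj (x j) (x j'))
    (hp : ∀ j, IsPattern Q Φ w (x j) (p j).1) (r : ℕ → V)
    (hr : ∀ j, ∀ u, Distinguished (p j).1 u → r (startTime w (x j) (p j).1 + 1) = u)
    (ω₀ : ℕ → (∀ v, Q v) × (∀ v, Q v)) :
    iterE (fun s => Φ.pairKernel π (r (s + 1))) T 0
      (fun ω => if ∀ j, Φ.Matches π w r ω (x j) (p j) then 1 else 0) ω₀ ≤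
    ∏ b ∈ (Finset.univ.sigma fun j => Φ.vblBar Q (x j).1) with
        Distinguished (p b.1).1 b.2 ∨ ∃ t ∈ period w (x b.1) (p b.1).1 b.2, r (t + 1) = b.2,
      if Distinguished (p b.1).1 b.2 then
        4 * Φ.zeta π (x b.1).1 * Φ.forbidBound π (x b.1).1 b.2
      else Φ.forbidBound π (x b.1).1 b.2 := by
  set D := (Finset.univ.sigma fun j => Φ.vblBar Q (x j).1).filter fun b =>
    Distinguished (p b.1).1 b.2 ∨ ∃ t ∈ period w (x b.1) (p b.1).1 b.2, r (t + 1) = b.2 with hD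
  let τ : (_ : J) × V → ℕ := fun b => decisiveTime w r (x b.1) (p b.1).1 b.2
  have hτ : ∀ b ∈ D, r (τ b + 1) = b.2 ∧ InRange w (x b.1) (τ b) := fun b hb =>
    decisiveTime_spec hw (hp b.1) (hr b.1 b.2) (Finset.mem_filter.1 hb).2
  have hmem : ∀ b ∈ D, b.2 ∈ Φ.vblBar Q (x b.1).1 := fun b hb =>
    (Finset.mem_sigma.1 (Finset.mem_filter.1 hb).1).2
  refine le_trans ?_ (iterE_events_le (W := fun s => Φ.pairKernel π (r (s + 1)))
    (fun s z z' => h.pairKernel_nonneg hη hΩ _ z z')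
    (fun s z => h.sum_pairKernel hη hΩ _ z) D τ T
    (fun b hb => lt_of_inRange hw (hτ b hb).2 (hxT b.1)) ?_
    (fun b => Φ.DecisiveEvent π (x b.1) (p b.1) b.2) _ ?_ ω₀)
  · refine iterE_le_iterE (fun s z z' => h.pairKernel_nonneg hη hΩ _ z z') T 0 ω₀ fun ω _ hω => ?_
    have hf := follows_of_pairKernel_ne_zero hω
    by_cases hm : ∀ j, Φ.Matches π w r ω (x j) (p j)
    · rw [if_pos hm, if_pos]
      intro b hb
      refine (hm b.1).decisiveEvent hf ?_ (hmem b hb) (Finset.mem_filter.1 hb).2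
      have := startTime_lt hw (hp b.1)
      have := hx1 b.1
      rw [add_mul, one_mul] at *
      omega
    · rw [if_neg hm]; split_ifs <;> norm_num
  · rintro ⟨j, u⟩ hb ⟨j', u'⟩ hb' heq
    obtain ⟨h1, h2⟩ := hτ _ hb
    obtain ⟨h3, h4⟩ := hτ _ hb'
    rw [← heq] at h3 h4
    have huu : u = u' := h1.symm.trans h3
    subst huu
    by_cases hj : j = j'
    · rw [hj]
    · exact absurd (adj_of_inRange h2 h4 (Finset.mem_filter.1 (hmem _ hb)).1
        (Finset.mem_filter.1 (hmem _ hb')).1) (hadj j j' hj)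
  · intro b hb z
    rw [(hτ b hb).1]
    unfold DecisiveEvent
    by_cases hd : Distinguished (p b.1).1 b.2
    · simp only [hd, if_true]
      exact h.sum_pairKernel_special_le hη hΩ b.2 z _ (hmem b hb)
    · simp only [hd, if_false]
      exact h.sum_pairKernel_side_le hη hΩ b.2 z _ _

/-- The bound for a given schedule is averaged over the schedules: a variable that is not updated
during its period costs the probability of this event in place of that of the forbidden value. -/
theorem IsAdmissible.pairE_matches_le (hn : 2 ≤ Fintype.card V) (hw : 0 < w)
    {J : Type*} [Fintype J] (x : J → Node ι)
    (p : J → Pattern V) (hx1 : ∀ j, 1 ≤ (x j).2.1)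
    (hxT : ∀ j, ((x j).2.1 + (x j).2.2 + 1) * w ≤ T)
    (hadj : ∀ j j', j ≠ j' → ¬ Φ.Adj (x j) (x j'))
    (hp : ∀ j, IsPattern Q Φ w (x j) (p j).1) (r₀ : V) (z₀ : (∀ v, Q v) × (∀ v, Q v)) :
    Φ.pairE π T r₀ z₀ (fun r ω => if ∀ j, Φ.Matches π w r ω (x j) (p j) then 1 else 0) ≤
      ∏ j, Φ.patternWeight π w (x j) (p j).1 := by
  set B : Finset ((_ : J) × V) := Finset.univ.sigma fun j => Φ.vblBar Q (x j).1 with hB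
  set P := B.filter fun b => Distinguished (p b.1).1 b.2 with hP
  set N := B.filter fun b => ¬ Distinguished (p b.1).1 b.2 with hN
  let f : (_ : J) × V → ℝ := fun b => Φ.forbidBound π (x b.1).1 b.2
  let g : (_ : J) × V → ℝ := fun b => 4 * Φ.zeta π (x b.1).1 * f b
  set c : ℝ := 1 - (Fintype.card V : ℝ)⁻¹ with hc
  let I : (_ : J) × V → Finset ℕ := fun b => period w (x b.1) (p b.1).1 b.2
  let s : (_ : J) × V → ℕ := fun b => startTime w (x b.1) (p b.1).1
  have hf0 : ∀ b, 0 < f b := fun b => h.forbidBound_pos hη hΩ _ _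
  have hg0 : ∀ b, 0 < g b := fun b => mul_pos
    (mul_pos (by norm_num) (lt_of_lt_of_le one_pos (one_le_zeta _))) (hf0 b)
  have hc0 : 0 ≤ c := by
    have : (1 : ℝ) ≤ Fintype.card V := by exact_mod_cast (by omega : 1 ≤ Fintype.card V)
    have := inv_le_one_of_one_le₀ this
    rw [hc]; linarith
  have hBmem : ∀ b ∈ B, b.2 ∈ Φ.vbl (x b.1).1 := fun b hb =>
    (Finset.mem_filter.1 (Finset.mem_sigma.1 hb).2).1
  let Sched : (ℕ → V) → Prop := fun r =>
    ∀ b ∈ P, r (s b + 1) = b.2 ∧ ∀ t ∈ I b, r (t + 1) ≠ b.2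
  let y : (ℕ → V) → (_ : J) × V → ℝ := fun r b => if ∀ t ∈ I b, r (t + 1) ≠ b.2 then 1 else 0
  have hy0 : ∀ r b, 0 ≤ y r b := fun r b => by simp only [y]; split_ifs <;> norm_num
  -- The bound for a fixed schedule.
  have step1 : ∀ r : ℕ → V, iterE (fun s => Φ.pairKernel π (r (s + 1))) T 0
      (fun ω => if ∀ j, Φ.Matches π w r ω (x j) (p j) then 1 else 0) (fun _ => z₀) ≤
      (if Sched r then 1 else 0) * ((∏ b ∈ P, g b) * ∏ b ∈ N, (y r b + f b)) := by
    intro r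
    by_cases hS : Sched r
    · rw [if_pos hS, one_mul]
      refine (h.iterE_matches_le hη hΩ hw x p (fun j => le_trans ?_ (hxT j)) hxT hadj hp r
        (fun j u hd => ?_) _).trans ?_
      · rw [← Nat.succ_mul]
        exact Nat.mul_le_mul_right w (by omega)
      · obtain ⟨s', hs'⟩ := id hd
        have h1 := hp j
        rw [hs'] at h1
        exact (hS ⟨j, u⟩ (Finset.mem_filter.2 ⟨Finset.mem_sigma.2 ⟨Finset.mem_univ _, h1.2⟩, hd⟩)).1
      · rw [Finset.prod_filter, ← Finset.prod_filter_mul_prod_filter_not B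
          (fun b => Distinguished (p b.1).1 b.2)]
        refine mul_le_mul (Finset.prod_le_prod (fun b _ => ?_) fun b hb => ?_)
          (Finset.prod_le_prod (fun b _ => ?_) fun b hb => ?_)
          (Finset.prod_nonneg fun b _ => ?_) (Finset.prod_nonneg fun b _ => (hg0 b).le)
        · have := hf0 b
          have := hg0 b
          split_ifs <;> [exact this.le; exact (hf0 b).le; norm_num]
        · have hd := (Finset.mem_filter.1 hb).2
          simp only [hd, true_or, if_true]
          exact le_rfl
        · have := hf0 b
          have := hg0 b
          split_ifs <;> [exact this.le; exact (hf0 b).le; norm_num]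
        · have hd := (Finset.mem_filter.1 hb).2
          simp only [hd, false_or, if_false, y]
          have := hf0 b
          by_cases hu : ∃ t ∈ period w (x b.1) (p b.1).1 b.2, r (t + 1) = b.2
          · rw [if_pos hu]
            split_ifs
            · change f b ≤ _; linarith
            · change f b ≤ _; linarith
          · rw [if_neg hu, if_pos (by push Not at hu; exact hu)]
            linarith
        · have := hf0 b
          have := hg0 b
          split_ifs <;> [exact this.le; exact (hf0 b).le; norm_num]
    · rw [if_neg hS, zero_mul]
      calc _ ≤ iterE (fun s => Φ.pairKernel π (r (s + 1))) T 0 (fun _ => 0 * 0) fun _ => z₀ := by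
            refine iterE_le_iterE (fun s z z' => h.pairKernel_nonneg hη hΩ _ z z') _ _ _
              fun ω _ _ => ?_
            rw [if_neg]
            · simp
            · intro hm
              exact hS fun b hb => (hm b.1).schedule (Finset.mem_filter.1 hb).2
        _ = 0 := by rw [iterE_const_mul, zero_mul]
  -- Expanding over the set `S` of variables that are not updated during their periods.
  have step2 : ∀ r : ℕ → V, (if Sched r then (1 : ℝ) else 0) *
      ((∏ b ∈ P, g b) * ∏ b ∈ N, (y r b + f b)) =
      ∑ S ∈ N.powerset, ((∏ b ∈ P, g b) * ∏ b ∈ N \ S, f b) *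
        ((if Sched r then 1 else 0) * ∏ b ∈ S, y r b) := by
    intro r
    rw [Finset.prod_add, Finset.mul_sum, Finset.mul_sum]
    exact Finset.sum_congr rfl fun S _ => by ring
  have hcard : ∀ b, (I b).card = if Distinguished (p b.1).1 b.2 then (x b.1).2.2 * w else w :=
    fun b => card_period hw (hp b.1) (hx1 b.1)
  have step3 : ∀ S ∈ N.powerset, iterE (scheduleKernel V) T 0
      (fun r => (if Sched r then 1 else 0) * ∏ b ∈ S, y r b) (fun _ => r₀) ≤
      (∏ b ∈ P, (6 * (Fintype.card V : ℝ)⁻¹ * (c ^ w) ^ (x b.1).2.2)) * ∏ _b ∈ S, c ^ w := by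
    intro S hS
    rw [Finset.mem_powerset] at hS
    have hSB : ∀ b ∈ P ∪ S, b ∈ B := fun b hb => by
      rcases Finset.mem_union.1 hb with hb | hb
      · exact (Finset.mem_filter.1 hb).1
      · exact (Finset.mem_filter.1 (hS hb)).1
    -- The periods belonging to the same variable in different nodes are disjoint.
    have hsame : ∀ b ∈ B, ∀ b' ∈ B, b.2 = b'.2 → ∀ t, InRange w (x b.1) t →
        InRange w (x b'.1) t → b = b' := by
      rintro ⟨j, u⟩ hb ⟨j', u'⟩ hb' huu t h1 h2
      simp only at huu
      subst huu
      by_cases hj : j = j'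
      · rw [hj]
      · exact absurd (adj_of_inRange h1 h2 (hBmem _ hb) (hBmem _ hb')) (hadj j j' hj)
    have hdisj : Disjoint P S := Finset.disjoint_of_subset_right hS
      (Finset.disjoint_filter_filter_not _ _ _)
    refine le_trans (iterE_le_iterE scheduleKernel_nonneg _ _ _ fun r _ _ => ?_)
      ((iterE_schedule_le hn P (P ∪ S) (fun b => b.2) s I T (fun b hb => ?_) (fun b hb t ht => ?_)
        (fun b hb b' hb' hss huu => ?_) (fun b hb b' hb' huu t ht ht' => ?_) _).trans (le_of_eq ?_))
    · simp only [y]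
      rw [prod_ite_one_zero]
      by_cases h1 : Sched r
      · by_cases h2 : ∀ b ∈ S, ∀ t ∈ I b, r (t + 1) ≠ b.2
        · have h3 : ∀ b ∈ P ∪ S, ∀ t ∈ I b, r (t + 1) ≠ b.2 := fun b hb => by
            rcases Finset.mem_union.1 hb with hb | hb
            · exact (h1 b hb).2
            · exact h2 b hb
          rw [if_pos h1, if_pos h2, if_pos ⟨fun b hb => (h1 b hb).1, h3⟩, one_mul]
        · rw [if_neg h2, mul_zero]; split_ifs <;> norm_num
      · rw [if_neg h1, zero_mul]; split_ifs <;> norm_num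
    · exact lt_of_inRange hw (inRange_startTime hw (hp b.1)) (hxT b.1)
    · exact lt_of_inRange hw (inRange_of_mem_period hw (hp b.1) ht) (hxT b.1)
    · refine hsame b (Finset.mem_filter.1 hb).1 b' (Finset.mem_filter.1 hb').1 huu (s b)
        (inRange_startTime hw (hp b.1)) ?_
      rw [hss]
      exact inRange_startTime hw (hp b'.1)
    · exact hsame b (hSB b hb) b' (hSB b' hb') huu t (inRange_of_mem_period hw (hp b.1) ht)
        (inRange_of_mem_period hw (hp b'.1) ht')
    · rw [Finset.prod_union hdisj, ← mul_assoc, ← Finset.prod_mul_distrib]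
      congr 1
      · refine Finset.prod_congr rfl fun b hb => ?_
        rw [hcard, if_pos (Finset.mem_filter.1 hb).2, mul_comm _ w, pow_mul]
      · refine Finset.prod_congr rfl fun b hb => ?_
        rw [hcard, if_neg (Finset.mem_filter.1 (hS hb)).2]
  unfold pairE
  refine (iterE_le_iterE scheduleKernel_nonneg _ _ _ fun r _ _ =>
    (step1 r).trans (step2 r).le).trans ?_
  rw [iterE_sum]
  simp_rw [iterE_const_mul]
  calc _ ≤ ∑ S ∈ N.powerset, ((∏ b ∈ P, g b) * ∏ b ∈ N \ S, f b) *
        ((∏ b ∈ P, (6 * (Fintype.card V : ℝ)⁻¹ * (c ^ w) ^ (x b.1).2.2)) * ∏ _b ∈ S, c ^ w) := by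
        refine Finset.sum_le_sum fun S hS => mul_le_mul_of_nonneg_left (step3 S hS) ?_
        exact mul_nonneg (Finset.prod_nonneg fun b _ => (hg0 b).le)
          (Finset.prod_nonneg fun b _ => (hf0 b).le)
    _ = (∏ b ∈ P, (6 * (Fintype.card V : ℝ)⁻¹ * (c ^ w) ^ (x b.1).2.2 * g b)) *
        ∏ b ∈ N, (f b + c ^ w) := by
        simp_rw [add_comm (f _)]
        have hprod : ∏ b ∈ P, (6 * (Fintype.card V : ℝ)⁻¹ * (c ^ w) ^ (x b.1).2.2 * g b) =
            (∏ b ∈ P, (6 * (Fintype.card V : ℝ)⁻¹ * (c ^ w) ^ (x b.1).2.2)) * ∏ b ∈ P, g b :=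
          Finset.prod_mul_distrib
        rw [Finset.prod_add, Finset.mul_sum, hprod]
        exact Finset.sum_congr rfl fun S _ => by ring
    _ = ∏ b ∈ B, (if Distinguished (p b.1).1 b.2 then
          6 * (Fintype.card V : ℝ)⁻¹ * (c ^ w) ^ (x b.1).2.2 * g b else f b + c ^ w) := by
        rw [← Finset.prod_filter_mul_prod_filter_not B (fun b => Distinguished (p b.1).1 b.2)]
        congr 1
        · exact Finset.prod_congr rfl fun b hb => by rw [if_pos (Finset.mem_filter.1 hb).2]
        · exact Finset.prod_congr rfl fun b hb => by rw [if_neg (Finset.mem_filter.1 hb).2]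
    _ = _ := by
        rw [hB, Finset.prod_sigma]
        rfl

end Joint

section PairE

variable [Fintype V] [∀ v, Fintype (Ω v)] [Fintype ι] [∀ v, Fintype (Q v)]
variable {Φ : AtomicCSP V Ω ι} {π : ∀ v, Ω v → Q v} {η κ : ℝ} {w T : ℕ}

omit [∀ v, Fintype (Ω v)] [Fintype ι] in
theorem pairE_sum {β : Type*} (B : Finset β)
    (F : β → (ℕ → V) → (ℕ → (∀ v, Q v) × (∀ v, Q v)) → ℝ) (r₀ : V)
    (z₀ : (∀ v, Q v) × (∀ v, Q v)) :
    Φ.pairE π T r₀ z₀ (fun r ω => ∑ b ∈ B, F b r ω) = ∑ b ∈ B, Φ.pairE π T r₀ z₀ (F b) := by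
  unfold pairE
  simp_rw [iterE_sum]

omit [∀ v, Fintype (Ω v)] [Fintype ι] in
theorem pairE_add (F G : (ℕ → V) → (ℕ → (∀ v, Q v) × (∀ v, Q v)) → ℝ) (r₀ : V)
    (z₀ : (∀ v, Q v) × (∀ v, Q v)) :
    Φ.pairE π T r₀ z₀ (fun r ω => F r ω + G r ω) =
      Φ.pairE π T r₀ z₀ F + Φ.pairE π T r₀ z₀ G := by
  unfold pairE
  simp_rw [iterE_add]

variable [Nonempty ι] (h : Φ.IsAdmissible π η κ) (hη : η < 1 / 2) (hΩ : ∀ v, Nonempty (Ω v))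
include h hη hΩ

theorem IsAdmissible.pairE_mono {F G : (ℕ → V) → (ℕ → (∀ v, Q v) × (∀ v, Q v)) → ℝ} (r₀ : V)
    (z₀ : (∀ v, Q v) × (∀ v, Q v)) (hFG : ∀ r ω, Φ.Follows π T r ω → F r ω ≤ G r ω) :
    Φ.pairE π T r₀ z₀ F ≤ Φ.pairE π T r₀ z₀ G :=
  iterE_le_iterE scheduleKernel_nonneg _ _ _ fun r _ _ =>
    iterE_le_iterE (fun _ _ _ => h.pairKernel_nonneg hη hΩ _ _ _) _ _ _ fun ω _ hω =>
      hFG r ω (follows_of_pairKernel_ne_zero hω)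

theorem IsAdmissible.pairE_schedule (F : (ℕ → V) → ℝ) (r₀ : V) (z₀ : (∀ v, Q v) × (∀ v, Q v)) :
    Φ.pairE π T r₀ z₀ (fun r _ => F r) = iterE (scheduleKernel V) T 0 F fun _ => r₀ := by
  unfold pairE
  refine iterE_congr _ _ _ fun r _ => ?_
  exact iterE_const (fun _ _ => h.sum_pairKernel hη hΩ _ _) _ _ _ _

end PairE

section NodeWeight

variable [Fintype V]

/-- All the patterns of a node. -/
def patterns (Q : V → Type u₄) (Φ : AtomicCSP V Ω ι) (w : ℕ) (z : Node ι) :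
    Finset (Option (ℕ × V)) :=
  (Finset.Ico (z.2.1 * w) ((z.2.1 + 1) * w) ×ˢ Φ.vblBar Q z.1).map Function.Embedding.some ∪
    if z.2.2 = 0 then {none} else ∅

omit [Fintype V] in
theorem mem_patterns {Φ : AtomicCSP V Ω ι} {w : ℕ} (hw : 0 < w) {z : Node ι}
    {o : Option (ℕ × V)} : o ∈ patterns Q Φ w z ↔ IsPattern Q Φ w z o := by
  unfold patterns
  rcases o with _ | ⟨s, u⟩
  · by_cases hz : z.2.2 = 0 <;> simp [IsPattern, hz]
  · have : s / w = z.2.1 ↔ z.2.1 * w ≤ s ∧ s < (z.2.1 + 1) * w := by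
      rw [← Nat.le_div_iff_mul_le hw, ← Nat.div_lt_iff_lt_mul hw]; omega
    by_cases hz : z.2.2 = 0 <;> simp [IsPattern, hz, this]

variable [∀ v, Fintype (Ω v)] [Fintype ι] [∀ v, Fintype (Q v)]

/-- The bound for the probability that the node `z` occurs; the factor `2` accounts for the choice
of one of the two configurations. -/
def nodeWeight (Φ : AtomicCSP V Ω ι) (π : ∀ v, Ω v → Q v) (w : ℕ) (z : Node ι) : ℝ :=
  2 * ∑ o ∈ patterns Q Φ w z, Φ.patternWeight π w z o

variable {Φ : AtomicCSP V Ω ι} {π : ∀ v, Ω v → Q v} {η κ : ℝ} {w T : ℕ}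

variable [Nonempty ι] (h : Φ.IsAdmissible π η κ) (hη : η < 1 / 2) (hΩ : ∀ v, Nonempty (Ω v))
include h hη hΩ

/-- Pairwise non-adjacent nodes occur jointly with at most the product of their weights as
probability. -/
theorem IsAdmissible.pairE_occurs_le (hn : 2 ≤ Fintype.card V) (hw : 0 < w)
    {J : Type*} [Fintype J] (x : J → Node ι) (hx1 : ∀ j, 1 ≤ (x j).2.1)
    (hxT : ∀ j, ((x j).2.1 + (x j).2.2 + 1) * w ≤ T)
    (hadj : ∀ j j', j ≠ j' → ¬ Φ.Adj (x j) (x j')) (r₀ : V) (z₀ : (∀ v, Q v) × (∀ v, Q v)) :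
    Φ.pairE π T r₀ z₀ (fun r ω => if ∀ j, Φ.Occurs π w r ω (x j) then 1 else 0) ≤
      ∏ j, Φ.nodeWeight π w (x j) := by
  let pats : J → Finset (Pattern V) := fun j => patterns Q Φ w (x j) ×ˢ Finset.univ
  have hsum : ∀ j, Φ.nodeWeight π w (x j) = ∑ p ∈ pats j, Φ.patternWeight π w (x j) p.1 := by
    intro j
    rw [nodeWeight, Finset.sum_product, Finset.mul_sum]
    exact Finset.sum_congr rfl fun o _ => by simp
  simp_rw [hsum]
  rw [Finset.prod_univ_sum]
  refine (h.pairE_mono hη hΩ r₀ z₀ (G := fun r ω => ∑ p ∈ Fintype.piFinset pats,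
    if ∀ j, Φ.Matches π w r ω (x j) (p j) then 1 else 0) fun r ω _ => ?_).trans ?_
  · have hnn : ∀ p ∈ Fintype.piFinset pats,
        (0 : ℝ) ≤ if ∀ j, Φ.Matches π w r ω (x j) (p j) then 1 else 0 := fun p _ => by
      split_ifs <;> norm_num
    by_cases ho : ∀ j, Φ.Occurs π w r ω (x j)
    · rw [if_pos ho]
      choose p hp using ho
      refine le_trans ?_ (Finset.single_le_sum hnn (a := p) (Fintype.mem_piFinset.2 fun j =>
        Finset.mem_product.2 ⟨(mem_patterns hw).2 (hp j).isPattern, Finset.mem_univ _⟩))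
      rw [if_pos hp]
    · rw [if_neg ho]
      exact Finset.sum_nonneg hnn
  · rw [pairE_sum]
    refine Finset.sum_le_sum fun p hp => ?_
    exact h.pairE_matches_le hη hΩ hn hw x p hx1 hxT hadj (fun j => (mem_patterns hw).1
      (Finset.mem_product.1 (Fintype.mem_piFinset.1 hp j)).1) r₀ z₀

/-- The terms of the bound come from the patterns with a distinguished update, of which there are
`w` times the number of variables, and from the pattern without one. -/
theorem IsAdmissible.nodeWeight_le (hn : 2 ≤ Fintype.card V) (z : Node ι) :
    Φ.nodeWeight π w z ≤ (48 * (w * (Fintype.card V : ℝ)⁻¹) * (Φ.vblBar Q z.1).card *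
      Φ.zeta π z.1 + 2) * (∏ u ∈ Φ.vblBar Q z.1,
        (Φ.forbidBound π z.1 u + (1 - (Fintype.card V : ℝ)⁻¹) ^ w)) *
      ((1 - (Fintype.card V : ℝ)⁻¹) ^ w) ^ z.2.2 := by
  set c : ℝ := (1 - (Fintype.card V : ℝ)⁻¹) ^ w with hc
  have hc0 : 0 ≤ c := by
    have : (1 : ℝ) ≤ Fintype.card V := by exact_mod_cast (by omega : 1 ≤ Fintype.card V)
    have := inv_le_one_of_one_le₀ this
    exact pow_nonneg (by linarith) _
  set A := ∏ u ∈ Φ.vblBar Q z.1, (Φ.forbidBound π z.1 u + c) with hA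
  have hf0 : ∀ u, 0 < Φ.forbidBound π z.1 u := fun u => h.forbidBound_pos hη hΩ _ _
  have hA0 : 0 ≤ A := Finset.prod_nonneg fun u _ => by have := hf0 u; positivity
  have hζ := one_le_zeta (Φ := Φ) (π := π) z.1
  have hsome : ∀ s, ∀ u ∈ Φ.vblBar Q z.1, Φ.patternWeight π w z (some (s, u)) ≤
      24 * (Fintype.card V : ℝ)⁻¹ * Φ.zeta π z.1 * A * c ^ z.2.2 := by
    intro s u hu
    have hd : ∀ u', Distinguished (some (s, u)) u' ↔ u' = u := fun u' => by
      simp [Distinguished, eq_comm]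
    unfold patternWeight
    rw [hA, ← Finset.mul_prod_erase _ _ hu, ← Finset.mul_prod_erase _ _ hu, if_pos ((hd u).2 rfl)]
    have : ∀ u' ∈ (Φ.vblBar Q z.1).erase u, (if Distinguished (some (s, u)) u' then
        6 * (Fintype.card V : ℝ)⁻¹ * ((1 - (Fintype.card V : ℝ)⁻¹) ^ w) ^ z.2.2 *
          (4 * Φ.zeta π z.1 * Φ.forbidBound π z.1 u')
        else Φ.forbidBound π z.1 u' + (1 - (Fintype.card V : ℝ)⁻¹) ^ w) =
        Φ.forbidBound π z.1 u' + c := fun u' hu' => by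
      rw [if_neg (by rw [hd]; exact (Finset.mem_erase.1 hu').1)]
    rw [Finset.prod_congr rfl this]
    set B := ∏ u' ∈ (Φ.vblBar Q z.1).erase u, (Φ.forbidBound π z.1 u' + c)
    have hB : 0 ≤ B := Finset.prod_nonneg fun u _ => by have := hf0 u; positivity
    rw [← hc]
    calc _ = 24 * (Fintype.card V : ℝ)⁻¹ * Φ.zeta π z.1 * (Φ.forbidBound π z.1 u * B) *
          c ^ z.2.2 := by ring
      _ ≤ _ := by
        gcongr
        linarith
  have hnone : Φ.patternWeight π w z none = A := by
    unfold patternWeight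
    exact Finset.prod_congr rfl fun u _ => if_neg (by simp [Distinguished])
  have hsplit : ∑ o ∈ patterns Q Φ w z, Φ.patternWeight π w z o ≤
      w * (Φ.vblBar Q z.1).card * (24 * (Fintype.card V : ℝ)⁻¹ * Φ.zeta π z.1 * A * c ^ z.2.2) +
      A * c ^ z.2.2 := by
    unfold patterns
    rw [Finset.sum_union]
    · refine add_le_add ?_ ?_
      · rw [Finset.sum_map]
        refine (Finset.sum_le_card_nsmul _ _ _ fun x hx =>
          hsome x.1 x.2 (Finset.mem_product.1 hx).2).trans (le_of_eq ?_)
        rw [Finset.card_product, Nat.card_Ico, ← Nat.sub_mul, nsmul_eq_mul]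
        simp
      · split_ifs with hz
        · simp [hz, hnone]
        · simp; positivity
    · rw [Finset.disjoint_right]
      intro o ho
      split_ifs at ho
      · rw [Finset.mem_singleton.1 ho]; simp
      · simp at ho
  unfold nodeWeight
  calc _ ≤ 2 * _ := mul_le_mul_of_nonneg_left hsplit zero_le_two
    _ = _ := by ring

omit hη hΩ [Fintype V] [∀ v, Fintype (Ω v)] in
theorem IsAdmissible.kappa_bounds : 28 ≤ κ ∧ Real.exp (-κ) ≤ ((3000 * (Φ.degree : ℝ)) ^ 4)⁻¹ := by
  have hD := h.one_le_degree
  have h1 := h.le_kappa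
  have h2 : (7 : ℝ) ≤ Real.log (3000 * Φ.degree) := by
    rw [Real.le_log_iff_exp_le (by positivity)]
    have h3 : Real.exp 7 = Real.exp 1 ^ 7 := by rw [← Real.exp_nat_mul]; norm_num
    have h4 := Real.exp_one_lt_three
    rw [h3]
    calc Real.exp 1 ^ 7 ≤ 3 ^ 7 := by gcongr
      _ ≤ 3000 * 1 := by norm_num
      _ ≤ _ := by gcongr
  refine ⟨by linarith, ?_⟩
  rw [← Real.exp_log (show (0 : ℝ) < 3000 * Φ.degree by positivity), ← Real.exp_nat_mul,
    ← Real.exp_neg, Real.exp_le_exp]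
  push_cast
  linarith

omit h hη hΩ [Nonempty ι] [∀ v, Fintype (Ω v)] [Fintype ι] [∀ v, Fintype (Q v)] in
theorem one_sub_inv_pow_le (hn : 2 ≤ Fintype.card V) (hw : κ * Fintype.card V ≤ w) :
    (1 - (Fintype.card V : ℝ)⁻¹) ^ w ≤ Real.exp (-κ) := by
  have hn2 : (2 : ℝ) ≤ Fintype.card V := by exact_mod_cast hn
  have hinv : (Fintype.card V : ℝ)⁻¹ ≤ 1 := inv_le_one_of_one_le₀ (by linarith)
  calc (1 - (Fintype.card V : ℝ)⁻¹) ^ w ≤ Real.exp (-(Fintype.card V : ℝ)⁻¹) ^ w := by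
        refine pow_le_pow_left₀ (by linarith) ?_ w
        have := Real.add_one_le_exp (-(Fintype.card V : ℝ)⁻¹)
        linarith
    _ = Real.exp (-(w * (Fintype.card V : ℝ)⁻¹)) := by rw [← Real.exp_nat_mul]; ring_nf
    _ ≤ Real.exp (-κ) := by
        rw [Real.exp_le_exp, neg_le_neg_iff, ← div_eq_mul_inv, le_div_iff₀ (by linarith)]
        exact hw

/-- The admissibility condition makes the weight of a node small, in terms of the number of blocks
it covers. -/
theorem IsAdmissible.nodeWeight_le_pow (hn : 2 ≤ Fintype.card V)
    (hw : κ * Fintype.card V ≤ w) (hw' : (w : ℝ) ≤ κ * Fintype.card V + 1) (z : Node ι) :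
    Φ.nodeWeight π w z ≤ (((30000 * (Φ.degree : ℝ))⁻¹) ^ (z.2.2 + 1)) ^ 2 := by
  have hD := h.one_le_degree
  obtain ⟨hκ, hκexp⟩ := h.kappa_bounds
  have hn2 : (2 : ℝ) ≤ Fintype.card V := by exact_mod_cast hn
  have hc := one_sub_inv_pow_le (V := V) hn hw
  set c : ℝ := (1 - (Fintype.card V : ℝ)⁻¹) ^ w with hc_def
  have hc0 : 0 ≤ c := by
    have := inv_le_one_of_one_le₀ (by linarith : (1 : ℝ) ≤ Fintype.card V)
    exact pow_nonneg (by linarith) _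
  set N : ℝ := ((Φ.vblBar Q z.1).card : ℝ) with hN
  have hN1 : 1 ≤ N := by
    rw [hN]; exact_mod_cast (h.vblBar_nonempty z.1).card_pos
  have hζ := one_le_zeta (Φ := Φ) (π := π) z.1
  have hf0 : ∀ u, 0 < Φ.forbidBound π z.1 u := fun u => h.forbidBound_pos hη hΩ _ _
  set A := ∏ u ∈ Φ.vblBar Q z.1, (Φ.forbidBound π z.1 u + c) with hA
  have hA0 : 0 ≤ A := Finset.prod_nonneg fun u _ => by have := hf0 u; positivity
  -- The product in the admissibility condition dominates `A`.
  have hprod : N ^ 2 * κ ^ 2 * Φ.zeta π z.1 * A ≤ ((60000 * (Φ.degree : ℝ)) ^ 2)⁻¹ := by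
    refine le_trans ?_ (h.prod_le z.1)
    refine mul_le_mul_of_nonneg_left (Finset.prod_le_prod (fun u _ => ?_) fun u _ => ?_)
      (by positivity)
    · have := hf0 u; positivity
    · refine add_le_add le_rfl (hc.trans ?_)
      rw [Real.exp_le_exp]; linarith
  have h1 := h.nodeWeight_le hη hΩ (w := w) hn z
  rw [← hc_def, ← hN, ← hA] at h1
  have hwn : w * (Fintype.card V : ℝ)⁻¹ ≤ κ + 1 / 2 := by
    rw [← div_eq_mul_inv, div_le_iff₀ (by linarith)]
    nlinarith
  have h2 : (48 * (w * (Fintype.card V : ℝ)⁻¹) * N * Φ.zeta π z.1 + 2) * A ≤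
      ((30000 * (Φ.degree : ℝ)) ^ 2)⁻¹ := by
    have hNζ : 1 ≤ N * Φ.zeta π z.1 := by nlinarith
    have e1 : 48 * (w * (Fintype.card V : ℝ)⁻¹) * N * Φ.zeta π z.1 + 2 ≤
        49 * κ * (N * Φ.zeta π z.1) := by nlinarith
    have e2 : 28 * (κ * (N * Φ.zeta π z.1) * A) ≤ N ^ 2 * κ ^ 2 * Φ.zeta π z.1 * A := by
      have : 28 ≤ N * κ := by nlinarith
      calc _ ≤ (N * κ) * (κ * (N * Φ.zeta π z.1) * A) := by gcongr
        _ = _ := by ring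
    have e3 : ((60000 * (Φ.degree : ℝ)) ^ 2)⁻¹ = ((30000 * (Φ.degree : ℝ)) ^ 2)⁻¹ / 4 := by
      rw [show (60000 * (Φ.degree : ℝ)) ^ 2 = (30000 * (Φ.degree : ℝ)) ^ 2 * 4 by ring, mul_inv,
        div_eq_mul_inv]
    have e4 : (48 * (w * (Fintype.card V : ℝ)⁻¹) * N * Φ.zeta π z.1 + 2) * A ≤
        49 * κ * (N * Φ.zeta π z.1) * A := mul_le_mul_of_nonneg_right e1 hA0
    have e5 : 0 ≤ ((30000 * (Φ.degree : ℝ)) ^ 2)⁻¹ := by positivity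
    linarith
  have h3 : c ≤ ((30000 * (Φ.degree : ℝ)) ^ 2)⁻¹ := by
    refine (hc.trans hκexp).trans (inv_anti₀ (by positivity) ?_)
    have : (1 : ℝ) ≤ (Φ.degree : ℝ) ^ 2 := one_le_pow₀ hD
    nlinarith [this, sq_nonneg (Φ.degree : ℝ)]
  calc Φ.nodeWeight π w z ≤ _ := h1
    _ ≤ ((30000 * (Φ.degree : ℝ)) ^ 2)⁻¹ * (((30000 * (Φ.degree : ℝ)) ^ 2)⁻¹) ^ z.2.2 := by
        gcongr
    _ = _ := by rw [← pow_succ', ← inv_pow, ← pow_mul, ← pow_mul, mul_comm 2]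

end NodeWeight

end AtomicCSP

/-! ### Summation over paths -/

/-- The total weight of the paths of `k + 1` vertices decays geometrically if the transition weights
contract a potential `G ≥ 1`. -/
theorem sum_path_le {α : Type*} [Fintype α] {F G : α → ℝ} {M : α → α → ℝ} (hF : ∀ a, 0 ≤ F a)
    (hM : ∀ a b, 0 ≤ M a b) (hG : ∀ a, 1 ≤ G a) {q : ℝ}
    (h : ∀ a, ∑ b, M a b * G b ≤ q * G a) (k : ℕ) :
    ∑ y : Fin (k + 1) → α, F (y 0) * ∏ i : Fin k, M (y i.castSucc) (y i.succ) ≤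
      q ^ k * ∑ a, F a * G a := by
  have hP : ∀ k, ∀ y : Fin (k + 1) → α,
      0 ≤ F (y 0) * ∏ i : Fin k, M (y i.castSucc) (y i.succ) := fun k y =>
    mul_nonneg (hF _) (Finset.prod_nonneg fun i _ => hM _ _)
  have key : ∀ k, ∑ y : Fin (k + 1) → α, F (y 0) *
      (∏ i : Fin k, M (y i.castSucc) (y i.succ)) * G (y (Fin.last k)) ≤
      q ^ k * ∑ a, F a * G a := by
    intro k
    induction k with
    | zero =>
      rw [← (Equiv.funUnique (Fin 1) α).symm.sum_comp]
      simp
    | succ k ih =>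
      rw [← (Fin.snocEquiv fun _ : Fin (k + 2) => α).sum_comp, Fintype.sum_prod_type_right]
      have hq : 0 ≤ q ∨ IsEmpty α := by
        rcases isEmpty_or_nonempty α with hα | ⟨⟨a⟩⟩
        · exact Or.inr hα
        · left
          by_contra hq
          have h1 := h a
          have h2 : 0 ≤ ∑ b, M a b * G b := Finset.sum_nonneg fun b _ =>
            mul_nonneg (hM _ _) (zero_le_one.trans (hG b))
          nlinarith [hG a]
      rcases hq with hq | hα
      swap
      · simp
      calc _ ≤ ∑ y : Fin (k + 1) → α, q * (F (y 0) *
            (∏ i : Fin k, M (y i.castSucc) (y i.succ)) * G (y (Fin.last k))) := by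
            refine Finset.sum_le_sum fun y _ => ?_
            have e : ∀ z, F ((Fin.snoc y z : Fin (k + 2) → α) 0) *
                (∏ i : Fin (k + 1), M ((Fin.snoc y z : Fin (k + 2) → α) i.castSucc)
                  ((Fin.snoc y z : Fin (k + 2) → α) i.succ)) *
                G ((Fin.snoc y z : Fin (k + 2) → α) (Fin.last (k + 1))) =
                (F (y 0) * ∏ i : Fin k, M (y i.castSucc) (y i.succ)) *
                  (M (y (Fin.last k)) z * G z) := fun z => by
              rw [Fin.prod_univ_castSucc]
              simp only [Fin.snoc_castSucc, Fin.snoc_last, Fin.succ_last]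
              have h0 : (Fin.snoc y z : Fin (k + 2) → α) 0 = y 0 := by
                rw [← Fin.castSucc_zero, Fin.snoc_castSucc]
              have h1 : ∀ i : Fin k, (Fin.snoc y z : Fin (k + 2) → α) i.castSucc.succ = y i.succ :=
                fun i => by rw [Fin.succ_castSucc, Fin.snoc_castSucc]
              simp only [h0, h1]
              ring
            calc _ = ∑ z, (F (y 0) * ∏ i : Fin k, M (y i.castSucc) (y i.succ)) *
                  (M (y (Fin.last k)) z * G z) := Finset.sum_congr rfl fun z _ => e z
              _ ≤ (F (y 0) * ∏ i : Fin k, M (y i.castSucc) (y i.succ)) *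
                  (q * G (y (Fin.last k))) := by
                  rw [← Finset.mul_sum]
                  exact mul_le_mul_of_nonneg_left (h _) (hP k y)
              _ = _ := by ring
        _ ≤ q * (q ^ k * ∑ a, F a * G a) := by
            rw [← Finset.mul_sum]
            exact mul_le_mul_of_nonneg_left ih hq
        _ = _ := by ring
  refine le_trans (Finset.sum_le_sum fun y _ => ?_) (key k)
  exact le_mul_of_one_le_right (hP k y) (hG _)

theorem sum_pow_fin_le (N : ℕ) {q : ℝ} (hq0 : 0 ≤ q) (hq : q ≤ 1 / 2) :
    ∑ m : Fin N, q ^ (m : ℕ) ≤ 2 := by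
  rw [Fin.sum_univ_eq_sum_range (fun m => q ^ m)]
  exact (Finset.sum_le_sum fun m _ => pow_le_pow_left₀ hq0 hq m).trans (sum_geometric_two_le N)

namespace AtomicCSP

variable {V : Type u₁} {Ω : V → Type u₂} {ι : Type u₃} {Q : V → Type u₄}

section Paths

variable [Fintype ι] {Φ : AtomicCSP V Ω ι}

/-- Nodes within the first `N` blocks. -/
abbrev BoundedNode (ι : Type*) (N : ℕ) := ι × Fin N × Fin N

/-- The node underlying a bounded node. -/
def BoundedNode.toNode {N : ℕ} (a : BoundedNode ι N) : Node ι := (a.1, a.2.1, a.2.2)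

/-- The number of positions of a time range of given length that meets a given one. -/
theorem card_blocks_le (N j m m' : ℕ) :
    ((Finset.univ.filter fun j' : Fin N => j ≤ j' + m' + 1 ∧ (j' : ℕ) ≤ j + m + 1).card : ℝ) ≤
      3 * 2 ^ m * 2 ^ m' := by
  have h1 : (Finset.univ.filter fun j' : Fin N => j ≤ j' + m' + 1 ∧ (j' : ℕ) ≤ j + m + 1).card ≤
      (Finset.Icc (j - m' - 1) (j + m + 1)).card := by
    refine Finset.card_le_card_of_injOn (fun j' => (j' : ℕ)) (fun j' hj' => ?_)
      (fun a _ b _ hab => Fin.ext hab)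
    have := (Finset.mem_filter.1 hj').2
    exact Finset.mem_coe.2 (Finset.mem_Icc.2 ⟨by dsimp only; omega, this.2⟩)
  rw [Nat.card_Icc] at h1
  have h2 : m + 1 ≤ 2 ^ m := Nat.lt_two_pow_self
  have h3 : m' + 1 ≤ 2 ^ m' := Nat.lt_two_pow_self
  have h4 : (m + 1) * (m' + 1) ≤ 2 ^ m * 2 ^ m' := Nat.mul_le_mul h2 h3
  have h5 : m + m' + 3 ≤ 3 * 2 ^ m * 2 ^ m' := by nlinarith
  have h6 : (Finset.univ.filter fun j' : Fin N => j ≤ j' + m' + 1 ∧ (j' : ℕ) ≤ j + m + 1).card ≤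
      3 * 2 ^ m * 2 ^ m' := by omega
  exact_mod_cast h6

/-- The potential `2 ^ m` is contracted by the adjacency of nodes. -/
theorem sum_adj_le (hD : (1 : ℝ) ≤ Φ.degree) (N : ℕ) (a : BoundedNode ι N) :
    ∑ b : BoundedNode ι N, (if Φ.Adj a.toNode b.toNode then
        ((300 * (Φ.degree : ℝ))⁻¹) ^ ((b.2.2 : ℕ) + 1) else 0) * 2 ^ (b.2.2 : ℕ) ≤
      1 / 2 * 2 ^ (a.2.2 : ℕ) := by
  set φ : ℝ := (300 * (Φ.degree : ℝ))⁻¹ with hφ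
  have hφ0 : 0 ≤ φ := by positivity
  have hφD : φ * Φ.degree = 1 / 300 := by rw [hφ]; field_simp
  have hφ1 : φ ≤ 1 / 300 := by nlinarith
  have hin : ∀ i : ι, ∑ m : Fin N, ∑ j : Fin N, (if Φ.Adj a.toNode (i, (j : ℕ), (m : ℕ)) then
      φ ^ ((m : ℕ) + 1) else 0) * 2 ^ (m : ℕ) ≤
      if (Φ.vbl a.1 ∩ Φ.vbl i).Nonempty then 6 * φ * 2 ^ (a.2.2 : ℕ) else 0 := by
    intro i
    split_ifs with hi
    · have h1 : ∀ m : Fin N, ∑ j : Fin N, (if Φ.Adj a.toNode (i, (j : ℕ), (m : ℕ)) then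
          φ ^ ((m : ℕ) + 1) else 0) * 2 ^ (m : ℕ) ≤
          3 * φ * 2 ^ (a.2.2 : ℕ) * (4 * φ) ^ (m : ℕ) := by
        intro m
        calc _ = ∑ j : Fin N, if (a.2.1 : ℕ) ≤ j + m + 1 ∧ (j : ℕ) ≤ a.2.1 + a.2.2 + 1 then
              φ ^ ((m : ℕ) + 1) * 2 ^ (m : ℕ) else 0 := by
              refine Finset.sum_congr rfl fun j _ => ?_
              rw [ite_mul, zero_mul]
              exact if_congr (and_iff_right hi) rfl rfl
          _ = ((Finset.univ.filter fun j : Fin N => (a.2.1 : ℕ) ≤ j + m + 1 ∧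
              (j : ℕ) ≤ a.2.1 + a.2.2 + 1).card : ℝ) * (φ ^ ((m : ℕ) + 1) * 2 ^ (m : ℕ)) := by
              rw [← Finset.sum_filter, Finset.sum_const, nsmul_eq_mul]
          _ ≤ (3 * 2 ^ (a.2.2 : ℕ) * 2 ^ (m : ℕ)) * (φ ^ ((m : ℕ) + 1) * 2 ^ (m : ℕ)) := by
              refine mul_le_mul_of_nonneg_right (card_blocks_le _ _ _ _) (by positivity)
          _ = _ := by
              rw [mul_pow, show (4 : ℝ) = 2 * 2 by norm_num, mul_pow]; ring
      refine (Finset.sum_le_sum fun m _ => h1 m).trans ?_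
      rw [← Finset.mul_sum]
      have := sum_pow_fin_le N (q := 4 * φ) (by positivity) (by linarith)
      calc _ ≤ 3 * φ * 2 ^ (a.2.2 : ℕ) * 2 := by gcongr
        _ = _ := by ring
    · refine (Finset.sum_eq_zero fun m _ => Finset.sum_eq_zero fun j _ => ?_).le
      rw [if_neg fun h => hi h.1, zero_mul]
  calc _ = ∑ i : ι, ∑ m : Fin N, ∑ j : Fin N, (if Φ.Adj a.toNode (i, (j : ℕ), (m : ℕ)) then
      φ ^ ((m : ℕ) + 1) else 0) * 2 ^ (m : ℕ) := by
        rw [Fintype.sum_prod_type]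
        refine Finset.sum_congr rfl fun i _ => ?_
        rw [Fintype.sum_prod_type_right]
        rfl
    _ ≤ ∑ i : ι, if (Φ.vbl a.1 ∩ Φ.vbl i).Nonempty then 6 * φ * 2 ^ (a.2.2 : ℕ) else 0 :=
        Finset.sum_le_sum fun i _ => hin i
    _ = ((Finset.univ.filter fun i => (Φ.vbl a.1 ∩ Φ.vbl i).Nonempty).card : ℝ) *
        (6 * φ * 2 ^ (a.2.2 : ℕ)) := by
        rw [← Finset.sum_filter, Finset.sum_const, nsmul_eq_mul]
    _ ≤ Φ.degree * (6 * φ * 2 ^ (a.2.2 : ℕ)) := by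
        gcongr
        exact_mod_cast Finset.le_sup (f := fun i => (Finset.univ.filter
          fun j => (Φ.vbl i ∩ Φ.vbl j).Nonempty).card) (Finset.mem_univ a.1)
    _ = 6 * (φ * Φ.degree) * 2 ^ (a.2.2 : ℕ) := by ring
    _ ≤ _ := by rw [hφD]; gcongr; norm_num

/-- The weight of the possible initial nodes of a path, with the potential `2 ^ m`. -/
theorem sum_top_le (hD : (1 : ℝ) ≤ Φ.degree) (N : ℕ) :
    ∑ a : BoundedNode ι N, (if (a.2.1 : ℕ) + a.2.2 + 1 = N then
        ((300 * (Φ.degree : ℝ))⁻¹) ^ ((a.2.2 : ℕ) + 1) else 0) * 2 ^ (a.2.2 : ℕ) ≤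
      Fintype.card ι := by
  set φ : ℝ := (300 * (Φ.degree : ℝ))⁻¹ with hφ
  have hφ0 : 0 ≤ φ := by positivity
  have hφD : φ * Φ.degree = 1 / 300 := by rw [hφ]; field_simp
  have hφ1 : φ ≤ 1 / 300 := by nlinarith
  have hin : ∀ m : Fin N, ∑ j : Fin N, (if (j : ℕ) + m + 1 = N then
      φ ^ ((m : ℕ) + 1) else 0) * 2 ^ (m : ℕ) ≤ φ * (2 * φ) ^ (m : ℕ) := by
    intro m
    have hcard : (Finset.univ.filter fun j : Fin N => (j : ℕ) + m + 1 = N).card ≤ 1 := by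
      refine Finset.card_le_one.2 fun j hj j' hj' => Fin.ext ?_
      have h1 := (Finset.mem_filter.1 hj).2
      have h2 := (Finset.mem_filter.1 hj').2
      omega
    calc _ = ((Finset.univ.filter fun j : Fin N => (j : ℕ) + m + 1 = N).card : ℝ) *
          (φ * (2 * φ) ^ (m : ℕ)) := by
          rw [← nsmul_eq_mul, ← Finset.sum_const, Finset.sum_filter]
          refine Finset.sum_congr rfl fun j _ => ?_
          rw [ite_mul, zero_mul]
          congr 1
          rw [mul_pow]; ring
      _ ≤ 1 * (φ * (2 * φ) ^ (m : ℕ)) := by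
          gcongr
          exact_mod_cast hcard
      _ = _ := one_mul _
  calc _ = ∑ _i : ι, ∑ m : Fin N, ∑ j : Fin N, (if (j : ℕ) + m + 1 = N then
      φ ^ ((m : ℕ) + 1) else 0) * 2 ^ (m : ℕ) := by
        rw [Fintype.sum_prod_type]
        refine Finset.sum_congr rfl fun i _ => ?_
        rw [Fintype.sum_prod_type_right]
    _ ≤ ∑ _i : ι, (1 : ℝ) := by
        refine Finset.sum_le_sum fun i _ => (Finset.sum_le_sum fun m _ => hin m).trans ?_
        rw [← Finset.mul_sum]
        have := sum_pow_fin_le N (q := 2 * φ) (by positivity) (by linarith)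
        nlinarith
    _ = _ := by simp

end Paths

section PathProbability

variable [Fintype V] [∀ v, Fintype (Ω v)] [Fintype ι] [∀ v, Fintype (Q v)]
variable {Φ : AtomicCSP V Ω ι} {π : ∀ v, Ω v → Q v} {η κ : ℝ} {w T J₀ J₁ : ℕ}

omit [Fintype V] [∀ v, Fintype (Ω v)] [Fintype ι] in
theorem Adj.symm {z z' : Node ι} (hz : Φ.Adj z z') : Φ.Adj z' z :=
  ⟨by rw [Finset.inter_comm]; exact hz.1, hz.2.2, hz.2.1⟩

omit [∀ v, Fintype (Ω v)] in
theorem IsAdmissible.card_constraints_le (h : Φ.IsAdmissible π η κ) :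
    (Fintype.card ι : ℝ) ≤ Fintype.card V * Φ.degree := by
  have h1 : (Finset.univ : Finset ι) ⊆
      Finset.univ.biUnion fun v : V => Finset.univ.filter fun i => v ∈ Φ.vbl i := fun i _ => by
    obtain ⟨v, hv⟩ := h.vbl_nonempty i
    exact Finset.mem_biUnion.2 ⟨v, Finset.mem_univ v, Finset.mem_filter.2 ⟨Finset.mem_univ i, hv⟩⟩
  have h2 := (Finset.card_le_card h1).trans (Finset.card_biUnion_le_card_mul _ _ Φ.degree
    fun v _ => Φ.card_mem_vbl_le_degree v)
  rw [Finset.card_univ, Finset.card_univ] at h2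
  exact_mod_cast h2

variable [Nonempty ι] (h : Φ.IsAdmissible π η κ) (hη : η < 1 / 2) (hΩ : ∀ v, Nonempty (Ω v))
include h hη hΩ

/-- The probability that all nodes of an induced path occur. The nodes with even index are pairwise
non-adjacent, and so are those with odd index; the geometric mean of the two resulting bounds
involves every node. -/
theorem IsAdmissible.pairE_path_le (hn : 2 ≤ Fintype.card V) (hw0 : 0 < w)
    (hw : κ * Fintype.card V ≤ w) (hw' : (w : ℝ) ≤ κ * Fintype.card V + 1)
    {k : ℕ} (y : Fin (k + 1) → Node ι) (hy1 : ∀ i, 1 ≤ (y i).2.1)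
    (hyT : ∀ i, ((y i).2.1 + (y i).2.2 + 1) * w ≤ T)
    (hind : ∀ i j : Fin (k + 1), (i : ℕ) + 1 < j → ¬ Φ.Adj (y i) (y j)) (r₀ : V)
    (z₀ : (∀ v, Q v) × (∀ v, Q v)) :
    Φ.pairE π T r₀ z₀ (fun r ω => if ∀ i, Φ.Occurs π w r ω (y i) then 1 else 0) ≤
      ∏ i, ((30000 * (Φ.degree : ℝ))⁻¹) ^ ((y i).2.2 + 1) := by
  set θ : ℝ := (30000 * (Φ.degree : ℝ))⁻¹ with hθ
  set X := Φ.pairE π T r₀ z₀ (fun r ω => if ∀ i, Φ.Occurs π w r ω (y i) then 1 else 0)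
  have hθ0 : 0 ≤ θ := by positivity
  have hpar : ∀ p : Fin (k + 1) → Prop, (∀ i j, p i → p j → i ≠ j → (i : ℕ) + 1 ≠ j) →
      X ≤ ∏ i : {i // p i}, (θ ^ ((y i).2.2 + 1)) ^ 2 := by
    intro p hp
    refine le_trans (h.pairE_mono hη hΩ r₀ z₀ (G := fun r ω =>
      if ∀ i : {i // p i}, Φ.Occurs π w r ω (y i) then 1 else 0) fun r ω _ => ?_)
      ((h.pairE_occurs_le hη hΩ hn hw0 (fun i : {i // p i} => y i) (fun i => hy1 i)
        (fun i => hyT i) (fun i j hij hadj => ?_) r₀ z₀).trans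
        (Finset.prod_le_prod (fun i _ => ?_)
          fun i _ => h.nodeWeight_le_pow hη hΩ hn hw hw' (y i)))
    · by_cases ho : ∀ i, Φ.Occurs π w r ω (y i)
      · rw [if_pos ho, if_pos fun i => ho _]
      · rw [if_neg ho]; split_ifs <;> norm_num
    · have hij' : (i : Fin (k + 1)) ≠ j := fun h => hij (Subtype.ext h)
      have h1 := hp i j i.2 j.2 hij'
      have h2 := hp j i j.2 i.2 hij'.symm
      have h3 : ((i : Fin (k + 1)) : ℕ) ≠ (j : Fin (k + 1)) := fun h => hij' (Fin.ext h)
      rcases lt_or_gt_of_ne h3 with hlt | hlt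
      · exact hind i j (by omega) hadj
      · exact hind j i (by omega) hadj.symm
    · refine mul_nonneg zero_le_two (Finset.sum_nonneg fun o _ => Finset.prod_nonneg fun u _ => ?_)
      have hf := h.forbidBound_pos hη hΩ (y i).1 u
      have hζ := one_le_zeta (Φ := Φ) (π := π) (y i).1
      have hc : 0 ≤ 1 - (Fintype.card V : ℝ)⁻¹ := by
        have := inv_le_one_of_one_le₀ (by exact_mod_cast (by omega : 1 ≤ Fintype.card V) :
          (1 : ℝ) ≤ Fintype.card V)
        linarith
      split_ifs <;> positivity
  have h1 := hpar (fun i => Even (i : ℕ)) fun i j hi hj _ hij => by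
    rw [← hij] at hj
    exact Nat.even_add_one.1 hj hi
  have h2 := hpar (fun i => ¬ Even (i : ℕ)) fun i j hi hj _ hij => by
    rw [← hij, Nat.even_add_one] at hj
    exact hj hi
  have hX0 : 0 ≤ X := by
    refine (le_of_eq ?_).trans (h.pairE_mono hη hΩ r₀ z₀ (F := fun _ _ => 0)
      fun r ω _ => by split_ifs <;> norm_num)
    have hV : Nonempty V := ⟨r₀⟩
    rw [h.pairE_schedule hη hΩ (fun _ => 0)]
    exact (iterE_const sum_scheduleKernel _ _ _ _).symm
  have h3 : X ^ 2 ≤ (∏ i, θ ^ ((y i).2.2 + 1)) ^ 2 := by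
    rw [← Finset.prod_pow, ← Fintype.prod_subtype_mul_prod_subtype (fun i : Fin (k + 1) =>
      Even (i : ℕ)), sq]
    refine mul_le_mul (h1.trans_eq ?_) (h2.trans_eq ?_) hX0
      (Finset.prod_nonneg fun i _ => by positivity)
    all_goals exact Finset.prod_congr (Finset.ext fun i => by simp) fun i _ => rfl
  exact (pow_le_pow_iff_left₀ hX0 (Finset.prod_nonneg fun i _ => by positivity) two_ne_zero).1 h3

/-- The probability that the nodes reached from time `J₁ w` lead to a block below `J₀`. -/
theorem IsAdmissible.pairE_reached_le (hn : 2 ≤ Fintype.card V) (hw0 : 0 < w)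
    (hw : κ * Fintype.card V ≤ w) (hw' : (w : ℝ) ≤ κ * Fintype.card V + 1)
    (hJT : J₁ * w ≤ T) (r₀ : V) (z₀ : (∀ v, Q v) × (∀ v, Q v)) :
    Φ.pairE π T r₀ z₀ (fun r ω => if ∃ z, Φ.Reached π w J₁ r ω z ∧ z.2.1 < J₀ then 1 else 0) ≤
      2 * (Fintype.card V * Φ.degree) * (1 / 100) ^ (J₁ - J₀) := by
  have hD := h.one_le_degree
  let α := BoundedNode ι J₁
  let good : ∀ k, (Fin (k + 1) → α) → Prop := fun k y =>
    ((y 0).2.1 : ℕ) + (y 0).2.2 + 1 = J₁ ∧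
    (∀ i : Fin k, Φ.Adj (y i.castSucc).toNode (y i.succ).toNode) ∧
    (∀ i, 1 ≤ ((y i).2.1 : ℕ) ∧ ((y i).2.1 : ℕ) + (y i).2.2 + 1 ≤ J₁) ∧
    (∀ i j : Fin (k + 1), (i : ℕ) + 1 < j → ¬ Φ.Adj (y i).toNode (y j).toNode) ∧
    J₁ - J₀ ≤ ∑ i, (((y i).2.2 : ℕ) + 1)
  let K := Fintype.card α
  have step1 : ∀ (r : ℕ → V) ω, (∃ z, Φ.Reached π w J₁ r ω z ∧ z.2.1 < J₀) →
      ∃ k < K, ∃ y : Fin (k + 1) → α, good k y ∧ ∀ i, Φ.Occurs π w r ω (y i).toNode := by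
    rintro r ω ⟨z, ⟨k, x, ⟨htop, hx, hadj⟩, rfl⟩, hbot⟩
    obtain ⟨k, x, htop, hbot, hx, hadj, hind, hinj⟩ := exists_induced_path (R := Φ.Adj)
      (P := fun z => Φ.Occurs π w r ω z ∧ 1 ≤ z.2.1 ∧ z.2.1 + z.2.2 + 1 ≤ J₁)
      (A := fun z => z.2.1 + z.2.2 + 1 = J₁) (B := fun z => z.2.1 < J₀)
      ⟨k, x, htop, hbot, hx, hadj⟩
    have hlt : ∀ i : Fin (k + 1), (i : ℕ) ≤ k := fun i => Nat.lt_succ_iff.1 i.2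
    let y : Fin (k + 1) → α := fun i => ((x i).1,
      ⟨(x i).2.1, by have := (hx i (hlt i)).2.2; omega⟩,
      ⟨(x i).2.2, by have := (hx i (hlt i)).2.2; omega⟩)
    have hy : ∀ i, (y i).toNode = x i := fun i => rfl
    have hyinj : Function.Injective y := fun i j hij => by
      have hxy : x i = x j := by rw [← hy, ← hy, hij]
      rcases lt_trichotomy (i : ℕ) j with hlt' | heq | hlt'
      · exact absurd hxy (hinj i j hlt' (hlt j))
      · exact Fin.ext heq
      · exact absurd hxy.symm (hinj j i hlt' (hlt i))
    have hcard := Fintype.card_le_of_injective y hyinj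
    rw [Fintype.card_fin] at hcard
    refine ⟨k, hcard, y, ⟨htop, fun i => ?_, fun i => (hx i (hlt i)).2, fun i j hij => ?_, ?_⟩,
      fun i => ?_⟩
    · rw [hy, hy]; exact hadj i i.2
    · rw [hy, hy]; exact hind i j hij (hlt j)
    · have := le_add_sum_of_adj htop hbot hadj
      rw [Fin.sum_univ_eq_sum_range (fun i => (x i).2.2 + 1)]
      omega
    · rw [hy]; exact (hx i (hlt i)).1
  have step2 : Φ.pairE π T r₀ z₀
      (fun r ω => if ∃ z, Φ.Reached π w J₁ r ω z ∧ z.2.1 < J₀ then 1 else 0) ≤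
      ∑ k ∈ Finset.range K, ∑ y : Fin (k + 1) → α with good k y,
        ∏ i, ((30000 * (Φ.degree : ℝ))⁻¹) ^ (((y i).2.2 : ℕ) + 1) := by
    refine le_trans (h.pairE_mono hη hΩ r₀ z₀ (G := fun r ω => ∑ k ∈ Finset.range K,
      ∑ y : Fin (k + 1) → α with good k y,
        if ∀ i, Φ.Occurs π w r ω (y i).toNode then 1 else 0) fun r ω _ => ?_) ?_
    · have hnn : ∀ k, ∀ y : Fin (k + 1) → α,
          (0 : ℝ) ≤ if ∀ i, Φ.Occurs π w r ω (y i).toNode then 1 else 0 := fun k y => by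
        split_ifs <;> norm_num
      by_cases hr : ∃ z, Φ.Reached π w J₁ r ω z ∧ z.2.1 < J₀
      · rw [if_pos hr]
        obtain ⟨k, hk, y, hy, ho⟩ := step1 r ω hr
        refine le_trans ?_ (Finset.single_le_sum (f := fun k => ∑ y : Fin (k + 1) → α with good k y,
          if ∀ i, Φ.Occurs π w r ω (y i).toNode then (1 : ℝ) else 0)
          (fun k _ => Finset.sum_nonneg fun y _ => hnn k y) (Finset.mem_range.2 hk))
        refine le_trans ?_ (Finset.single_le_sum (fun y _ => hnn k y)
          (Finset.mem_filter.2 ⟨Finset.mem_univ y, hy⟩))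
        rw [if_pos ho]
      · rw [if_neg hr]
        exact Finset.sum_nonneg fun k _ => Finset.sum_nonneg fun y _ => hnn k y
    · rw [pairE_sum]
      refine Finset.sum_le_sum fun k _ => ?_
      rw [pairE_sum]
      refine Finset.sum_le_sum fun y hy => ?_
      obtain ⟨-, -, hy1, hy2, -⟩ := (Finset.mem_filter.1 hy).2
      exact h.pairE_path_le hη hΩ hn hw0 hw hw' (fun i => (y i).toNode) (fun i => (hy1 i).1)
        (fun i => (Nat.mul_le_mul_right w (hy1 i).2).trans hJT) hy2 r₀ z₀
  -- A factor `1 / 100` for each block covered is split off; the rest is summable over paths.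
  set φ : ℝ := (300 * (Φ.degree : ℝ))⁻¹ with hφ
  have hφ0 : 0 ≤ φ := by positivity
  have hθ : (30000 * (Φ.degree : ℝ))⁻¹ = 1 / 100 * φ := by
    rw [hφ, show (30000 * (Φ.degree : ℝ)) = 100 * (300 * Φ.degree) by ring, mul_inv, one_div]
  let F : α → ℝ := fun a => if (a.2.1 : ℕ) + a.2.2 + 1 = J₁ then φ ^ ((a.2.2 : ℕ) + 1) else 0
  let M : α → α → ℝ := fun a b => if Φ.Adj a.toNode b.toNode then φ ^ ((b.2.2 : ℕ) + 1) else 0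
  have hF : ∀ a, 0 ≤ F a := fun a => by simp only [F]; split_ifs <;> positivity
  have hM : ∀ a b, 0 ≤ M a b := fun a b => by simp only [M]; split_ifs <;> positivity
  have step3 : ∀ k, ∑ y : Fin (k + 1) → α with good k y,
      ∏ i, ((30000 * (Φ.degree : ℝ))⁻¹) ^ (((y i).2.2 : ℕ) + 1) ≤
      (1 / 100) ^ (J₁ - J₀) * ((1 / 2) ^ k * (Fintype.card V * Φ.degree)) := by
    intro k
    calc _ ≤ ∑ y : Fin (k + 1) → α with good k y, (1 / 100) ^ (J₁ - J₀) *
          (F (y 0) * ∏ i : Fin k, M (y i.castSucc) (y i.succ)) := by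
          refine Finset.sum_le_sum fun y hy => ?_
          obtain ⟨hy0, hyadj, -, -, hylen⟩ := (Finset.mem_filter.1 hy).2
          simp_rw [hθ, mul_pow]
          rw [Finset.prod_mul_distrib, Finset.prod_pow_eq_pow_sum]
          refine mul_le_mul (pow_le_pow_of_le_one (by norm_num) (by norm_num) hylen)
            (le_of_eq ?_) (Finset.prod_nonneg fun i _ => by positivity) (by positivity)
          rw [Fin.prod_univ_succ]
          simp only [F, M, hy0, hyadj, if_true]
      _ ≤ ∑ y : Fin (k + 1) → α, (1 / 100) ^ (J₁ - J₀) *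
          (F (y 0) * ∏ i : Fin k, M (y i.castSucc) (y i.succ)) := by
          refine Finset.sum_le_sum_of_subset_of_nonneg (Finset.filter_subset _ _) fun y _ _ => ?_
          exact mul_nonneg (by positivity)
            (mul_nonneg (hF _) (Finset.prod_nonneg fun i _ => hM _ _))
      _ ≤ _ := by
          rw [← Finset.mul_sum]
          refine mul_le_mul_of_nonneg_left ?_ (by positivity)
          refine (sum_path_le hF hM (G := fun a : α => 2 ^ (a.2.2 : ℕ))
            (fun a => one_le_pow₀ one_le_two) (sum_adj_le hD J₁) k).trans ?_
          exact mul_le_mul_of_nonneg_left ((sum_top_le hD J₁).trans h.card_constraints_le)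
            (by positivity)
  refine step2.trans ((Finset.sum_le_sum fun k _ => step3 k).trans ?_)
  rw [← Finset.mul_sum, ← Finset.sum_mul]
  have h2 := sum_geometric_two_le K
  calc _ ≤ (1 / 100 : ℝ) ^ (J₁ - J₀) * (2 * (Fintype.card V * Φ.degree)) := by gcongr
    _ = _ := by ring

end PathProbability

end AtomicCSP

/-! ### Coalescence -/

namespace AtomicCSP

variable {V : Type u₁} {Ω : V → Type u₂} {ι : Type u₃} {Q : V → Type u₄}
variable [Fintype V] [∀ v, Fintype (Ω v)] [Fintype ι] [∀ v, Fintype (Q v)]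
variable {Φ : AtomicCSP V Ω ι} {π : ∀ v, Ω v → Q v} {η κ : ℝ} {w T J₀ J₁ : ℕ}
variable [Nonempty ι] (h : Φ.IsAdmissible π η κ) (hη : η < 1 / 2) (hΩ : ∀ v, Nonempty (Ω v))
include h hη hΩ

/-- The probability that some variable is not updated between the times `a` and `b`. -/
theorem IsAdmissible.pairE_not_updated_le (hn : 2 ≤ Fintype.card V) {a b : ℕ} (hb : b ≤ T) (r₀ : V)
    (z₀ : (∀ v, Q v) × (∀ v, Q v)) :
    Φ.pairE π T r₀ z₀ (fun r _ => if ∃ u, ∀ s, a ≤ s → s < b → r (s + 1) ≠ u then 1 else 0) ≤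
      Fintype.card V * (1 - (Fintype.card V : ℝ)⁻¹) ^ (b - a) := by
  refine (h.pairE_mono hη hΩ r₀ z₀ (G := fun r _ => ∑ u : V,
    if ∀ s, a ≤ s → s < b → r (s + 1) ≠ u then 1 else 0) fun r ω _ => ?_).trans ?_
  · split_ifs with hr
    · obtain ⟨u, hu⟩ := hr
      refine le_trans ?_ (Finset.single_le_sum (fun v _ => ?_) (Finset.mem_univ u))
      · rw [if_pos hu]
      · split_ifs <;> norm_num
    · exact Finset.sum_nonneg fun v _ => by split_ifs <;> norm_num
  · rw [pairE_sum]
    refine (Finset.sum_le_card_nsmul _ _ ((1 - (Fintype.card V : ℝ)⁻¹) ^ (b - a))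
      fun u _ => ?_).trans_eq (by rw [Finset.card_univ, nsmul_eq_mul])
    have hV : Nonempty V := ⟨r₀⟩
    rw [h.pairE_schedule hη hΩ (fun r => if ∀ s, a ≤ s → s < b → r (s + 1) ≠ u then 1 else 0)]
    refine le_trans (le_of_eq ?_) ((iterE_schedule_le hn (∅ : Finset V) {u} (fun v => v)
      (fun _ => 0) (fun _ => Finset.Ico a b) T (by simp)
      (fun v _ t ht => (Finset.mem_Ico.1 ht).2.trans_le hb) (by simp)
      (fun v _ v' _ hv _ _ _ => hv) fun _ => r₀).trans_eq ?_)
    · congr 1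
      funext r
      congr 1
      simp
    · simp

/-- The chains have coalesced unless some variable is not updated in the blocks from `1` to
`J₀ - 1`, or after time `J₁ w`, or the discrepancies percolate from block `J₁` down to block
`J₀`. -/
theorem IsAdmissible.pairE_ne_le (hn : 2 ≤ Fintype.card V) (hw0 : 0 < w)
    (hw : κ * Fintype.card V ≤ w) (hw' : (w : ℝ) ≤ κ * Fintype.card V + 1)
    (hJ : J₀ ≤ J₁) (hJT : J₁ * w ≤ T) (r₀ : V) (z₀ : (∀ v, Q v) × (∀ v, Q v)) :
    Φ.pairE π T r₀ z₀ (fun _ ω => if (ω T).1 ≠ (ω T).2 then 1 else 0) ≤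
      Fintype.card V * (1 - (Fintype.card V : ℝ)⁻¹) ^ (J₀ * w - w) +
      Fintype.card V * (1 - (Fintype.card V : ℝ)⁻¹) ^ (T - J₁ * w) +
      2 * (Fintype.card V * Φ.degree) * (1 / 100) ^ (J₁ - J₀) := by
  refine le_trans ?_ (add_le_add (add_le_add
    (h.pairE_not_updated_le hη hΩ hn ((Nat.mul_le_mul_right w hJ).trans hJT) r₀ z₀)
    (h.pairE_not_updated_le hη hΩ hn le_rfl r₀ z₀))
    (h.pairE_reached_le hη hΩ hn hw0 hw hw' (J₀ := J₀) hJT r₀ z₀))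
  rw [← pairE_add, ← pairE_add]
  refine h.pairE_mono hη hΩ r₀ z₀ fun r ω hf => ?_
  by_cases h1 : ∃ u, ∀ s, w ≤ s → s < J₀ * w → r (s + 1) ≠ u
  · rw [if_pos h1]; split_ifs <;> norm_num
  by_cases h2 : ∃ u, ∀ s, J₁ * w ≤ s → s < T → r (s + 1) ≠ u
  · rw [if_pos h2]; split_ifs <;> norm_num
  by_cases h3 : ∃ z, Φ.Reached π w J₁ r ω z ∧ z.2.1 < J₀
  · rw [if_pos h3]; split_ifs <;> norm_num
  push Not at h1 h2
  rw [if_neg]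
  · split_ifs <;> norm_num
  rw [not_not]
  exact h.eq_of_not_relevant hη hΩ hf hJT h2 fun u hu =>
    h3 (h.exists_reached hη hΩ hf hw0 hJ hJT h1 _ le_rfl u hu (Or.inl rfl))

end AtomicCSP

/-- The number of steps suffices for blocks of length `w`, with `l ≥ L` blocks at the beginning and
at the end, and `2 l` blocks between them. -/
theorem block_count_le {κ n L w l : ℝ} (hκ : 1 ≤ κ) (hn : 1 ≤ n) (hL : 1 ≤ L) (hl0 : 0 ≤ l)
    (hw : w ≤ κ * n + 1) (hl : l ≤ L + 1) : (4 * l + 1) * w ≤ 20 * κ * n * L := by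
  have h1 : 1 ≤ κ * n := one_le_mul_of_one_le_of_one_le hκ hn
  calc (4 * l + 1) * w ≤ (9 * L) * (2 * (κ * n)) := by
        refine (mul_le_mul_of_nonneg_left (by linarith : w ≤ 2 * (κ * n)) (by linarith)).trans
          (mul_le_mul_of_nonneg_right (by linarith) (by linarith))
    _ ≤ 20 * κ * n * L := by
        nlinarith [mul_nonneg (zero_le_one.trans h1) (zero_le_one.trans hL)]

/-- The final estimate, in terms of `x = δ / (n Δ)`. -/
theorem four_mul_pow_le {n D δ : ℝ} (hn : 2 ≤ n) (hD : 1 ≤ D) (hδ : 0 < δ) (hδ' : δ < 1 / 2) :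
    4 * (n * D) * (δ / (n * D)) ^ 8 ≤ δ ^ 4 := by
  have hnD : 2 ≤ n * D := by nlinarith
  set x := δ / (n * D) with hx
  have hx0 : 0 ≤ x := by positivity
  have hxδ : n * D * x = δ := by rw [hx]; field_simp
  have hx1 : x ≤ δ / 2 := by
    rw [hx]; exact div_le_div_of_nonneg_left hδ.le two_pos hnD
  calc 4 * (n * D) * x ^ 8 = 4 * (n * D * x) * x ^ 7 := by ring
    _ = 4 * δ * x ^ 3 * x ^ 4 := by rw [hxδ]; ring
    _ ≤ 4 * (1 / 2) * (1 / 2) ^ 3 * δ ^ 4 := by gcongr <;> linarith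
    _ ≤ δ ^ 4 := by nlinarith [pow_pos hδ 4]

end

open scoped Classical in
theorem proposition4p2 :
    ∃ c C : ℝ, 1 ≤ c ∧ 1 ≤ C ∧
      ∀ (V : Type u₁) (Ω : V → Type u₂) (ι : Type u₃) (Q : V → Type u₄)
        [Fintype V] [∀ v, Fintype (Ω v)] [∀ v, Nontrivial (Ω v)]
        [Fintype ι] [Nonempty ι] [∀ v, Fintype (Q v)]
        (Φ : AtomicCSP V Ω ι) (π : ∀ v, Ω v → Q v) (η κ : ℝ),
        0 < η → η < 1 / 2 → Φ.IsAdmissible π η κ →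
        c ≤ (Fintype.card V : ℝ) →
        ∀ (Y₀ : ∀ v, Q v) (δ : ℝ), 0 < δ → δ < 1 / 2 →
          tvDist
            (Φ.glauberLaw π Y₀
              ⌈C * κ * Fintype.card V * Real.log (Fintype.card V * Φ.degree / δ)⌉₊)
            (Φ.projMeasure π) ≤ δ ^ 4 := by
  refine ⟨2, 20, by norm_num, by norm_num, ?_⟩
  intro V Ω ι Q _ _ _ _ _ _ Φ π η κ _ hη h hc Y₀ δ hδ hδ'
  have hn : 2 ≤ Fintype.card V := by exact_mod_cast hc
  obtain ⟨r₀⟩ : Nonempty V := Fintype.card_pos_iff.1 (by omega)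
  have hV : Nonempty V := ⟨r₀⟩
  have hΩ : ∀ v, Nonempty (Ω v) := fun v => inferInstance
  have hD := h.one_le_degree
  obtain ⟨hκ, -⟩ := h.kappa_bounds
  set n : ℝ := (Fintype.card V : ℝ) with hn_def
  set D : ℝ := (Φ.degree : ℝ) with hD_def
  set L := Real.log (n * D / δ) with hL_def
  have hnD : 2 ≤ n * D := by nlinarith
  have hexpL : Real.exp (-L) = δ / (n * D) := by
    rw [Real.exp_neg, hL_def, Real.exp_log (by positivity), inv_div]
  have hL : 1 ≤ L := by
    rw [hL_def, Real.le_log_iff_exp_le (by positivity), le_div_iff₀ hδ]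
    have := Real.exp_one_lt_three
    nlinarith [Real.exp_pos 1]
  set T := ⌈20 * κ * n * L⌉₊ with hT_def
  -- Blocks have length `w`. The blocks `1, …, l` precede block `J₀ = l + 1`, another `2 l` lead to
  -- block `J₁ = 3 l + 1`, and the time after its beginning is still at least `l w`.
  set w := ⌈κ * n⌉₊ with hw_def
  set l := ⌈L⌉₊ with hl_def
  have hw : κ * n ≤ w := Nat.le_ceil _
  have hw' : (w : ℝ) ≤ κ * n + 1 := (Nat.ceil_lt_add_one (by positivity)).le
  have hw0 : 0 < w := Nat.ceil_pos.2 (by positivity)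
  have hl : L ≤ l := Nat.le_ceil _
  have hl' : (l : ℝ) ≤ L + 1 := (Nat.ceil_lt_add_one (by linarith)).le
  have hT : (4 * l + 1) * w ≤ T := by
    have h1 := (block_count_le (by linarith : 1 ≤ κ) (by linarith : 1 ≤ n) hL l.cast_nonneg hw'
      hl').trans (Nat.le_ceil _)
    exact_mod_cast h1
  have hT' : l * w + (3 * l + 1) * w ≤ T := by linarith
  refine h.tvDist_glauberLaw_le hη hΩ T Y₀ r₀ fun Z => ?_
  refine (h.pairE_ne_le hη hΩ hn hw0 hw hw' (J₀ := l + 1) (J₁ := 3 * l + 1) (by omega)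
    (le_trans (Nat.le_add_left _ _) hT') r₀ (Y₀, Z)).trans ?_
  rw [← hn_def, ← hD_def]
  set x := δ / (n * D) with hx
  -- Both `e ^ (-κ l)` and `100 ^ (-2 l)` are at most `e ^ (-8 L) = x ^ 8`.
  have hx8 : Real.exp (-8) ^ l ≤ x ^ 8 := by
    rw [← hexpL, ← Real.exp_nat_mul, ← Real.exp_nat_mul, Real.exp_le_exp]
    push_cast; linarith
  have hninv : n⁻¹ ≤ 1 := inv_le_one_of_one_le₀ (by linarith)
  have hninv0 : 0 < n⁻¹ := by positivity
  have hstay : ∀ k, l * w ≤ k → (1 - n⁻¹) ^ k ≤ x ^ 8 := fun k hk => by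
    calc (1 - n⁻¹) ^ k ≤ (1 - n⁻¹) ^ (l * w) :=
          pow_le_pow_of_le_one (by linarith) (by linarith) hk
      _ = ((1 - n⁻¹) ^ w) ^ l := by rw [mul_comm, pow_mul]
      _ ≤ Real.exp (-8) ^ l := by
          refine pow_le_pow_left₀ (pow_nonneg (by linarith) _) ?_ l
          refine (AtomicCSP.one_sub_inv_pow_le hn hw).trans ?_
          rw [Real.exp_le_exp]; linarith
      _ ≤ x ^ 8 := hx8
  have hperc : (1 / 100 : ℝ) ^ (3 * l + 1 - (l + 1)) ≤ x ^ 8 := by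
    rw [show 3 * l + 1 - (l + 1) = 2 * l by omega, pow_mul]
    refine (pow_le_pow_left₀ (by norm_num) ?_ l).trans hx8
    have h1 : Real.exp 4 ≤ 100 := by
      have h2 : Real.exp 4 = Real.exp 1 ^ 4 := by rw [← Real.exp_nat_mul]; norm_num
      rw [h2]
      calc Real.exp 1 ^ 4 ≤ 3 ^ 4 := by gcongr; exact Real.exp_one_lt_three.le
        _ ≤ 100 := by norm_num
    have h3 : (1 / 100 : ℝ) ≤ Real.exp (-4) := by
      rw [Real.exp_neg, one_div]
      exact inv_anti₀ (Real.exp_pos 4) h1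
    calc (1 / 100 : ℝ) ^ 2 ≤ Real.exp (-4) ^ 2 := by gcongr
      _ = Real.exp (-8) := by rw [← Real.exp_nat_mul]; norm_num
  have hx0 : 0 ≤ x ^ 8 := by positivity
  have e1 := hstay ((l + 1) * w - w) (by rw [add_mul, one_mul, Nat.add_sub_cancel])
  have e2 := hstay (T - (3 * l + 1) * w) (Nat.le_sub_of_add_le hT')
  calc _ ≤ n * x ^ 8 + n * x ^ 8 + 2 * (n * D) * x ^ 8 := by gcongr
    _ ≤ 4 * (n * D) * x ^ 8 := by
        nlinarith [mul_nonneg (mul_nonneg (zero_le_two.trans hc) (sub_nonneg.2 hD)) hx0]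
    _ ≤ δ ^ 4 := four_mul_pow_le hc hD hδ hδ'
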